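/- Points of $S^n\subset\mathbb R^{n+1}$ are identified with null lines of the Minkowski space $\mathbb R^{n+1,1}$ via $x\mapsto\mathbb R(1,x)$, Möbius transformations with the action of Lorentz transformations on null lines, and $2$-spheres with the $4$-dimensional subspaces whose orthogonal complement is space-like; $\langle\cdot,\cdot\rangle$ is extended complex bilinearly. Let $M$ be a Riemann surface and let $f,\hat f:M\to S^n$ be smooth immersions, both conformal for the conformal structure of $M$ (regardless of orientation), with $f(p)\neq\hat f(p)$ for all $p$, which envelop a common $2$-sphere congruence $S$: for each $p$, $S(p)$ is a $2$-sphere through $f(p)$ and $\hat f(p)$, tangent there to $f$ and to $\hat f$ respectively (a solution of the generalized Blaschke problem). For lifts $Y,\hat Y$ of $f,\hat f$ and a complex coordinate $z$ put $$\frac{\theta}{2}=\frac{\langle Y_z\wedge Y,\hat Y_z\wedge\hat Y\rangle}{\langle Y\wedge\hat Y,Y\wedge\hat Y\rangle},\qquad \frac{\rho}{2}=\frac{\langle Y_{\bar z}\wedge Y,\hat Y_z\wedge\hat Y\rangle}{\langle Y\wedge\hat Y,Y\wedge\hat Y\rangle};$$ their vanishing at a point does not depend on the choices. For a single surface $f$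 and a coordinate $z$, let $Y$ be its canonical lift (the forward lift with $|dY|^2=|dz|^2$), $V=\mathrm{span}\{Y,dY,Y_{z\bar z}\}$ the mean curvature sphere, $\kappa=Y_{zz}+\frac s2Y\in V^\perp\otimes\mathbb C$ the Hopf differential, $s$ the Schwarzian, and $D$ the normal connection on $V^\perp$. The surface is Willmore if $D_{\bar z}D_{\bar z}\kappa+\frac{\bar s}2\kappa=0$, and S-Willmore if in addition $\kappa$ and $D_{\bar z}\kappa$ are linearly dependent at each point. The pair $f,\hat f$ is a Darboux pair (of isothermic surfaces) if it is a solution of the Blaschke problem as above, both surfaces induce the same orientation on each $S(p)$, and near each point there is a holomorphic coordinate $z$ in which both Hopf differentials are real and, for the canonical lift $Y$ of $f$ and the lift $\hat Y$ of $\hat f$ with $\langle Y,\hat Y\rangle=-1$, the Darboux equation $\hat Y_z\equiv t\,(Y_{\bar z}+\langle Y_{\bar z},\hat Y\rangle Y)\pmod{\hat Y}$ holds with a real constant $t\ne0$. Then: 0. At every point of $M$ exactly one of $\rho=0$, $\theta=0$ holds. 1. (Isothermic case.) At every point $p$ with $\rho(p)=0$ the orientations that $f$ and $\hat f$ (with the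 orientation of $M$) induce on $S(p)$ are equal. If $\rho=0$ on $M$, then $f,\hat f$ form a Darboux pair. 2. (S-Willmore case.) At every point $p$ with $\theta(p)=0$ the orientations that $f$ and $\hat f$ induce on $S(p)$ are opposite. If $\theta=0$ on $M$, then: at each $p$ such that $\hat f$ is not the composition of $f$ with a Möbius transformation on any neighbourhood of $p$ (the non-trivial situation), $S(p)$ is the mean curvature sphere of both $f$ and $\hat f$ at $p$; and on every open set on which $S$ is the mean curvature sphere congruence of $f$, it is also that of $\hat f$, and both $f$ and $\hat f$ are S-Willmore there. -/

import Mathlib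

open scoped Manifold ContDiff

noncomputable section

namespace MoebiusSurf

/-! ## The light-cone model -/

/-- The round sphere `S^n`. -/
abbrev Sph (n : ℕ) : Type := Metric.sphere (0 : EuclideanSpace ℝ (Fin (n + 1))) 1

/-- The Minkowski space `ℝ^{n+1,1}`; the coordinate of index `0` is the time coordinate. -/
abbrev Mink (n : ℕ) : Type := Fin (n + 2) → ℝ

/-- The complexified Minkowski space. -/
abbrev MinkC (n : ℕ) : Type := Fin (n + 2) → ℂ

/-- The Lorentz product over `ℝ`, and its complex bilinear extension over `ℂ`. -/
def lor {K : Type*} [CommRing K] {n : ℕ} (x y : Fin (n + 2) → K) : K :=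
  -(x 0 * y 0) + ∑ i : Fin (n + 1), x i.succ * y i.succ

/-- Inclusion of the real vectors in the complexification. -/
def toC {n : ℕ} (x : Mink n) : MinkC n := fun i => (x i : ℂ)

/-- Complex conjugation of vectors. -/
def conjV {n : ℕ} (x : MinkC n) : MinkC n := fun i => (starRingEnd ℂ) (x i)

/-- The vector is real. -/
def IsRealV {n : ℕ} (x : MinkC n) : Prop := ∀ i, (x i).im = 0

/-- The forward null vector `(1, x)` that represents the point `x` of `S^n`. -/
def nullLift {n : ℕ} (x : Sph n) : Mink n :=
  Fin.cons 1 (fun i => (x : EuclideanSpace ℝ (Fin (n + 1))) i)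

/-- Forward time-like vectors. -/
def IsFutureTimelike {n : ℕ} (T : Mink n) : Prop := lor T T < 0 ∧ 0 < T 0

/-- A 2-sphere in `S^n` is a 4-dimensional subspace of Minkowski space whose orthogonal complement
is space-like (equivalently, a 4-dimensional subspace of signature `(3,1)`); its points are the null
lines that it contains. -/
def IsTwoSphere {n : ℕ} (W : Submodule ℝ (Mink n)) : Prop :=
  Module.finrank ℝ W = 4 ∧ ∀ x : Mink n, (∀ w ∈ W, lor x w = 0) → x ≠ 0 → 0 < lor x x

/-- Orientations of the 2-sphere `W` are identified with orientations of the 4-space `W`.  The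
oriented contact element with null vector `X` (forward) and oriented tangent frame `X₁, X₂` of the
sphere at that point orients `W` by the frames `(X, T, X₁, X₂)` with `T` forward time-like. -/
def InducesOrientation {n : ℕ} (W : Submodule ℝ (Mink n)) (o : Orientation ℝ W (Fin 4))
    (X X₁ X₂ : Mink n) : Prop :=
  ∃ (T : Mink n) (b : Module.Basis (Fin 4) ℝ W), IsFutureTimelike T ∧
    (∀ i, (b i : Mink n) = ![X, T, X₁, X₂] i) ∧ b.orientation = o

/-! ## Derivatives in a complex coordinate `z = u + i v` -/

/-- `∂/∂u`. -/
def du {E : Type*} [NormedAddCommGroup E] [NormedSpace ℝ E] (F : ℂ → E) (z : ℂ) : E :=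
  fderiv ℝ F z 1

/-- `∂/∂v`. -/
def dv {E : Type*} [NormedAddCommGroup E] [NormedSpace ℝ E] (F : ℂ → E) (z : ℂ) : E :=
  fderiv ℝ F z Complex.I

/-- `∂/∂z`. -/
def dz {n : ℕ} (F : ℂ → MinkC n) (z : ℂ) : MinkC n :=
  (1 / 2 : ℂ) • (du F z - Complex.I • dv F z)

/-- `∂/∂z̄`. -/
def dzb {n : ℕ} (F : ℂ → MinkC n) (z : ℂ) : MinkC n :=
  (1 / 2 : ℂ) • (du F z + Complex.I • dv F z)

/-! ## Invariants of a surface in a coordinate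

`F` is the expression of a real lift of a conformal immersion in a complex coordinate. -/

/-- The canonical lift `Y`: the positive multiple of the forward lift `F` with `|dY|² = |dz|²`. -/
def canonicalLift {n : ℕ} (F : ℂ → Mink n) (z : ℂ) : MinkC n :=
  toC ((Real.sqrt (lor (du F z) (du F z)))⁻¹ • F z)

/-- The null section `N` of `V` with `⟨N, Y⟩ = -1` and `⟨N, Y_z⟩ = 0`, explicitly
`N = 2 Y_{z z̄} + 2 ⟨Y_{z z̄}, Y_{z z̄}⟩ Y`. -/
def frameN {n : ℕ} (F : ℂ → Mink n) (z : ℂ) : MinkC n :=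
  (2 : ℂ) • dzb (dz (canonicalLift F)) z +
    (2 * lor (dzb (dz (canonicalLift F)) z) (dzb (dz (canonicalLift F)) z)) • canonicalLift F z

/-- The Schwarzian `s`, the function for which `Y_{zz} + (s/2) Y` is orthogonal to `V`. -/
def schwarzian {n : ℕ} (F : ℂ → Mink n) (z : ℂ) : ℂ :=
  2 * lor (dz (dz (canonicalLift F)) z) (frameN F z)

/-- The normal valued Hopf differential `κ = Y_{zz} + (s/2) Y`. -/
def hopf {n : ℕ} (F : ℂ → Mink n) (z : ℂ) : MinkC n :=
  dz (dz (canonicalLift F)) z + (schwarzian F z / 2) • canonicalLift F z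

/-- Orthogonal projection to the complexified normal bundle `V^⊥`, with
`V = span {Y, Y_z, Y_z̄, N}`. -/
def normalProj {n : ℕ} (F : ℂ → Mink n) (z : ℂ) (x : MinkC n) : MinkC n :=
  x + lor x (frameN F z) • canonicalLift F z + lor x (canonicalLift F z) • frameN F z
    - (2 * lor x (dzb (canonicalLift F) z)) • dz (canonicalLift F) z
    - (2 * lor x (dz (canonicalLift F) z)) • dzb (canonicalLift F) z

/-- The normal connection `D_z̄` on sections of the complexified normal bundle. -/
def normalDzb {n : ℕ} (F : ℂ → Mink n) (ψ : ℂ → MinkC n) (z : ℂ) : MinkC n :=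
  normalProj F z (dzb ψ z)

/-- The Willmore equation `D_z̄ D_z̄ κ + (s̄/2) κ = 0` at `z`. -/
def WillmoreEq {n : ℕ} (F : ℂ → Mink n) (z : ℂ) : Prop :=
  normalDzb F (normalDzb F (hopf F)) z + ((starRingEnd ℂ) (schwarzian F z) / 2) • hopf F z = 0

/-- The multiple `Ŷ` of the second lift `G` with `⟨Y, Ŷ⟩ = -1`, where `Y` is the canonical lift
of the first surface. -/
def normalizedPartner {n : ℕ} (F G : ℂ → Mink n) (z : ℂ) : MinkC n :=
  (-(lor (canonicalLift F z) (toC (G z)))⁻¹) • toC (G z)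

/-! ## Invariants of a pair of surfaces -/

/-- The inner product `⟨a ∧ b, c ∧ d⟩` of bivectors. -/
def biv {n : ℕ} (a b c d : MinkC n) : ℂ := lor a c * lor b d - lor a d * lor b c

/-- The coefficient `θ` in a coordinate:
`θ/2 = ⟨F_z ∧ F, G_z ∧ G⟩ / ⟨F ∧ G, F ∧ G⟩`, for any lifts `F`, `G` of the two surfaces. -/
def thetaCoord {n : ℕ} (F G : ℂ → Mink n) (z : ℂ) : ℂ :=
  2 * (biv (dz (fun w => toC (F w)) z) (toC (F z)) (dz (fun w => toC (G w)) z) (toC (G z)) /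
    biv (toC (F z)) (toC (G z)) (toC (F z)) (toC (G z)))

/-- The coefficient `ρ` in a coordinate:
`ρ/2 = ⟨F_z̄ ∧ F, G_z ∧ G⟩ / ⟨F ∧ G, F ∧ G⟩`, for any lifts `F`, `G` of the two surfaces. -/
def rhoCoord {n : ℕ} (F G : ℂ → Mink n) (z : ℂ) : ℂ :=
  2 * (biv (dzb (fun w => toC (F w)) z) (toC (F z)) (dz (fun w => toC (G w)) z) (toC (G z)) /
    biv (toC (F z)) (toC (G z)) (toC (F z)) (toC (G z)))

/-! ## Surfaces on a Riemann surface -/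

section Surfaces

variable {M : Type*} [TopologicalSpace M] [ChartedSpace ℂ M] {n : ℕ}

/-- The lift `(1, f)` in the coordinate `e`. -/
def coordLift (f : M → Sph n) (e : OpenPartialHomeomorph M ℂ) (z : ℂ) : Mink n :=
  nullLift (f (e.symm z))

/-- The lift `(1, f)` in the preferred coordinate around `p`. -/
def liftAt (f : M → Sph n) (p : M) : ℂ → Mink n := coordLift f (chartAt ℂ p)

/-- The coordinate of `p`. -/
def pt (p : M) : ℂ := chartAt ℂ p p

/-- The value of `θ` at `p` (its vanishing does not depend on the coordinate). -/
def theta (f g : M → Sph n) (p : M) : ℂ := thetaCoord (liftAt f p) (liftAt g p) (pt p)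

/-- The value of `ρ` at `p` (its vanishing does not depend on the coordinate). -/
def rho (f g : M → Sph n) (p : M) : ℂ := rhoCoord (liftAt f p) (liftAt g p) (pt p)

/-- Smooth immersions that are conformal for the conformal structure of `M`
(nothing is said about orientation). -/
structure IsConformalImmersion (f : M → Sph n) : Prop where
  smooth : ContMDiff 𝓘(ℝ, ℂ) 𝓘(ℝ, EuclideanSpace ℝ (Fin (n + 1))) ∞
    (fun p => (f p : EuclideanSpace ℝ (Fin (n + 1))))
  immersion : ∀ p, LinearIndependent ℝ ![du (liftAt f p) (pt p), dv (liftAt f p) (pt p)]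
  isometric_axes : ∀ p, lor (du (liftAt f p) (pt p)) (du (liftAt f p) (pt p)) =
    lor (dv (liftAt f p) (pt p)) (dv (liftAt f p) (pt p))
  orthogonal_axes : ∀ p, lor (du (liftAt f p) (pt p)) (dv (liftAt f p) (pt p)) = 0

/-- The surface `f` envelops the 2-sphere congruence `S`: `S p` is a 2-sphere through `f p` that is
tangent to `f` there. -/
def Envelops (f : M → Sph n) (S : M → Submodule ℝ (Mink n)) : Prop :=
  ∀ p, IsTwoSphere (S p) ∧ nullLift (f p) ∈ S p ∧
    du (liftAt f p) (pt p) ∈ S p ∧ dv (liftAt f p) (pt p) ∈ S p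

/-- Solutions of the generalized Blaschke problem: two immersed surfaces, different at corresponding
points and inducing the same conformal structure, that envelop a common 2-sphere congruence. -/
structure IsBlaschkeSolution (f g : M → Sph n) (S : M → Submodule ℝ (Mink n)) : Prop where
  conformal_left : IsConformalImmersion f
  conformal_right : IsConformalImmersion g
  distinct : ∀ p, f p ≠ g p
  envelops_left : Envelops f S
  envelops_right : Envelops g S

/-- `f` induces the orientation `o` on the 2-sphere `W` tangent to it at `f p`; the coordinate frame
`∂/∂u, ∂/∂v` is positively oriented in `M`. -/
def SurfaceInduces (f : M → Sph n) (p : M) (W : Submodule ℝ (Mink n))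
    (o : Orientation ℝ W (Fin 4)) : Prop :=
  InducesOrientation W o (nullLift (f p)) (du (liftAt f p) (pt p)) (dv (liftAt f p) (pt p))

/-- The two surfaces induce the same orientation on the common tangent sphere `W`. -/
def CompatibleOrientations (f g : M → Sph n) (p : M) (W : Submodule ℝ (Mink n)) : Prop :=
  ∃ o : Orientation ℝ W (Fin 4), SurfaceInduces f p W o ∧ SurfaceInduces g p W o

/-- The two surfaces induce opposite orientations on the common tangent sphere `W`. -/
def OppositeOrientations (f g : M → Sph n) (p : M) (W : Submodule ℝ (Mink n)) : Prop :=
  ∃ o : Orientation ℝ W (Fin 4), SurfaceInduces f p W o ∧ SurfaceInduces g p W (-o)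

/-- The mean curvature sphere `V = span {F, dF, F_{z z̄}}` of `f` at `p`. -/
def meanCurvatureSphere (f : M → Sph n) (p : M) : Submodule ℝ (Mink n) :=
  Submodule.span ℝ {liftAt f p (pt p), du (liftAt f p) (pt p), dv (liftAt f p) (pt p),
    du (du (liftAt f p)) (pt p) + dv (dv (liftAt f p)) (pt p)}

/-- The S-Willmore condition at `p`: the Willmore equation holds and `κ`, `D_z̄ κ` are linearly
dependent. -/
def IsSWillmoreAt (f : M → Sph n) (p : M) : Prop :=
  WillmoreEq (liftAt f p) (pt p) ∧
    ¬ LinearIndependent ℂ ![hopf (liftAt f p) (pt p),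
      normalDzb (liftAt f p) (hopf (liftAt f p)) (pt p)]

/-- Near `p`, the map `g` is the composition of `f` with a Möbius transformation, that is, with the
action of a Lorentz transformation on null lines. -/
def MoebiusCongruentNear (f g : M → Sph n) (p : M) : Prop :=
  ∃ L : Mink n ≃ₗ[ℝ] Mink n, (∀ x y, lor (L x) (L y) = lor x y) ∧
    ∃ U : Set M, IsOpen U ∧ p ∈ U ∧
      ∀ q ∈ U, ∃ c : ℝ, c ≠ 0 ∧ L (nullLift (f q)) = c • nullLift (g q)

/-- The surfaces `f`, `g` form a Darboux pair of isothermic surfaces with enveloped 2-sphere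
congruence `S`: they envelop `S`, induce the same conformal structure and the same orientation on the
spheres of `S`, and around each point there is a holomorphic coordinate in which both Hopf
differentials are real (both surfaces are isothermic and their curvature lines correspond) and in
which the Darboux equation `Ŷ_z ≡ t (Y_z̄ + ⟨Y_z̄, Ŷ⟩ Y)  mod Ŷ` holds with a nonzero real constant
`t` (the spectral parameter). -/
structure IsDarbouxPair [IsManifold 𝓘(ℂ, ℂ) ω M]
    (f g : M → Sph n) (S : M → Submodule ℝ (Mink n)) : Prop where
  solution : IsBlaschkeSolution f g S
  compatible : ∀ p, CompatibleOrientations f g p (S p)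
  darboux : ∀ p, ∃ e ∈ IsManifold.maximalAtlas 𝓘(ℂ, ℂ) ω M, p ∈ e.source ∧
    ∃ t : ℝ, t ≠ 0 ∧ ∀ z ∈ e.target,
      IsRealV (hopf (coordLift f e) z) ∧ IsRealV (hopf (coordLift g e) z) ∧
      ∃ a : ℂ, dz (normalizedPartner (coordLift f e) (coordLift g e)) z =
        a • normalizedPartner (coordLift f e) (coordLift g e) z +
          (t : ℂ) • (dzb (canonicalLift (coordLift f e)) z +
            lor (dzb (canonicalLift (coordLift f e)) z)
              (normalizedPartner (coordLift f e) (coordLift g e) z) •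
              canonicalLift (coordLift f e) z)

end Surfaces

end MoebiusSurf

end

noncomputable section

namespace MoebiusSurf

open Complex Filter Topology

/-! ## Algebra of the Lorentz product -/

section Algebra

variable {K : Type*} [CommRing K] {n : ℕ}

/-! In a holomorphic coordinate, rescale the lifts so that `Y` is canonical and `⟨Y, Z⟩ = -1`. Both
surfaces touch `S`, so `Z_z` lies in the complexified 4-space of `S`, which is spanned by `Y`, `Z`,
`P = Y_z + λ Y` and `P̄`, where `λ = ⟨Y_z, Z⟩`. This gives the structure equation `Z_z = λ Z + ρ P +
θ P̄` (`dz_partner`). Since `P` is isotropic and `⟨P, P̄⟩ = 1/2`, conformality of `Z` reads `ρ θ =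
0`, while `ρ = θ = 0` would make `Z_z` a multiple of `Z`. Modulo `Y` and `Z`, the derivative `Z_z`
is therefore a nonzero multiple of `Y_z̄` (if `ρ = 0`) or of `Y_z` (if `θ = 0`). Exchanging the two
null lines in the frame of the 4-space reverses the orientation once more, so the induced
orientations agree in the first case and are opposite in the second.

Everything else comes from the integrability condition `(Z_z)_z̄ = (Z_z̄)_z`.

If `ρ = 0`, its product with `P` says that `θ` is holomorphic (`dzb_theta_of_rho`). So `θ dz²` is a
holomorphic quadratic differential without zeros, and a primitive of its square root is a coordinate
in which `θ = 1`. There the structure equation is the Darboux equation with `t = 1`, and the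
remaining content of the condition is that `Y_zz` is real modulo `Y`, hence that `κ` is real. As `θ`
is symmetric in the two surfaces, the same holds for the other Hopf differential.

If `θ = 0`, the condition gives `ρ_z̄ = 2 λ̄ ρ` and puts `(ρ - ρ̄) Y_zz̄` into the complexified
sphere. Where `S` is not the mean curvature sphere, an open condition, `ρ` is thus real; then `E = Z
- ρ Y` satisfies `E_z = λ E` and `⟨E, E⟩ = 2 ρ`, so the reflection in `E^⊥` is constant, and it maps
`Y` to `ρ⁻¹ Z`: the surfaces are congruent (`exists_congruence`). Where `S` is the mean curvature
sphere on an open set, `Y_zz̄` is `Z / 2 - λ̄ Y_z - λ Y_z̄` modulo `Y`. Differentiating yields `D_z̄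
κ = -λ̄ κ` (`normal_dzb_hopfC`), and with `s / 2 = λ_z - λ²` a second derivative yields the Willmore
equation.

These computations transfer to `M` because `ρ` and `θ` do not depend on the lifts and change by
nonzero factors with the coordinate, and because the condition that `Y_zz̄` lies in the sphere
depends on neither. -/

lemma lor_comm (x y : Fin (n + 2) → K) : lor x y = lor y x := by
  simp [lor, mul_comm]

@[simp] lemma lor_add_left (x y w : Fin (n + 2) → K) : lor (x + y) w = lor x w + lor y w := by
  simp [lor, add_mul, Finset.sum_add_distrib]; ring

@[simp] lemma lor_smul_left (c : K) (x w : Fin (n + 2) → K) : lor (c • x) w = c * lor x w := by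
  simp [lor, mul_add, Finset.mul_sum, mul_assoc]

@[simp] lemma lor_add_right (x y w : Fin (n + 2) → K) : lor w (x + y) = lor w x + lor w y := by
  simp [lor_comm w]

@[simp] lemma lor_smul_right (c : K) (x w : Fin (n + 2) → K) : lor w (c • x) = c * lor w x := by
  simp [lor_comm w]

@[simp] lemma lor_neg_left (x w : Fin (n + 2) → K) : lor (-x) w = -lor x w := by
  simpa using lor_smul_left (-1) x w

@[simp] lemma lor_neg_right (x w : Fin (n + 2) → K) : lor w (-x) = -lor w x := by
  simp [lor_comm w]

@[simp] lemma lor_sub_left (x y w : Fin (n + 2) → K) : lor (x - y) w = lor x w - lor y w := by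
  simp [sub_eq_add_neg]

@[simp] lemma lor_sub_right (x y w : Fin (n + 2) → K) : lor w (x - y) = lor w x - lor w y := by
  simp [sub_eq_add_neg]

@[simp] lemma lor_zero_left (w : Fin (n + 2) → K) : lor 0 w = 0 := by simp [lor]

@[simp] lemma lor_zero_right (w : Fin (n + 2) → K) : lor w 0 = 0 := by simp [lor]

end Algebra

/-! ### Complexification of vectors and subspaces; nondegeneracy of 2-spheres. -/

variable {n : ℕ}

lemma lor_toC (x y : Mink n) : lor (toC x) (toC y) = ((lor x y : ℝ) : ℂ) := by
  simp [lor, toC]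

lemma lor_conjV (x y : MinkC n) : lor (conjV x) (conjV y) = (starRingEnd ℂ) (lor x y) := by
  simp [lor, conjV]

@[simp] lemma conjV_conjV (x : MinkC n) : conjV (conjV x) = x := by ext; simp [conjV]

@[simp] lemma conjV_add (x y : MinkC n) : conjV (x + y) = conjV x + conjV y := by
  ext; simp [conjV]

@[simp] lemma conjV_sub (x y : MinkC n) : conjV (x - y) = conjV x - conjV y := by
  ext; simp [conjV]

@[simp] lemma conjV_smul (c : ℂ) (x : MinkC n) : conjV (c • x) = (starRingEnd ℂ) c • conjV x := by
  ext; simp [conjV]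

@[simp] lemma conjV_toC (x : Mink n) : conjV (toC x) = toC x := by ext; simp [conjV, toC]

lemma toC_smul (r : ℝ) (x : Mink n) : toC (r • x) = (r : ℂ) • toC x := by ext; simp [toC]

lemma toC_add (x y : Mink n) : toC (x + y) = toC x + toC y := by ext; simp [toC]

lemma toC_sub (x y : Mink n) : toC (x - y) = toC x - toC y := by ext; simp [toC]

lemma toC_injective : Function.Injective (toC (n := n)) := by
  intro x y h
  ext i
  simpa [toC] using congrFun h i

lemma isRealV_of_conjV_eq {x : MinkC n} (h : conjV x = x) : IsRealV x := by
  intro i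
  exact Complex.conj_eq_iff_im.mp (congrFun h i)

/-- The real part of a complex vector. -/
def reV (x : MinkC n) : Mink n := fun i => (x i).re

/-- The imaginary part of a complex vector. -/
def imV (x : MinkC n) : Mink n := fun i => (x i).im

lemma toC_reV_add (x : MinkC n) : x = toC (reV x) + I • toC (imV x) := by
  ext i
  simp [toC, reV, imV, mul_comm I, Complex.re_add_im]

lemma toC_reV {x : MinkC n} (h : conjV x = x) : toC (reV x) = x := by
  ext i
  simpa [toC, reV] using Complex.conj_eq_iff_re.mp (congrFun h i)

@[simp] lemma reV_toC (x : Mink n) : reV (toC x) = x := by ext; simp [reV, toC]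

@[simp] lemma imV_toC (x : Mink n) : imV (toC x) = 0 := by ext; simp [imV, toC]

/-- The complexification of a real subspace. -/
def WC (W : Submodule ℝ (Mink n)) : Submodule ℂ (MinkC n) where
  carrier := {x | reV x ∈ W ∧ imV x ∈ W}
  add_mem' := by
    rintro x y ⟨h1, h2⟩ ⟨h3, h4⟩
    refine ⟨?_, ?_⟩
    · have : reV (x + y) = reV x + reV y := by ext; simp [reV]
      rw [this]; exact W.add_mem h1 h3
    · have : imV (x + y) = imV x + imV y := by ext; simp [imV]
      rw [this]; exact W.add_mem h2 h4
  zero_mem' := by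
    refine ⟨?_, ?_⟩
    · have : reV (0 : MinkC n) = 0 := by ext; simp [reV]
      rw [this]; exact W.zero_mem
    · have : imV (0 : MinkC n) = 0 := by ext; simp [imV]
      rw [this]; exact W.zero_mem
  smul_mem' := by
    rintro c x ⟨h1, h2⟩
    refine ⟨?_, ?_⟩
    · have : reV (c • x) = c.re • reV x - c.im • imV x := by ext; simp [reV, imV]
      rw [this]; exact W.sub_mem (W.smul_mem _ h1) (W.smul_mem _ h2)
    · have : imV (c • x) = c.re • imV x + c.im • reV x := by ext; simp [reV, imV]
      rw [this]; exact W.add_mem (W.smul_mem _ h2) (W.smul_mem _ h1)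

lemma mem_WC {W : Submodule ℝ (Mink n)} {x : MinkC n} :
    x ∈ WC W ↔ reV x ∈ W ∧ imV x ∈ W := Iff.rfl

@[simp] lemma toC_mem_WC {W : Submodule ℝ (Mink n)} {x : Mink n} : toC x ∈ WC W ↔ x ∈ W := by
  simp [mem_WC]

lemma conjV_mem_WC {W : Submodule ℝ (Mink n)} {x : MinkC n} (h : x ∈ WC W) : conjV x ∈ WC W := by
  refine ⟨?_, ?_⟩
  · have : reV (conjV x) = reV x := by ext; simp [reV, conjV]
    rw [this]; exact h.1
  · have : imV (conjV x) = -imV x := by ext; simp [imV, conjV]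
    rw [this]; exact W.neg_mem h.2

/-- Four vectors with the inner products of a null vector, two orthogonal non-null vectors
perpendicular to it, and a vector that is not orthogonal to the null vector, are independent. -/
lemma linearIndependent_of_lor {a b c d : Mink n} (haa : lor a a = 0) (hab : lor a b = 0)
    (hac : lor a c = 0) (hbc : lor b c = 0) (hbb : lor b b ≠ 0) (hcc : lor c c ≠ 0)
    (had : lor a d ≠ 0) : LinearIndependent ℝ ![a, b, c, d] := by
  rw [Fintype.linearIndependent_iff]
  intro g hg
  simp only [Fin.sum_univ_four, Matrix.cons_val] at hg
  have h3 : g 3 = 0 := by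
    have := congrArg (lor a) hg
    simpa [haa, hab, hac, had] using this
  have h1 : g 1 = 0 := by
    have := congrArg (lor b) hg
    simpa [lor_comm b a, hab, hbc, hbb, h3] using this
  have h2 : g 2 = 0 := by
    have := congrArg (lor c) hg
    simpa [lor_comm c a, lor_comm c b, hac, hbc, hcc, h3] using this
  have h0 : g 0 = 0 := by
    have := congrArg (fun x => lor x d) hg
    simpa [h1, h2, h3, had] using this
  intro i
  fin_cases i <;> assumption

lemma span_eq_of_linearIndependent {W : Submodule ℝ (Mink n)} (hW : Module.finrank ℝ W = 4)
    {a b c d : Mink n} (ha : a ∈ W) (hb : b ∈ W) (hc : c ∈ W) (hd : d ∈ W)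
    (h : LinearIndependent ℝ ![a, b, c, d]) : Submodule.span ℝ {a, b, c, d} = W := by
  have hr : Set.range ![a, b, c, d] = {a, b, c, d} := by
    simp only [Matrix.range_cons, Matrix.range_empty, Set.singleton_union, insert_empty_eq]
  apply Submodule.eq_of_le_of_finrank_eq
  · rw [Submodule.span_le]
    rintro x (rfl | rfl | rfl | rfl) <;> assumption
  · rw [← hr, finrank_span_eq_card h, hW]
    simp

/-- A vector of `W ∩ W^⊥` is null, while the product is positive definite on `W^⊥`; so the product
is nondegenerate on `W`. -/
lemma eq_zero_of_orthogonal {W : Submodule ℝ (Mink n)} (hW : IsTwoSphere W) {x : Mink n}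
    (hx : x ∈ W) (h : ∀ w ∈ W, lor x w = 0) : x = 0 := by
  by_contra h0
  exact absurd (hW.2 x h h0) (by simp [h x hx])

lemma eq_zero_of_orthogonal_span {W : Submodule ℝ (Mink n)} (hW : IsTwoSphere W)
    {a b c d x : Mink n} (hs : Submodule.span ℝ {a, b, c, d} = W) (hx : x ∈ W)
    (ha : lor x a = 0) (hb : lor x b = 0) (hc : lor x c = 0) (hd : lor x d = 0) : x = 0 := by
  refine eq_zero_of_orthogonal hW hx fun w hw => ?_
  rw [← hs] at hw
  induction hw using Submodule.span_induction with
  | mem y hy => rcases hy with rfl | rfl | rfl | rfl <;> assumption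
  | zero => simp
  | add y z _ _ hy hz => simp [hy, hz]
  | smul r y _ hy => simp [hy]

/-! ## Calculus of the operators `∂/∂z` and `∂/∂z̄` -/

/-- The operator `(∂/∂u - c ∂/∂v) / 2` on vector valued functions. -/
def vd (c : ℂ) (F : ℂ → MinkC n) (z : ℂ) : MinkC n := (1 / 2 : ℂ) • (du F z - c • dv F z)

/-- The operator `(∂/∂u - c ∂/∂v) / 2` on functions. -/
def wd (c : ℂ) (f : ℂ → ℂ) (z : ℂ) : ℂ := (1 / 2 : ℂ) * (fderiv ℝ f z 1 - c * fderiv ℝ f z I)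

/-- Each rule of calculus is proved once for the parameter `c`; `c = I` gives `∂/∂z` and `c = -I`
gives `∂/∂z̄`. -/
lemma dz_eq (F : ℂ → MinkC n) (z : ℂ) : dz F z = vd I F z := rfl

lemma dzb_eq (F : ℂ → MinkC n) (z : ℂ) : dzb F z = vd (-I) F z := by simp [dzb, vd]

lemma dzb_eq' : (dzb : (ℂ → MinkC n) → ℂ → MinkC n) = vd (-I) := by ext1 F; ext1 z; exact dzb_eq F z

lemma vd_apply (c : ℂ) {F : ℂ → MinkC n} {z : ℂ} (hF : DifferentiableAt ℝ F z) (i : Fin (n + 2)) :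
    vd c F z i = wd c (fun w => F w i) z := by
  have h : ∀ v, fderiv ℝ F z v i = fderiv ℝ (fun w => F w i) z v := by
    intro v
    have := (hasFDerivAt_pi'.mp hF.hasFDerivAt i).fderiv
    rw [this]; rfl
  simp [vd, wd, du, dv, h]

lemma wd_add (c : ℂ) {f g : ℂ → ℂ} {z : ℂ} (hf : DifferentiableAt ℝ f z)
    (hg : DifferentiableAt ℝ g z) : wd c (fun w => f w + g w) z = wd c f z + wd c g z := by
  simp only [wd, fderiv_fun_add hf hg, add_apply]; ring

lemma wd_neg (c : ℂ) (f : ℂ → ℂ) (z : ℂ) : wd c (fun w => - f w) z = - wd c f z := by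
  simp only [wd, fderiv_fun_neg, neg_apply]; ring

lemma wd_mul (c : ℂ) {f g : ℂ → ℂ} {z : ℂ} (hf : DifferentiableAt ℝ f z)
    (hg : DifferentiableAt ℝ g z) :
    wd c (fun w => f w * g w) z = wd c f z * g z + f z * wd c g z := by
  simp only [wd, fderiv_fun_mul hf hg, add_apply,
    smul_apply, smul_eq_mul]; ring

@[simp] lemma wd_const (c a : ℂ) (z : ℂ) : wd c (fun _ => a) z = 0 := by
  simp [wd]

lemma wd_sum (c : ℂ) {ι : Type*} (s : Finset ι) {f : ι → ℂ → ℂ} {z : ℂ}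
    (hf : ∀ i ∈ s, DifferentiableAt ℝ (f i) z) :
    wd c (fun w => ∑ i ∈ s, f i w) z = ∑ i ∈ s, wd c (f i) z := by
  simp only [wd, fderiv_fun_sum hf, sum_apply, Finset.mul_sum,
    ← Finset.sum_sub_distrib]

lemma wd_congr (c : ℂ) {f g : ℂ → ℂ} {z : ℂ} (h : f =ᶠ[𝓝 z] g) : wd c f z = wd c g z := by
  simp only [wd, h.fderiv_eq]

lemma vd_congr (c : ℂ) {F G : ℂ → MinkC n} {z : ℂ} (h : F =ᶠ[𝓝 z] G) : vd c F z = vd c G z := by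
  simp only [vd, du, dv, h.fderiv_eq]

lemma vd_add (c : ℂ) {F G : ℂ → MinkC n} {z : ℂ} (hF : DifferentiableAt ℝ F z)
    (hG : DifferentiableAt ℝ G z) : vd c (fun w => F w + G w) z = vd c F z + vd c G z := by
  simp only [vd, du, dv, fderiv_fun_add hF hG, add_apply]; module

lemma vd_sub (c : ℂ) {F G : ℂ → MinkC n} {z : ℂ} (hF : DifferentiableAt ℝ F z)
    (hG : DifferentiableAt ℝ G z) : vd c (fun w => F w - G w) z = vd c F z - vd c G z := by
  simp only [vd, du, dv, fderiv_fun_sub hF hG, sub_apply]; module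

lemma _root_.DifferentiableAt.coord {F : ℂ → MinkC n} {z : ℂ} (hF : DifferentiableAt ℝ F z)
    (i : Fin (n + 2)) : DifferentiableAt ℝ (fun w => F w i) z :=
  differentiableAt_pi.mp hF i

lemma _root_.DifferentiableAt.smulC {f : ℂ → ℂ} {F : ℂ → MinkC n} {z : ℂ} (hf : DifferentiableAt ℝ f z)
    (hF : DifferentiableAt ℝ F z) : DifferentiableAt ℝ (fun w => f w • F w) z :=
  differentiableAt_pi.mpr fun i => hf.mul (DifferentiableAt.coord hF i)

lemma vd_smul (c : ℂ) {f : ℂ → ℂ} {F : ℂ → MinkC n} {z : ℂ} (hf : DifferentiableAt ℝ f z)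
    (hF : DifferentiableAt ℝ F z) :
    vd c (fun w => f w • F w) z = wd c f z • F z + f z • vd c F z := by
  ext i
  rw [vd_apply c (DifferentiableAt.smulC hf hF)]
  simp only [Pi.smul_apply, Pi.add_apply, smul_eq_mul, vd_apply c hF]
  exact wd_mul c hf (DifferentiableAt.coord hF i)

lemma wd_lor (c : ℂ) {F G : ℂ → MinkC n} {z : ℂ} (hF : DifferentiableAt ℝ F z)
    (hG : DifferentiableAt ℝ G z) :
    wd c (fun w => lor (F w) (G w)) z = lor (vd c F z) (G z) + lor (F z) (vd c G z) := by
  have hm : ∀ i, DifferentiableAt ℝ (fun w => F w i * G w i) z := fun i =>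
    (DifferentiableAt.coord hF i).mul (DifferentiableAt.coord hG i)
  have h1 : ∀ i, wd c (fun w => F w i * G w i) z = vd c F z i * G z i + F z i * vd c G z i := by
    intro i
    rw [wd_mul c (DifferentiableAt.coord hF i) (DifferentiableAt.coord hG i), vd_apply c hF,
      vd_apply c hG]
  simp only [lor]
  rw [wd_add c (hm 0).fun_neg (DifferentiableAt.fun_sum fun i _ => hm _), wd_neg,
    wd_sum c _ (fun i _ => hm _), h1]
  simp only [h1, Finset.sum_add_distrib]
  ring

/-! ### Smoothness -/

lemma _root_.ContDiffAt.smulC {f : ℂ → ℂ} {F : ℂ → MinkC n} {z : ℂ} (hf : ContDiffAt ℝ ∞ f z)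
    (hF : ContDiffAt ℝ ∞ F z) : ContDiffAt ℝ ∞ (fun w => f w • F w) z :=
  contDiffAt_pi.mpr fun i => hf.mul (contDiffAt_pi.mp hF i)

lemma _root_.ContDiffAt.lorProd {F G : ℂ → MinkC n} {z : ℂ} (hF : ContDiffAt ℝ ∞ F z)
    (hG : ContDiffAt ℝ ∞ G z) : ContDiffAt ℝ ∞ (fun w => lor (F w) (G w)) z := by
  have hm : ∀ i, ContDiffAt ℝ ∞ (fun w => F w i * G w i) z := fun i =>
    (contDiffAt_pi.mp hF i).mul (contDiffAt_pi.mp hG i)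
  exact (hm 0).neg.add (ContDiffAt.sum fun i _ => hm _)

lemma _root_.ContDiffAt.vecDeriv (c : ℂ) {F : ℂ → MinkC n} {z : ℂ} (hF : ContDiffAt ℝ ∞ F z) :
    ContDiffAt ℝ ∞ (vd c F) z := by
  have h : ContDiffAt ℝ ∞ (fderiv ℝ F) z := hF.fderiv_right (by simp)
  have h1 : ∀ v, ContDiffAt ℝ ∞ (fun w => fderiv ℝ F w v) z := fun v =>
    h.clm_apply contDiffAt_const
  exact ContDiffAt.smulC contDiffAt_const ((h1 1).sub (ContDiffAt.smulC contDiffAt_const (h1 I)))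

lemma _root_.ContDiffAt.scalDeriv (c : ℂ) {f : ℂ → ℂ} {z : ℂ} (hf : ContDiffAt ℝ ∞ f z) :
    ContDiffAt ℝ ∞ (wd c f) z := by
  have h : ContDiffAt ℝ ∞ (fderiv ℝ f) z := hf.fderiv_right (by simp)
  have h1 : ∀ v, ContDiffAt ℝ ∞ (fun w => fderiv ℝ f w v) z := fun v =>
    h.clm_apply contDiffAt_const
  exact contDiffAt_const.mul ((h1 1).sub (contDiffAt_const.mul (h1 I)))

lemma _root_.ContDiffAt.conjC {f : ℂ → ℂ} {z : ℂ} (hf : ContDiffAt ℝ ∞ f z) :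
    ContDiffAt ℝ ∞ (fun w => (starRingEnd ℂ) (f w)) z :=
  (Complex.conjCLE.contDiff.contDiffAt).comp z hf

lemma _root_.ContDiffAt.diffAt {E : Type*} [NormedAddCommGroup E] [NormedSpace ℝ E] {F : ℂ → E} {z : ℂ}
    (hF : ContDiffAt ℝ ∞ F z) : DifferentiableAt ℝ F z :=
  hF.differentiableAt (by simp)

/-! ### Conjugation -/

lemma wd_conj (c : ℂ) {f : ℂ → ℂ} {z : ℂ} (hf : DifferentiableAt ℝ f z) :
    wd c (fun w => (starRingEnd ℂ) (f w)) z = (starRingEnd ℂ) (wd ((starRingEnd ℂ) c) f z) := by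
  have h := (Complex.conjCLE.toContinuousLinearMap.hasFDerivAt.comp z hf.hasFDerivAt).fderiv
  have h' : fderiv ℝ (fun w => (starRingEnd ℂ) (f w)) z =
      Complex.conjCLE.toContinuousLinearMap.comp (fderiv ℝ f z) := h
  simp [wd, h', map_ofNat]

lemma vd_conjV (c : ℂ) {F : ℂ → MinkC n} {z : ℂ} (hF : DifferentiableAt ℝ F z) :
    vd c (fun w => conjV (F w)) z = conjV (vd ((starRingEnd ℂ) c) F z) := by
  have h : DifferentiableAt ℝ (fun w => conjV (F w)) z :=
    differentiableAt_pi.mpr fun i => (Complex.conjCLE.differentiableAt).comp z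
      (DifferentiableAt.coord hF i)
  ext i
  rw [vd_apply c h]
  simp only [conjV]
  rw [wd_conj c (DifferentiableAt.coord hF i), vd_apply _ hF]

/-! ### Symmetry of second derivatives -/

/-- Both sides expand in the values of the second Fréchet derivative on `1` and `I`; the expansion
is symmetric in the two parameters once the mixed values agree. -/
lemma vd_comm (c d : ℂ) {F : ℂ → MinkC n} {z : ℂ} (hF : ContDiffAt ℝ ∞ F z) :
    vd c (vd d F) z = vd d (vd c F) z := by
  have hs : IsSymmSndFDerivAt ℝ F z := 
    hF.isSymmSndFDerivAt (by
      rw [minSmoothness_of_isRCLikeNormedField]; exact WithTop.coe_le_coe.mpr le_top)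
  have h : DifferentiableAt ℝ (fderiv ℝ F) z :=
    (hF.fderiv_right (m := ∞) (by simp)).differentiableAt (by simp)
  have key : ∀ a b : ℂ, vd a (vd b F) z = (1 / 4 : ℂ) •
      (fderiv ℝ (fderiv ℝ F) z 1 1 - b • fderiv ℝ (fderiv ℝ F) z 1 I -
        a • fderiv ℝ (fderiv ℝ F) z I 1 + (a * b) • fderiv ℝ (fderiv ℝ F) z I I) := by
    intro a b
    have hd : ∀ v, DifferentiableAt ℝ (fun w => fderiv ℝ F w v) z := fun v =>
      h.clm_apply (differentiableAt_const v)
    have h2 : ∀ v w, fderiv ℝ (fun y => fderiv ℝ F y v) z w = fderiv ℝ (fderiv ℝ F) z w v := by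
      intro v w
      rw [fderiv_clm_apply h (differentiableAt_const v)]
      simp
    have hI : DifferentiableAt ℝ (fun w => b • dv F w) z :=
      DifferentiableAt.smulC (differentiableAt_const b) (hd I)
    have e1 : vd a (vd b F) z = (1 / 2 : ℂ) • vd a (fun w => du F w - b • dv F w) z := by
      have := vd_smul a (f := fun _ => (1 / 2 : ℂ)) (F := fun w => du F w - b • dv F w)
        (differentiableAt_const _) ((hd 1).sub hI)
      rw [wd_const, zero_smul, zero_add] at this
      exact this
    rw [e1, vd_sub a (F := du F) (G := fun w => b • dv F w) (hd 1) hI,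
      vd_smul a (f := fun _ => b) (F := dv F) (differentiableAt_const _) (hd I), wd_const]
    have q1 : du (du F) z = fderiv ℝ (fderiv ℝ F) z 1 1 := h2 1 1
    have q2 : dv (du F) z = fderiv ℝ (fderiv ℝ F) z I 1 := h2 1 I
    have q3 : du (dv F) z = fderiv ℝ (fderiv ℝ F) z 1 I := h2 I 1
    have q4 : dv (dv F) z = fderiv ℝ (fderiv ℝ F) z I I := h2 I I
    simp only [vd, q1, q2, q3, q4]
    module
  rw [key, key]
  have : fderiv ℝ (fderiv ℝ F) z 1 I = fderiv ℝ (fderiv ℝ F) z I 1 := hs 1 I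
  rw [this]
  module

/-! ## Conformal lifts and pairs of lifts in a coordinate domain -/

/-- A real null lift, on a coordinate domain, of a conformal immersion enveloping `W`. -/
structure ConformalLift (U : Set ℂ) (Y : ℂ → MinkC n) (W : ℂ → Submodule ℝ (Mink n)) : Prop where
  isOpen : IsOpen U
  real : ∀ z, conjV (Y z) = Y z
  null : ∀ z, lor (Y z) (Y z) = 0
  smooth : ∀ z ∈ U, ContDiffAt ℝ ∞ Y z
  conf : ∀ z ∈ U, lor (dz Y z) (dz Y z) = 0
  imm : ∀ z ∈ U, lor (dz Y z) (dzb Y z) ≠ 0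
  mem : ∀ z ∈ U, Y z ∈ WC (W z)
  mem_dz : ∀ z ∈ U, dz Y z ∈ WC (W z)
  sphere : ∀ z ∈ U, IsTwoSphere (W z)

lemma dzb_eq_conjV_dz {Y : ℂ → MinkC n} (hr : ∀ z, conjV (Y z) = Y z) {z : ℂ}
    (hY : DifferentiableAt ℝ Y z) : dzb Y z = conjV (dz Y z) := by
  have h := vd_conjV (-I) hY
  rw [dzb_eq, dz_eq]
  simpa [hr] using h

lemma wd_eq_of_eqOn {U : Set ℂ} (hU : IsOpen U) (c : ℂ) {f g : ℂ → ℂ} (h : ∀ z ∈ U, f z = g z)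
    {z : ℂ} (hz : z ∈ U) : wd c f z = wd c g z :=
  wd_congr c (Filter.eventuallyEq_of_mem (hU.mem_nhds hz) h)

lemma vd_eq_of_eqOn {U : Set ℂ} (hU : IsOpen U) (c : ℂ) {f g : ℂ → MinkC n}
    (h : ∀ z ∈ U, f z = g z) {z : ℂ} (hz : z ∈ U) : vd c f z = vd c g z :=
  vd_congr c (Filter.eventuallyEq_of_mem (hU.mem_nhds hz) h)

/-- The derivative of the constant inner product of two vector fields vanishes. -/
lemma lor_vd_add_eq_zero {U : Set ℂ} (hU : IsOpen U) (c a : ℂ) {F G : ℂ → MinkC n}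
    (hF : ∀ z ∈ U, ContDiffAt ℝ ∞ F z) (hG : ∀ z ∈ U, ContDiffAt ℝ ∞ G z)
    (h : ∀ z ∈ U, lor (F z) (G z) = a) {z : ℂ} (hz : z ∈ U) :
    lor (vd c F z) (G z) + lor (F z) (vd c G z) = 0 := by
  rw [← wd_lor c (hF z hz).diffAt (hG z hz).diffAt, wd_eq_of_eqOn hU c h hz, wd_const]

namespace ConformalLift

variable {U : Set ℂ} {Y : ℂ → MinkC n} {W : ℂ → Submodule ℝ (Mink n)}

lemma dzb_eq_conjV (h : ConformalLift U Y W) {z : ℂ} (hz : z ∈ U) : dzb Y z = conjV (dz Y z) :=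
  dzb_eq_conjV_dz h.real (h.smooth z hz).diffAt

lemma dz_eq_conjV (h : ConformalLift U Y W) {z : ℂ} (hz : z ∈ U) : dz Y z = conjV (dzb Y z) := by
  rw [h.dzb_eq_conjV hz, conjV_conjV]

lemma smooth_dz (h : ConformalLift U Y W) {z : ℂ} (hz : z ∈ U) : ContDiffAt ℝ ∞ (dz Y) z :=
  (h.smooth z hz).vecDeriv I

lemma smooth_dzb (h : ConformalLift U Y W) {z : ℂ} (hz : z ∈ U) : ContDiffAt ℝ ∞ (dzb Y) z := by
  rw [dzb_eq']; exact (h.smooth z hz).vecDeriv (-I)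

lemma mem_dzb (h : ConformalLift U Y W) {z : ℂ} (hz : z ∈ U) : dzb Y z ∈ WC (W z) := by
  rw [h.dzb_eq_conjV hz]; exact conjV_mem_WC (h.mem_dz z hz)

lemma conf' (h : ConformalLift U Y W) {z : ℂ} (hz : z ∈ U) : lor (dzb Y z) (dzb Y z) = 0 := by
  rw [h.dzb_eq_conjV hz, lor_conjV, h.conf z hz, map_zero]

lemma lor_vd_self (h : ConformalLift U Y W) (c : ℂ) {z : ℂ} (hz : z ∈ U) :
    lor (Y z) (vd c Y z) = 0 := by
  have := lor_vd_add_eq_zero h.isOpen c 0 h.smooth h.smooth (fun z _ => h.null z) hz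
  rw [lor_comm] at this
  linear_combination this / 2

lemma lor_dz_self (h : ConformalLift U Y W) {z : ℂ} (hz : z ∈ U) : lor (Y z) (dz Y z) = 0 :=
  h.lor_vd_self I hz

lemma lor_dzb_self (h : ConformalLift U Y W) {z : ℂ} (hz : z ∈ U) : lor (Y z) (dzb Y z) = 0 := by
  rw [dzb_eq]; exact h.lor_vd_self (-I) hz

/-- The term `r_z Y` in the new derivative is null and orthogonal to `Y_z` and `Y_z̄`, so the
products of the derivatives are only multiplied by `r²`. -/
lemma rescale (h : ConformalLift U Y W) {r : ℂ → ℂ} (hr : ∀ z, (starRingEnd ℂ) (r z) = r z)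
    (hs : ∀ z ∈ U, ContDiffAt ℝ ∞ r z) (h0 : ∀ z ∈ U, r z ≠ 0) :
    ConformalLift U (fun z => r z • Y z) W := by
  have hd : ∀ z ∈ U, dz (fun z => r z • Y z) z = wd I r z • Y z + r z • dz Y z := fun z hz =>
    vd_smul I (hs z hz).diffAt (h.smooth z hz).diffAt
  have hdb : ∀ z ∈ U, dzb (fun z => r z • Y z) z = wd (-I) r z • Y z + r z • dzb Y z := by
    intro z hz
    rw [dzb_eq, dzb_eq]
    exact vd_smul (-I) (hs z hz).diffAt (h.smooth z hz).diffAt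
  have h1 := fun z hz => lor_comm (dz Y z) (Y z) ▸ h.lor_dz_self (z := z) hz
  refine ⟨h.isOpen, fun z => ?_, fun z => ?_, fun z hz => ?_, fun z hz => ?_, fun z hz => ?_,
    fun z hz => ?_, fun z hz => ?_, h.sphere⟩
  · rw [conjV_smul, hr, h.real]
  · simp [h.null]
  · exact ContDiffAt.smulC (hs z hz) (h.smooth z hz)
  · rw [hd z hz]
    simp [h.null, h1 z hz, h.lor_dz_self hz, h.conf z hz]
  · rw [hd z hz, hdb z hz]
    simp [h.null, h1 z hz, h.lor_dzb_self hz, h0 z hz, h.imm z hz]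
  · exact (WC (W z)).smul_mem _ (h.mem z hz)
  · rw [hd z hz]
    exact add_mem ((WC (W z)).smul_mem _ (h.mem z hz)) ((WC (W z)).smul_mem _ (h.mem_dz z hz))

/-- These are the real and imaginary parts of `⟨Y_z, Y_z⟩ = 0` and `⟨Y, Y_z⟩ = 0`, in the form
required by `linearIndependent_of_lor`. -/
lemma lor_real_parts (h : ConformalLift U Y W) {z : ℂ} (hz : z ∈ U) :
    lor (reV (dz Y z)) (reV (dz Y z)) = lor (imV (dz Y z)) (imV (dz Y z)) ∧
      lor (reV (dz Y z)) (imV (dz Y z)) = 0 ∧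
      lor (reV (dz Y z)) (reV (dz Y z)) ≠ 0 ∧
      lor (reV (Y z)) (reV (dz Y z)) = 0 ∧ lor (reV (Y z)) (imV (dz Y z)) = 0 := by
  set a := reV (dz Y z)
  set b := imV (dz Y z)
  have e1 : dz Y z = toC a + I • toC b := toC_reV_add _
  have e2 : dzb Y z = toC a - I • toC b := by
    rw [h.dzb_eq_conjV hz, e1]; simp [sub_eq_add_neg]
  have e3 : Y z = toC (reV (Y z)) := (toC_reV (h.real z)).symm
  have h1 := h.conf z hz
  have h2 := h.imm z hz
  have h3 := h.lor_dz_self hz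
  rw [e3] at h3
  rw [e1] at h1 h3
  rw [e2, e1] at h2
  simp only [lor_add_left, lor_add_right, lor_smul_left, lor_smul_right, lor_sub_right,
    lor_toC, lor_comm b a] at h1 h2 h3
  have k1 : lor a a - lor b b = 0 := by
    have := congrArg Complex.re h1
    simpa [sub_eq_add_neg] using this
  have k2 : lor a b + lor a b = 0 := by
    have := congrArg Complex.im h1
    simpa using this
  have k3 : lor (reV (Y z)) a = 0 := by
    have := congrArg Complex.re h3
    simpa using this
  have k4 : lor (reV (Y z)) b = 0 := by
    have := congrArg Complex.im h3
    simpa using this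
  refine ⟨by linarith, by linarith, ?_, k3, k4⟩
  intro h0
  apply h2
  have k5 : lor b b = 0 := by linarith
  have k6 : lor a b = 0 := by linarith
  simp [h0, k5, k6]

lemma lor_reV_null (h : ConformalLift U Y W) (z : ℂ) : lor (reV (Y z)) (reV (Y z)) = 0 := by
  have := h.null z
  rw [← toC_reV (h.real z), lor_toC] at this
  exact_mod_cast this

/-- A real vector of `W` that is not orthogonal to the lift completes the lift and its
differential to a basis of `W`. -/
lemma span_eq (h : ConformalLift U Y W) {z : ℂ} (hz : z ∈ U) {x : Mink n} (hx : x ∈ W z)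
    (hx0 : lor (reV (Y z)) x ≠ 0) :
    Submodule.span ℝ {reV (Y z), reV (dz Y z), imV (dz Y z), x} = W z := by
  obtain ⟨h1, h2, h3, h4, h5⟩ := h.lor_real_parts hz
  exact span_eq_of_linearIndependent (h.sphere z hz).1 (h.mem z hz).1 (h.mem_dz z hz).1
    (h.mem_dz z hz).2 hx
    (linearIndependent_of_lor (h.lor_reV_null z) h4 h5 h2 h3 (h1 ▸ h3) hx0)

end ConformalLift

/-- Lifts of a solution of the generalized Blaschke problem. -/
structure BlaschkeLifts (U : Set ℂ) (Y Z : ℂ → MinkC n) (W : ℂ → Submodule ℝ (Mink n)) :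
    Prop where
  left : ConformalLift U Y W
  right : ConformalLift U Z W
  ne : ∀ z ∈ U, lor (Y z) (Z z) ≠ 0

namespace BlaschkeLifts

variable {U : Set ℂ} {Y Z : ℂ → MinkC n} {W : ℂ → Submodule ℝ (Mink n)}

lemma swap (h : BlaschkeLifts U Y Z W) : BlaschkeLifts U Z Y W :=
  ⟨h.right, h.left, fun z hz => by rw [lor_comm]; exact h.ne z hz⟩

lemma mono (h : BlaschkeLifts U Y Z W) {V : Set ℂ} (hV : IsOpen V) (hVU : V ⊆ U) :
    BlaschkeLifts V Y Z W := by
  obtain ⟨⟨_, a1, a2, a3, a4, a5, a6, a7, a8⟩, ⟨_, b1, b2, b3, b4, b5, b6, b7, b8⟩, c⟩ := h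
  exact ⟨⟨hV, a1, a2, fun z hz => a3 z (hVU hz), fun z hz => a4 z (hVU hz),
    fun z hz => a5 z (hVU hz), fun z hz => a6 z (hVU hz), fun z hz => a7 z (hVU hz),
    fun z hz => a8 z (hVU hz)⟩, ⟨hV, b1, b2, fun z hz => b3 z (hVU hz), fun z hz => b4 z (hVU hz),
    fun z hz => b5 z (hVU hz), fun z hz => b6 z (hVU hz), fun z hz => b7 z (hVU hz),
    fun z hz => b8 z (hVU hz)⟩, fun z hz => c z (hVU hz)⟩

lemma rescale_left (h : BlaschkeLifts U Y Z W) {r : ℂ → ℂ}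
    (hr : ∀ z, (starRingEnd ℂ) (r z) = r z)
    (hs : ∀ z ∈ U, ContDiffAt ℝ ∞ r z) (h0 : ∀ z ∈ U, r z ≠ 0) :
    BlaschkeLifts U (fun z => r z • Y z) Z W :=
  ⟨h.left.rescale hr hs h0, h.right, fun z hz => by simp [h0 z hz, h.ne z hz]⟩

lemma rescale_right (h : BlaschkeLifts U Y Z W) {r : ℂ → ℂ}
    (hr : ∀ z, (starRingEnd ℂ) (r z) = r z)
    (hs : ∀ z ∈ U, ContDiffAt ℝ ∞ r z) (h0 : ∀ z ∈ U, r z ≠ 0) :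
    BlaschkeLifts U Y (fun z => r z • Z z) W :=
  (h.swap.rescale_left hr hs h0).swap

/-- A vector of the complexified sphere is determined by its inner products with the lifts and the
derivatives of the first one. -/
lemma eq_zero (h : BlaschkeLifts U Y Z W) {z : ℂ} (hz : z ∈ U) {x : MinkC n} (hx : x ∈ WC (W z))
    (h1 : lor x (Y z) = 0) (h2 : lor x (dz Y z) = 0) (h3 : lor x (dzb Y z) = 0)
    (h4 : lor x (Z z) = 0) : x = 0 := by
  have hne : lor (reV (Y z)) (reV (Z z)) ≠ 0 := by
    have := h.ne z hz
    rw [← toC_reV (h.left.real z), ← toC_reV (h.right.real z), lor_toC] at this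
    exact_mod_cast this
  have hs := h.left.span_eq hz (h.right.mem z hz).1 hne
  -- A real vector orthogonal to `x` is orthogonal to its real and imaginary parts separately, so
  -- the real nondegeneracy applies to each of them.
  have key : ∀ y : Mink n, lor x (toC y) = 0 → lor (reV x) y = 0 ∧ lor (imV x) y = 0 := by
    intro y hy
    rw [toC_reV_add x, lor_add_left, lor_smul_left, lor_toC, lor_toC] at hy
    exact ⟨by simpa using congrArg Complex.re hy, by simpa using congrArg Complex.im hy⟩
  have e1 := toC_reV_add (dz Y z)
  have e2 : dzb Y z = toC (reV (dz Y z)) - I • toC (imV (dz Y z)) := by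
    rw [h.left.dzb_eq_conjV hz]
    conv_lhs => rw [e1]
    simp [sub_eq_add_neg]
  have k1 := key _ ((toC_reV (h.left.real z)).symm ▸ h1)
  have k4 := key _ ((toC_reV (h.right.real z)).symm ▸ h4)
  rw [e1, lor_add_right, lor_smul_right] at h2
  rw [e2, lor_sub_right, lor_smul_right] at h3
  have k2 := key _ (by linear_combination (h2 + h3) / 2)
  have k3 := key (imV (dz Y z)) (by
    have : I * lor x (toC (imV (dz Y z))) = 0 := by linear_combination (h2 - h3) / 2
    simpa using this)
  have r1 := eq_zero_of_orthogonal_span (h.left.sphere z hz) hs hx.1 k1.1 k2.1 k3.1 k4.1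
  have r2 := eq_zero_of_orthogonal_span (h.left.sphere z hz) hs hx.2 k1.2 k2.2 k3.2 k4.2
  rw [toC_reV_add x, r1, r2]
  ext; simp [toC]

end BlaschkeLifts

/-! ## Normalized pairs -/

/-- The coefficient `λ = ⟨Y_z, Z⟩`. -/
def lam (Y Z : ℂ → MinkC n) (z : ℂ) : ℂ := lor (dz Y z) (Z z)

/-- The conjugate of `lam`. -/
def lamb (Y Z : ℂ → MinkC n) (z : ℂ) : ℂ := lor (dzb Y z) (Z z)

/-- The component `Y_z + ⟨Y_z, Z⟩ Y` of `Y_z` perpendicular to `Z`. -/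
def perp (Y Z : ℂ → MinkC n) (z : ℂ) : MinkC n := dz Y z + lam Y Z z • Y z

/-- The component `Y_z̄ + ⟨Y_z̄, Z⟩ Y` of `Y_z̄` perpendicular to `Z`. -/
def perpb (Y Z : ℂ → MinkC n) (z : ℂ) : MinkC n := dzb Y z + lamb Y Z z • Y z

/-- The coefficient of `Y_z + ⟨Y_z, Z⟩ Y` in `Z_z`. -/
def rhoC (Y Z : ℂ → MinkC n) (z : ℂ) : ℂ := 2 * lor (dz Z z) (perpb Y Z z)

/-- The coefficient of `Y_z̄ + ⟨Y_z̄, Z⟩ Y` in `Z_z`. -/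
def thetaC (Y Z : ℂ → MinkC n) (z : ℂ) : ℂ := 2 * lor (dz Z z) (perp Y Z z)

/-- Lifts `Y`, `Z` of a solution of the Blaschke problem with `|dY|² = |dz|²`, `⟨Y, Z⟩ = -1`. -/
structure NormalizedLifts (U : Set ℂ) (Y Z : ℂ → MinkC n) (W : ℂ → Submodule ℝ (Mink n)) : Prop
    extends BlaschkeLifts U Y Z W where
  metric : ∀ z ∈ U, lor (dz Y z) (dzb Y z) = 1 / 2
  pairing : ∀ z ∈ U, lor (Y z) (Z z) = -1

namespace NormalizedLifts

variable {U : Set ℂ} {Y Z : ℂ → MinkC n} {W : ℂ → Submodule ℝ (Mink n)}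

/-- All inner products of `Y, Y_z, Y_z̄, Z` and of `Z_z` with `Y, Z`. -/
lemma table (h : NormalizedLifts U Y Z W) {z : ℂ} (hz : z ∈ U) :
    (lor (Y z) (Y z) = 0 ∧ lor (Z z) (Z z) = 0 ∧ lor (Y z) (Z z) = -1 ∧ lor (Z z) (Y z) = -1) ∧
    (lor (Y z) (dz Y z) = 0 ∧ lor (Y z) (dzb Y z) = 0 ∧ lor (dz Y z) (Y z) = 0 ∧
      lor (dzb Y z) (Y z) = 0) ∧
    (lor (dz Y z) (dz Y z) = 0 ∧ lor (dzb Y z) (dzb Y z) = 0 ∧ lor (dz Y z) (dzb Y z) = 1 / 2 ∧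
      lor (dzb Y z) (dz Y z) = 1 / 2) ∧
    (lor (dz Y z) (Z z) = lam Y Z z ∧ lor (dzb Y z) (Z z) = lamb Y Z z ∧
      lor (Z z) (dz Y z) = lam Y Z z ∧ lor (Z z) (dzb Y z) = lamb Y Z z) ∧
    (lor (dz Z z) (Z z) = 0 ∧ lor (dzb Z z) (Z z) = 0 ∧
      lor (dz Z z) (Y z) = -lam Y Z z ∧ lor (dzb Z z) (Y z) = -lamb Y Z z) := by
  have hp := fun c => lor_vd_add_eq_zero h.left.isOpen c (-1) h.left.smooth h.right.smooth
    h.pairing hz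
  refine ⟨⟨h.left.null z, h.right.null z, h.pairing z hz, ?_⟩,
    ⟨h.left.lor_dz_self hz, h.left.lor_dzb_self hz, ?_, ?_⟩,
    ⟨h.left.conf z hz, h.left.conf' hz, h.metric z hz, ?_⟩, ⟨rfl, rfl, ?_, ?_⟩, ⟨?_, ?_, ?_, ?_⟩⟩
  · rw [lor_comm, h.pairing z hz]
  · rw [lor_comm, h.left.lor_dz_self hz]
  · rw [lor_comm, h.left.lor_dzb_self hz]
  · rw [lor_comm, h.metric z hz]
  · rw [lor_comm]; rfl
  · rw [lor_comm]; rfl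
  · rw [lor_comm, h.right.lor_dz_self hz]
  · rw [lor_comm, h.right.lor_dzb_self hz]
  · have := hp I
    rw [lor_comm (Y z)] at this
    rw [lam, dz_eq, dz_eq]
    linear_combination this
  · have := hp (-I)
    rw [lor_comm (Y z)] at this
    rw [lamb, dzb_eq, dzb_eq]
    linear_combination this

lemma lamb_eq (h : NormalizedLifts U Y Z W) {z : ℂ} (hz : z ∈ U) :
    lamb Y Z z = (starRingEnd ℂ) (lam Y Z z) := by
  rw [lamb, lam, ← lor_conjV, h.right.real, h.left.dzb_eq_conjV hz]

lemma conj_lamb (h : NormalizedLifts U Y Z W) {z : ℂ} (hz : z ∈ U) :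
    (starRingEnd ℂ) (lamb Y Z z) = lam Y Z z := by
  rw [h.lamb_eq hz, Complex.conj_conj]

lemma conjV_perp (h : NormalizedLifts U Y Z W) {z : ℂ} (hz : z ∈ U) :
    conjV (perp Y Z z) = perpb Y Z z := by
  rw [perp, perpb, conjV_add, conjV_smul, ← h.lamb_eq hz, h.left.real, h.left.dzb_eq_conjV hz]

lemma perp_mem (h : NormalizedLifts U Y Z W) {z : ℂ} (hz : z ∈ U) : perp Y Z z ∈ WC (W z) :=
  add_mem (h.left.mem_dz z hz) ((WC (W z)).smul_mem _ (h.left.mem z hz))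

lemma perpb_mem (h : NormalizedLifts U Y Z W) {z : ℂ} (hz : z ∈ U) : perpb Y Z z ∈ WC (W z) :=
  add_mem (h.left.mem_dzb hz) ((WC (W z)).smul_mem _ (h.left.mem z hz))

/-- The structure equation `Z_z = λ Z + ρ (Y_z + λ Y) + θ (Y_z̄ + λ̄ Y)`. -/
lemma dz_partner (h : NormalizedLifts U Y Z W) {z : ℂ} (hz : z ∈ U) :
    dz Z z = lam Y Z z • Z z + rhoC Y Z z • perp Y Z z + thetaC Y Z z • perpb Y Z z := by
  rw [← sub_eq_zero]
  have hW := WC (W z)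
  obtain ⟨⟨a1, a2, a3, a4⟩, ⟨b1, b2, b3, b4⟩, ⟨c1, c2, c3, c4⟩, ⟨d1, d2, d3, d4⟩,
    ⟨e1, e2, e3, e4⟩⟩ := h.table hz
  -- The difference of the two sides lies in the complexified sphere and is orthogonal to a frame of
  -- it. The factor `2` in `rhoC` and `thetaC` compensates `⟨P, P̄⟩ = 1/2`.
  refine h.eq_zero hz ?_ ?_ ?_ ?_ ?_
  · exact sub_mem (h.right.mem_dz z hz) (add_mem (add_mem
      ((WC (W z)).smul_mem _ (h.right.mem z hz)) ((WC (W z)).smul_mem _ (h.perp_mem hz)))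
      ((WC (W z)).smul_mem _ (h.perpb_mem hz)))
  all_goals
    simp only [rhoC, thetaC, perp, perpb, lor_sub_left, lor_add_left, lor_smul_left, lor_add_right,
      lor_smul_right, a1, a2, a3, a4, b1, b2, b3, b4, c1, c2, c3, c4, d1, d2, d3, d4, e1, e3]
    ring

/-- Among the vectors `Z, P, P̄` only the product `⟨P, P̄⟩ = 1/2` is nonzero, so `⟨Z_z, Z_z⟩ = ρ θ`,
and this vanishes by conformality of `Z`. -/
lemma rhoC_mul_thetaC (h : NormalizedLifts U Y Z W) {z : ℂ} (hz : z ∈ U) :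
    rhoC Y Z z * thetaC Y Z z = 0 := by
  have h1 := h.right.conf z hz
  obtain ⟨⟨a1, a2, a3, a4⟩, ⟨b1, b2, b3, b4⟩, ⟨c1, c2, c3, c4⟩, ⟨d1, d2, d3, d4⟩, _⟩ := h.table hz
  rw [h.dz_partner hz] at h1
  simp only [perp, perpb, lor_add_left, lor_smul_left, lor_add_right,
      lor_smul_right, a1, a2, a3, a4, b1, b2, b3, b4, c1, c2, c3, c4, d1, d2, d3, d4] at h1
  linear_combination h1

/-- Otherwise `Z_z = λ Z` is orthogonal to `Z_z̄`, against the immersion condition. -/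
lemma rhoC_ne_zero_or (h : NormalizedLifts U Y Z W) {z : ℂ} (hz : z ∈ U) :
    rhoC Y Z z ≠ 0 ∨ thetaC Y Z z ≠ 0 := by
  by_contra! hc
  have h1 := h.right.imm z hz
  rw [h.dz_partner hz, hc.1, hc.2] at h1
  have := (h.table hz).2.2.2.2.2.1
  rw [lor_comm] at this
  simp [this] at h1

end NormalizedLifts

/-! ## Second order identities of normalized pairs -/

/-- The structure equation with one of `ρ`, `θ` equal to zero has this shape, with `V` equal to
`Y_z` or `Y_z̄`. -/
lemma vd_combination (c : ℂ) {f g k : ℂ → ℂ} {Z V Y : ℂ → MinkC n} {z : ℂ}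
    (hf : DifferentiableAt ℝ f z) (hg : DifferentiableAt ℝ g z) (hk : DifferentiableAt ℝ k z)
    (hZ : DifferentiableAt ℝ Z z) (hV : DifferentiableAt ℝ V z) (hY : DifferentiableAt ℝ Y z) :
    vd c (fun w => f w • Z w + g w • (V w + k w • Y w)) z =
      wd c f z • Z z + f z • vd c Z z + wd c g z • (V z + k z • Y z) +
        g z • (vd c V z + wd c k z • Y z + k z • vd c Y z) := by
  have h1 := hV.fun_add (hk.smulC hY)
  rw [vd_add c (hf.smulC hZ) (hg.smulC h1), vd_smul c hf hZ, vd_smul c hg h1,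
    vd_add c hV (hk.smulC hY), vd_smul c hk hY]
  module

namespace NormalizedLifts

variable {U : Set ℂ} {Y Z : ℂ → MinkC n} {W : ℂ → Submodule ℝ (Mink n)}

lemma smooth_lam (h : NormalizedLifts U Y Z W) {z : ℂ} (hz : z ∈ U) :
    ContDiffAt ℝ ∞ (lam Y Z) z := (h.left.smooth_dz hz).lorProd (h.right.smooth z hz)

lemma smooth_lamb (h : NormalizedLifts U Y Z W) {z : ℂ} (hz : z ∈ U) :
    ContDiffAt ℝ ∞ (lamb Y Z) z := (h.left.smooth_dzb hz).lorProd (h.right.smooth z hz)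

lemma smooth_perp (h : NormalizedLifts U Y Z W) {z : ℂ} (hz : z ∈ U) :
    ContDiffAt ℝ ∞ (perp Y Z) z :=
  (h.left.smooth_dz hz).add ((h.smooth_lam hz).smulC (h.left.smooth z hz))

lemma smooth_perpb (h : NormalizedLifts U Y Z W) {z : ℂ} (hz : z ∈ U) :
    ContDiffAt ℝ ∞ (perpb Y Z) z :=
  (h.left.smooth_dzb hz).add ((h.smooth_lamb hz).smulC (h.left.smooth z hz))

lemma smooth_rhoC (h : NormalizedLifts U Y Z W) {z : ℂ} (hz : z ∈ U) :
    ContDiffAt ℝ ∞ (rhoC Y Z) z :=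
  contDiffAt_const.mul ((h.right.smooth_dz hz).lorProd (h.smooth_perpb hz))

lemma smooth_thetaC (h : NormalizedLifts U Y Z W) {z : ℂ} (hz : z ∈ U) :
    ContDiffAt ℝ ∞ (thetaC Y Z) z :=
  contDiffAt_const.mul ((h.right.smooth_dz hz).lorProd (h.smooth_perp hz))

end NormalizedLifts

lemma ConformalLift.dz_dzb {U : Set ℂ} {Y : ℂ → MinkC n} {W : ℂ → Submodule ℝ (Mink n)}
    (h : ConformalLift U Y W) {z : ℂ} (hz : z ∈ U) : dz (dzb Y) z = dzb (dz Y) z := by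
  rw [dzb_eq']
  exact vd_comm I (-I) (h.smooth z hz)

lemma ConformalLift.conjV_dz_dz {U : Set ℂ} {Y : ℂ → MinkC n} {W : ℂ → Submodule ℝ (Mink n)}
    (h : ConformalLift U Y W) {z : ℂ} (hz : z ∈ U) : conjV (dz (dz Y) z) = dzb (dzb Y) z := by
  have h1 := vd_conjV (-I) (h.smooth_dz hz).diffAt
  have h2 := vd_eq_of_eqOn h.isOpen (-I) (fun w hw => h.dzb_eq_conjV hw) hz
  rw [dzb_eq, h2, h1]
  simp [dz_eq]

lemma ConformalLift.conjV_dzb_dz {U : Set ℂ} {Y : ℂ → MinkC n} {W : ℂ → Submodule ℝ (Mink n)}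
    (h : ConformalLift U Y W) {z : ℂ} (hz : z ∈ U) : conjV (dzb (dz Y) z) = dzb (dz Y) z := by
  have h1 := vd_conjV I (h.smooth_dz hz).diffAt
  have h2 := vd_eq_of_eqOn h.isOpen I (fun w hw => h.dzb_eq_conjV hw) hz
  have h3 : dz (dzb Y) z = conjV (dzb (dz Y) z) := by
    rw [dz_eq, h2, h1, Complex.conj_I, dzb_eq]
  rw [← h3, h.dz_dzb hz]

/-- A lift of a conformal immersion with `|dY|² = |dz|²`. -/
structure UnitLift (U : Set ℂ) (Y : ℂ → MinkC n) (W : ℂ → Submodule ℝ (Mink n)) : Prop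
    extends ConformalLift U Y W where
  metric : ∀ z ∈ U, lor (dz Y z) (dzb Y z) = 1 / 2

lemma NormalizedLifts.unitLift {U : Set ℂ} {Y Z : ℂ → MinkC n} {W : ℂ → Submodule ℝ (Mink n)}
    (h : NormalizedLifts U Y Z W) : UnitLift U Y W := ⟨h.left, h.metric⟩

/-- Inner products of the second derivatives of a unit lift with the lift and its differential. -/
lemma UnitLift.table {U : Set ℂ} {Y : ℂ → MinkC n} {W : ℂ → Submodule ℝ (Mink n)}
    (h : UnitLift U Y W) {z : ℂ} (hz : z ∈ U) :
    (lor (dz (dz Y) z) (Y z) = 0 ∧ lor (dz (dz Y) z) (dz Y z) = 0 ∧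
      lor (dz (dz Y) z) (dzb Y z) = 0) ∧
    (lor (dzb (dzb Y) z) (Y z) = 0 ∧ lor (dzb (dzb Y) z) (dz Y z) = 0 ∧
      lor (dzb (dzb Y) z) (dzb Y z) = 0) ∧
    (lor (dzb (dz Y) z) (Y z) = -1 / 2 ∧ lor (dzb (dz Y) z) (dz Y z) = 0 ∧
      lor (dzb (dz Y) z) (dzb Y z) = 0) := by
  have hA : ∀ z ∈ U, ContDiffAt ℝ ∞ (dz Y) z := fun z hz => h.smooth_dz hz
  have hB : ∀ z ∈ U, ContDiffAt ℝ ∞ (dzb Y) z := fun z hz => h.smooth_dzb hz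
  have key : ∀ (a : ℂ) {F G : ℂ → MinkC n}, (∀ z ∈ U, ContDiffAt ℝ ∞ F z) →
      (∀ z ∈ U, ContDiffAt ℝ ∞ G z) → (∀ z ∈ U, lor (F z) (G z) = a) →
      lor (dz F z) (G z) + lor (F z) (dz G z) = 0 ∧
        lor (dzb F z) (G z) + lor (F z) (dzb G z) = 0 := by
    intro a F G hF hG hFG
    refine ⟨lor_vd_add_eq_zero h.isOpen I a hF hG hFG hz, ?_⟩
    rw [dzb_eq, dzb_eq]
    exact lor_vd_add_eq_zero h.isOpen (-I) a hF hG hFG hz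
  have c1 := lor_comm (dz Y z) (dzb Y z)
  have c2 := lor_comm (dz Y z) (dzb (dzb Y) z)
  have c3 := lor_comm (dz Y z) (dzb (dz Y) z)
  have c4 := lor_comm (dzb Y z) (dzb (dzb Y) z)
  have c5 := lor_comm (dz Y z) (dz (dz Y) z)
  have c6 := lor_comm (dzb Y z) (dzb (dz Y) z)
  have e := h.dz_dzb hz
  -- Five constant products, each differentiated in `z` and in `z̄`, give a linear system for the
  -- nine unknown products.
  obtain ⟨p1, p2⟩ := key 0 hA h.smooth (fun z hz => by rw [lor_comm]; exact h.lor_dz_self hz)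
  obtain ⟨p3, p4⟩ := key 0 hB h.smooth (fun z hz => by rw [lor_comm]; exact h.lor_dzb_self hz)
  obtain ⟨p5, p6⟩ := key 0 hA hA h.conf
  obtain ⟨p7, p8⟩ := key 0 hB hB (fun z hz => h.conf' hz)
  obtain ⟨p9, p10⟩ := key _ hA hB h.metric
  have m := h.metric z hz
  have q1 := h.conf z hz
  have q2 := h.conf' hz
  rw [e] at p3 p7 p9
  have r1 : lor (dzb (dz Y) z) (dz Y z) = 0 := by linear_combination (p6 - c3) / 2
  have r2 : lor (dzb (dz Y) z) (dzb Y z) = 0 := by linear_combination (p7 - c6) / 2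
  refine ⟨⟨?_, ?_, ?_⟩, ⟨?_, ?_, ?_⟩, ?_, r1, r2⟩
  · linear_combination p1 - q1
  · linear_combination (p5 - c5) / 2
  · linear_combination p9 - c3 - r1
  · linear_combination p4 - q2
  · linear_combination p10 - r2 - c2
  · linear_combination (p8 - c4) / 2
  · linear_combination p2 - m

namespace NormalizedLifts

variable {U : Set ℂ} {Y Z : ℂ → MinkC n} {W : ℂ → Submodule ℝ (Mink n)}

lemma lor_perp_table (h : NormalizedLifts U Y Z W) {z : ℂ} (hz : z ∈ U) :
    (lor (Z z) (perp Y Z z) = 0 ∧ lor (Y z) (perp Y Z z) = 0 ∧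
      lor (perp Y Z z) (perp Y Z z) = 0 ∧ lor (perpb Y Z z) (perp Y Z z) = 1 / 2 ∧
      lor (dz Y z) (perp Y Z z) = 0 ∧ lor (dzb Y z) (perp Y Z z) = 1 / 2) ∧
    (lor (Z z) (perpb Y Z z) = 0 ∧ lor (Y z) (perpb Y Z z) = 0 ∧
      lor (perpb Y Z z) (perpb Y Z z) = 0 ∧ lor (perp Y Z z) (perpb Y Z z) = 1 / 2 ∧
      lor (dz Y z) (perpb Y Z z) = 1 / 2 ∧ lor (dzb Y z) (perpb Y Z z) = 0) := by
  obtain ⟨⟨a1, a2, a3, a4⟩, ⟨b1, b2, b3, b4⟩, ⟨c1, c2, c3, c4⟩, ⟨d1, d2, d3, d4⟩, _⟩ := h.table hz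
  refine ⟨⟨?_, ?_, ?_, ?_, ?_, ?_⟩, ?_, ?_, ?_, ?_, ?_, ?_⟩ <;>
  · simp only [perp, perpb, lor_add_left, lor_smul_left, lor_add_right,
      lor_smul_right, a1, a4, b1, b2, b3, b4, c1, c2, c3, c4, d3, d4]
    ring

/-! ### The case `ρ = 0` -/

lemma dz_partner_of_rho (h : NormalizedLifts U Y Z W) (hr : ∀ z ∈ U, rhoC Y Z z = 0) {z : ℂ}
    (hz : z ∈ U) : dz Z z = lam Y Z z • Z z + thetaC Y Z z • perpb Y Z z := by
  have := h.dz_partner hz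
  rwa [hr z hz, zero_smul, add_zero] at this

lemma dzb_partner_of_rho (h : NormalizedLifts U Y Z W) (hr : ∀ z ∈ U, rhoC Y Z z = 0) {z : ℂ}
    (hz : z ∈ U) :
    dzb Z z = lamb Y Z z • Z z + (starRingEnd ℂ) (thetaC Y Z z) • perp Y Z z := by
  rw [h.right.dzb_eq_conjV hz, h.dz_partner_of_rho hr hz, conjV_add, conjV_smul, conjV_smul,
    h.right.real, ← h.conjV_perp hz, conjV_conjV, h.lamb_eq hz]

/-- Comparison of the two expressions of `Z_{z z̄}` in the case `ρ = 0`. -/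
lemma compat_of_rho (h : NormalizedLifts U Y Z W) (hr : ∀ z ∈ U, rhoC Y Z z = 0) {z : ℂ}
    (hz : z ∈ U) :
    wd (-I) (lam Y Z) z • Z z + lam Y Z z • dzb Z z + wd (-I) (thetaC Y Z) z • perpb Y Z z +
        thetaC Y Z z • (dzb (dzb Y) z + wd (-I) (lamb Y Z) z • Y z + lamb Y Z z • dzb Y z) =
      wd I (lamb Y Z) z • Z z + lamb Y Z z • dz Z z +
        wd I (fun w => (starRingEnd ℂ) (thetaC Y Z w)) z • perp Y Z z +
        (starRingEnd ℂ) (thetaC Y Z z) •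
          (dz (dz Y) z + wd I (lam Y Z) z • Y z + lam Y Z z • dz Y z) := by
  have e1 := vd_eq_of_eqOn h.left.isOpen (-I) (fun w hw => h.dz_partner_of_rho hr hw) hz
  have e2 := vd_eq_of_eqOn h.left.isOpen I (fun w hw => h.dzb_partner_of_rho hr hw) hz
  have s1 := (h.smooth_lam hz).diffAt
  have s2 := (h.smooth_lamb hz).diffAt
  have s3 := (h.smooth_thetaC hz).diffAt
  have s4 := (h.smooth_thetaC hz).conjC.diffAt
  have sZ := (h.right.smooth z hz).diffAt
  have sY := (h.left.smooth z hz).diffAt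
  have f1 := vd_combination (-I) s1 s3 s2 sZ (h.left.smooth_dzb hz).diffAt sY
  have f2 := vd_combination I s2 s4 s1 sZ (h.left.smooth_dz hz).diffAt sY
  have e3 := h.right.dz_dzb hz
  rw [dz_eq, dzb_eq, e1, e2] at e3
  have e4 := (f2.symm.trans e3).trans f1
  simp only [← dzb_eq, ← dz_eq] at e4
  exact e4.symm

/-- In the case `ρ = 0` the coefficient `θ` is holomorphic. -/
lemma dzb_theta_of_rho (h : NormalizedLifts U Y Z W) (hr : ∀ z ∈ U, rhoC Y Z z = 0) {z : ℂ}
    (hz : z ∈ U) : wd (-I) (thetaC Y Z) z = 0 := by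
  -- The product with `P` leaves `θ_z̄ / 2` and two terms `λ̄ θ / 2` that cancel; `Y_zz` and
  -- `Y_z̄z̄` drop out, being orthogonal to `Y` and `Y_z`.
  have e := congrArg (fun x => lor x (perp Y Z z)) (h.compat_of_rho hr hz)
  obtain ⟨⟨p1, p2, p3, p4, p5, p6⟩, _⟩ := h.lor_perp_table hz
  obtain ⟨⟨t1, t2, _⟩, ⟨t4, t5, _⟩, _⟩ := h.unitLift.table hz
  have k1 : lor (dz (dz Y) z) (perp Y Z z) = 0 := by simp [perp, t1, t2]
  have k2 : lor (dzb (dzb Y) z) (perp Y Z z) = 0 := by simp [perp, t4, t5]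
  simp only [lor_add_left, lor_smul_left, h.dz_partner_of_rho hr hz, h.dzb_partner_of_rho hr hz,
    p1, p2, p3, p4, p5, p6, k1, k2] at e
  linear_combination 2 * e

/-- If `ρ = 0` and `θ` is a nonzero real constant, then `Y_{zz}` is real modulo `Y`. -/
lemma dz_dz_of_const_theta (h : NormalizedLifts U Y Z W) (hr : ∀ z ∈ U, rhoC Y Z z = 0) {t : ℝ}
    (ht : t ≠ 0) (hth : ∀ z ∈ U, thetaC Y Z z = t) {z : ℂ} (hz : z ∈ U) :
    ∃ c : ℂ, dzb (dzb Y) z = dz (dz Y) z + c • Y z := by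
  have e := h.compat_of_rho hr hz
  rw [wd_eq_of_eqOn h.left.isOpen (-I) hth hz, wd_eq_of_eqOn h.left.isOpen I
    (f := fun w => (starRingEnd ℂ) (thetaC Y Z w)) (g := fun _ => (t : ℂ)) (fun w hw => by rw [hth w hw, Complex.conj_ofReal]) hz, wd_const,
    wd_const, h.dz_partner_of_rho hr hz, h.dzb_partner_of_rho hr hz, hth z hz,
    Complex.conj_ofReal] at e
  -- The product with `Y` compares the coefficients of `Z` and gives `λ_z̄ = λ̄_z`. After the `Z`
  -- terms cancel, the rest is `t` times the claim.
  have e1 := congrArg (fun x => lor x (Y z)) e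
  obtain ⟨⟨a1, a2, a3, a4⟩, ⟨b1, b2, b3, b4⟩, _⟩ := h.table hz
  obtain ⟨⟨t1, _⟩, ⟨t4, _⟩, _⟩ := h.unitLift.table hz
  simp only [perp, perpb, lor_add_left, lor_smul_left, a1, a4, b3, b4, t1, t4] at e1
  have e2 : wd (-I) (lam Y Z) z = wd I (lamb Y Z) z := by linear_combination -e1
  have ht' : (t : ℂ) ≠ 0 := by exact_mod_cast ht
  refine ⟨wd I (lam Y Z) z - wd (-I) (lamb Y Z) z + lamb Y Z z ^ 2 - lam Y Z z ^ 2, ?_⟩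
  rw [e2] at e
  apply smul_right_injective _ ht'
  simp only [perp, perpb] at e ⊢
  linear_combination (norm := module) e

end NormalizedLifts

/-! ## The case `θ = 0` -/

/-- The component of `Y_{z z̄}` perpendicular to the sphere spanned by `Y, Y_z, Y_z̄, Z`. -/
def meanCurv (Y Z : ℂ → MinkC n) (z : ℂ) : MinkC n :=
  dzb (dz Y) z - (1 / 2 : ℂ) • Z z + lamb Y Z z • perp Y Z z + lam Y Z z • perpb Y Z z +
    lor (dzb (dz Y) z) (Z z) • Y z

namespace NormalizedLifts

variable {U : Set ℂ} {Y Z : ℂ → MinkC n} {W : ℂ → Submodule ℝ (Mink n)}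

lemma dz_partner_of_theta (h : NormalizedLifts U Y Z W) (hr : ∀ z ∈ U, thetaC Y Z z = 0) {z : ℂ}
    (hz : z ∈ U) : dz Z z = lam Y Z z • Z z + rhoC Y Z z • perp Y Z z := by
  have := h.dz_partner hz
  rwa [hr z hz, zero_smul, add_zero] at this

lemma dzb_partner_of_theta (h : NormalizedLifts U Y Z W) (hr : ∀ z ∈ U, thetaC Y Z z = 0) {z : ℂ}
    (hz : z ∈ U) :
    dzb Z z = lamb Y Z z • Z z + (starRingEnd ℂ) (rhoC Y Z z) • perpb Y Z z := by
  rw [h.right.dzb_eq_conjV hz, h.dz_partner_of_theta hr hz, conjV_add, conjV_smul, conjV_smul,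
    h.right.real, h.conjV_perp hz, h.lamb_eq hz]

lemma dzb_dz_partner_of_theta (h : NormalizedLifts U Y Z W) (hr : ∀ z ∈ U, thetaC Y Z z = 0)
    {z : ℂ} (hz : z ∈ U) :
    dzb (dz Z) z =
      wd (-I) (lam Y Z) z • Z z + lam Y Z z • dzb Z z + wd (-I) (rhoC Y Z) z • perp Y Z z +
        rhoC Y Z z • (dzb (dz Y) z + wd (-I) (lam Y Z) z • Y z + lam Y Z z • dzb Y z) := by
  have e1 := vd_eq_of_eqOn h.left.isOpen (-I) (fun w hw => h.dz_partner_of_theta hr hw) hz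
  have f1 := vd_combination (-I) (h.smooth_lam hz).diffAt (h.smooth_rhoC hz).diffAt
    (h.smooth_lam hz).diffAt (h.right.smooth z hz).diffAt (h.left.smooth_dz hz).diffAt
    (h.left.smooth z hz).diffAt
  have e2 := e1.trans f1
  simp only [← dzb_eq] at e2
  exact e2

/-- Comparison of the two expressions of `Z_{z z̄}` in the case `θ = 0`. -/
lemma compat_of_theta (h : NormalizedLifts U Y Z W) (hr : ∀ z ∈ U, thetaC Y Z z = 0) {z : ℂ}
    (hz : z ∈ U) :
    wd (-I) (lam Y Z) z • Z z + lam Y Z z • dzb Z z + wd (-I) (rhoC Y Z) z • perp Y Z z +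
        rhoC Y Z z • (dzb (dz Y) z + wd (-I) (lam Y Z) z • Y z + lam Y Z z • dzb Y z) =
      wd I (lamb Y Z) z • Z z + lamb Y Z z • dz Z z +
        wd I (fun w => (starRingEnd ℂ) (rhoC Y Z w)) z • perpb Y Z z +
        (starRingEnd ℂ) (rhoC Y Z z) •
          (dzb (dz Y) z + wd I (lamb Y Z) z • Y z + lamb Y Z z • dz Y z) := by
  have e2 := vd_eq_of_eqOn h.left.isOpen I (fun w hw => h.dzb_partner_of_theta hr hw) hz
  have f2 := vd_combination I (h.smooth_lamb hz).diffAt (h.smooth_rhoC hz).conjC.diffAt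
    (h.smooth_lamb hz).diffAt (h.right.smooth z hz).diffAt (h.left.smooth_dzb hz).diffAt
    (h.left.smooth z hz).diffAt
  have e3 := h.right.dz_dzb hz
  have e4 := e2.trans f2
  simp only [← dz_eq] at e4
  rw [← h.dzb_dz_partner_of_theta hr hz, ← e3, e4, h.left.dz_dzb hz]
  rfl

lemma lor_dzb_dz_perpb (h : NormalizedLifts U Y Z W) {z : ℂ} (hz : z ∈ U) :
    lor (dzb (dz Y) z) (perpb Y Z z) = -lamb Y Z z / 2 := by
  obtain ⟨_, _, t1, t2, t3⟩ := h.unitLift.table hz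
  simp only [perpb, lor_add_right, lor_smul_right, t1, t3]
  ring

/-- In the case `θ = 0`: `ρ_z̄ = 2 λ̄ ρ`. -/
lemma dzb_rho_of_theta (h : NormalizedLifts U Y Z W) (hr : ∀ z ∈ U, thetaC Y Z z = 0) {z : ℂ}
    (hz : z ∈ U) : wd (-I) (rhoC Y Z) z = 2 * lamb Y Z z * rhoC Y Z z := by
  -- On the right the terms with `ρ̄` cancel, because `⟨Y_zz̄, P̄⟩ = -λ̄ / 2` and `⟨Y_z, P̄⟩ = 1 /
  -- 2`.
  have e := congrArg (fun x => lor x (perpb Y Z z)) (h.compat_of_theta hr hz)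
  obtain ⟨_, p1, p2, p3, p4, p5, p6⟩ := h.lor_perp_table hz
  simp only [lor_add_left, lor_smul_left, h.dz_partner_of_theta hr hz,
    h.dzb_partner_of_theta hr hz, p1, p2, p3, p4, p5, p6, h.lor_dzb_dz_perpb hz] at e
  linear_combination 2 * e

lemma lor_meanCurv (h : NormalizedLifts U Y Z W) {z : ℂ} (hz : z ∈ U) :
    lor (meanCurv Y Z z) (Y z) = 0 ∧ lor (meanCurv Y Z z) (dz Y z) = 0 ∧
      lor (meanCurv Y Z z) (dzb Y z) = 0 ∧ lor (meanCurv Y Z z) (Z z) = 0 := by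
  obtain ⟨⟨a1, a2, a3, a4⟩, ⟨b1, b2, b3, b4⟩, ⟨c1, c2, c3, c4⟩, ⟨d1, d2, d3, d4⟩, _⟩ := h.table hz
  obtain ⟨_, _, t1, t2, t3⟩ := h.unitLift.table hz
  refine ⟨?_, ?_, ?_, ?_⟩ <;>
  · simp only [meanCurv, perp, perpb, lor_add_left, lor_smul_left, lor_sub_left, a1, a2, a3, a4,
      b1, b2, b3, b4, c1, c2, c3, c4, d1, d2, d3, d4, t1, t2, t3]
    ring

lemma dzb_dz_sub_meanCurv_mem (h : NormalizedLifts U Y Z W) {z : ℂ} (hz : z ∈ U) :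
    dzb (dz Y) z - meanCurv Y Z z ∈ WC (W z) := by
  have : dzb (dz Y) z - meanCurv Y Z z = (1 / 2 : ℂ) • Z z - lamb Y Z z • perp Y Z z -
      lam Y Z z • perpb Y Z z - lor (dzb (dz Y) z) (Z z) • Y z := by
    rw [meanCurv]; module
  rw [this]
  exact sub_mem (sub_mem (sub_mem ((WC (W z)).smul_mem _ (h.right.mem z hz))
    ((WC (W z)).smul_mem _ (h.perp_mem hz))) ((WC (W z)).smul_mem _ (h.perpb_mem hz)))
    ((WC (W z)).smul_mem _ (h.left.mem z hz))

/-- `Y_zz̄` differs from `meanCurv` by a vector of the sphere, and `meanCurv` is orthogonal to the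
sphere; by nondegeneracy it lies in the sphere only if it is zero. -/
lemma meanCurv_eq_zero_iff (h : NormalizedLifts U Y Z W) {z : ℂ} (hz : z ∈ U) :
    meanCurv Y Z z = 0 ↔ dzb (dz Y) z ∈ WC (W z) := by
  have hm := h.dzb_dz_sub_meanCurv_mem hz
  constructor
  · intro h0
    rwa [h0, sub_zero] at hm
  · intro h0
    obtain ⟨h1, h2, h3, h4⟩ := h.lor_meanCurv hz
    refine h.eq_zero hz ?_ h1 h2 h3 h4
    have := sub_mem h0 hm
    rwa [sub_sub_cancel] at this

/-- In the case `θ = 0`, either `ρ` is real or the sphere is the mean curvature sphere. -/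
lemma rho_real_or (h : NormalizedLifts U Y Z W) (hr : ∀ z ∈ U, thetaC Y Z z = 0) {z : ℂ}
    (hz : z ∈ U) (hm : meanCurv Y Z z ≠ 0) :
    (starRingEnd ℂ) (rhoC Y Z z) = rhoC Y Z z := by
  have e := h.compat_of_theta hr hz
  have hY := fun c : ℂ => (WC (W z)).smul_mem c (h.left.mem z hz)
  have hZ := fun c : ℂ => (WC (W z)).smul_mem c (h.right.mem z hz)
  have hA := fun c : ℂ => (WC (W z)).smul_mem c (h.left.mem_dz z hz)
  have hB := fun c : ℂ => (WC (W z)).smul_mem c (h.left.mem_dzb hz)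
  have hP := fun c : ℂ => (WC (W z)).smul_mem c (h.perp_mem hz)
  have hQ := fun c : ℂ => (WC (W z)).smul_mem c (h.perpb_mem hz)
  have hZz := fun c : ℂ => (WC (W z)).smul_mem c (h.right.mem_dz z hz)
  have hZb := fun c : ℂ => (WC (W z)).smul_mem c (h.right.mem_dzb hz)
  -- In the compatibility condition `Y_zz̄` has the coefficient `ρ` on one side and `ρ̄` on the
  -- other; every other vector lies in the sphere.
  have key : (rhoC Y Z z - (starRingEnd ℂ) (rhoC Y Z z)) • dzb (dz Y) z ∈ WC (W z) := by
    have e' : (rhoC Y Z z - (starRingEnd ℂ) (rhoC Y Z z)) • dzb (dz Y) z =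
        (wd I (lamb Y Z) z • Z z + lamb Y Z z • dz Z z +
          wd I (fun w => (starRingEnd ℂ) (rhoC Y Z w)) z • perpb Y Z z +
          (((starRingEnd ℂ) (rhoC Y Z z) * wd I (lamb Y Z) z) • Y z +
            ((starRingEnd ℂ) (rhoC Y Z z) * lamb Y Z z) • dz Y z)) -
        (wd (-I) (lam Y Z) z • Z z + lam Y Z z • dzb Z z + wd (-I) (rhoC Y Z) z • perp Y Z z +
          ((rhoC Y Z z * wd (-I) (lam Y Z) z) • Y z + (rhoC Y Z z * lam Y Z z) • dzb Y z)) := by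
      linear_combination (norm := module) e
    rw [e']
    exact sub_mem (add_mem (add_mem (add_mem (hZ _) (hZz _)) (hQ _)) (add_mem (hY _) (hA _)))
      (add_mem (add_mem (add_mem (hZ _) (hZb _)) (hP _)) (add_mem (hY _) (hB _)))
  by_contra hne
  apply hm
  rw [h.meanCurv_eq_zero_iff hz]
  have hne' : rhoC Y Z z - (starRingEnd ℂ) (rhoC Y Z z) ≠ 0 := fun h0 =>
    hne (sub_eq_zero.mp h0).symm
  have := (WC (W z)).smul_mem (rhoC Y Z z - (starRingEnd ℂ) (rhoC Y Z z))⁻¹ key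
  rwa [smul_smul, inv_mul_cancel₀ hne', one_smul] at this

lemma smooth_meanCurv (h : NormalizedLifts U Y Z W) {z : ℂ} (hz : z ∈ U) :
    ContDiffAt ℝ ∞ (meanCurv Y Z) z := by
  have h1 : ContDiffAt ℝ ∞ (dzb (dz Y)) z := by
    rw [dzb_eq']; exact (h.left.smooth_dz hz).vecDeriv _
  exact ((((h1.sub (contDiffAt_const.smulC (h.right.smooth z hz))).add
    ((h.smooth_lamb hz).smulC (h.smooth_perp hz))).add
    ((h.smooth_lam hz).smulC (h.smooth_perpb hz))).add
    ((h1.lorProd (h.right.smooth z hz)).smulC (h.left.smooth z hz)))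

/-! ### Moebius congruence when `ρ` is real -/

/-- When `ρ` is real, the reflection in the line spanned by `Z - ρ Y` is constant. -/
lemma vd_reflection (h : NormalizedLifts U Y Z W) (ht : ∀ z ∈ U, thetaC Y Z z = 0)
    (hr : ∀ z ∈ U, (starRingEnd ℂ) (rhoC Y Z z) = rhoC Y Z z) (x : MinkC n) {z : ℂ} (hz : z ∈ U) :
    vd I (fun w => ((rhoC Y Z w)⁻¹ * lor x (Z w - rhoC Y Z w • Y w)) •
      (Z w - rhoC Y Z w • Y w)) z = 0 := by
  have h0 : rhoC Y Z z ≠ 0 := by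
    rcases h.rhoC_ne_zero_or hz with h0 | h0
    · exact h0
    · exact absurd (ht z hz) h0
  have sr := (h.smooth_rhoC hz).diffAt
  have sE : DifferentiableAt ℝ (fun w => Z w - rhoC Y Z w • Y w) z :=
    (h.right.smooth z hz).diffAt.sub (sr.smulC (h.left.smooth z hz).diffAt)
  have sl : DifferentiableAt ℝ (fun w => lor x (Z w - rhoC Y Z w • Y w)) z :=
    (contDiffAt_const.lorProd ((h.right.smooth z hz).sub
      ((h.smooth_rhoC hz).smulC (h.left.smooth z hz)))).diffAt
  have si : DifferentiableAt ℝ (fun w => (rhoC Y Z w)⁻¹) z := sr.inv h0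
  -- Reality of `ρ` turns `ρ_z̄ = 2 λ̄ ρ` into `ρ_z = 2 λ ρ`, which is what makes `Z - ρ Y` an
  -- eigenvector of `∂/∂z` with factor `λ`.
  have drho : wd I (rhoC Y Z) z = 2 * lam Y Z z * rhoC Y Z z := by
    have e1 := wd_conj (-I) sr
    rw [wd_eq_of_eqOn h.left.isOpen (-I) hr hz, h.dzb_rho_of_theta ht hz] at e1
    have e2 := congrArg (starRingEnd ℂ) e1
    simp only [map_neg, Complex.conj_I, neg_neg, Complex.conj_conj] at e2
    rw [← e2, map_mul, map_mul, h.conj_lamb hz, hr z hz, map_ofNat]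
  have dE : vd I (fun w => Z w - rhoC Y Z w • Y w) z =
      lam Y Z z • (Z z - rhoC Y Z z • Y z) := by
    rw [vd_sub I (h.right.smooth z hz).diffAt (sr.smulC (h.left.smooth z hz).diffAt),
      vd_smul I sr (h.left.smooth z hz).diffAt, drho, ← dz_eq, ← dz_eq,
      h.dz_partner_of_theta ht hz, perp]
    module
  have di : wd I (fun w => (rhoC Y Z w)⁻¹) z = -(2 * lam Y Z z) * (rhoC Y Z z)⁻¹ := by
    have e1 := wd_mul I sr si
    have e2 : wd I (fun w => rhoC Y Z w * (rhoC Y Z w)⁻¹) z = 0 := by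
      rw [wd_congr I (g := fun _ => 1), wd_const]
      filter_upwards [(h.smooth_rhoC hz).continuousAt.eventually_ne h0] with w hw
      exact mul_inv_cancel₀ hw
    rw [e2, drho] at e1
    have e3 : rhoC Y Z z * (wd I (fun w => (rhoC Y Z w)⁻¹) z) =
      rhoC Y Z z * (-(2 * lam Y Z z) * (rhoC Y Z z)⁻¹) := by linear_combination -e1
    exact mul_left_cancel₀ h0 e3
  have dl : wd I (fun w => lor x (Z w - rhoC Y Z w • Y w)) z =
      lam Y Z z * lor x (Z z - rhoC Y Z z • Y z) := by
    rw [wd_lor I (differentiableAt_const x) sE, dE]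
    simp [vd, du, dv]
  -- The factor `ρ⁻¹` contributes `-2 λ` and each of the two factors `Z - ρ Y` contributes `λ`; the
  -- sum is zero.
  rw [vd_smul I (si.fun_mul sl) sE, wd_mul I si sl, di, dl, dE]
  module

end NormalizedLifts

/-- The reflection in the hyperplane perpendicular to `e`, where `⟨e, e⟩ = 2 r ≠ 0`. -/
lemma exists_reflection {e : Mink n} {r : ℝ} (he : lor e e = 2 * r) (hr : r ≠ 0) :
    ∃ L : Mink n ≃ₗ[ℝ] Mink n, (∀ x, L x = x - (r⁻¹ * lor x e) • e) ∧
      ∀ x y, lor (L x) (L y) = lor x y := by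
  let f : Mink n →ₗ[ℝ] Mink n :=
    { toFun := fun x => x - (r⁻¹ * lor x e) • e
      map_add' := fun x y => by simp only [lor_add_left]; module
      map_smul' := fun c x => by simp only [lor_smul_left, RingHom.id_apply]; module }
  have hf : ∀ x, f x = x - (r⁻¹ * lor x e) • e := fun _ => rfl
  have hinv : Function.Involutive f := by
    intro x
    rw [hf, hf]
    simp only [lor_sub_left, lor_smul_left, he]
    have : r⁻¹ * (lor x e - r⁻¹ * lor x e * (2 * r)) = -(r⁻¹ * lor x e) := by
      field_simp; ring
    rw [this]; module
  refine ⟨LinearEquiv.ofInvolutive f hinv, hf, fun x y => ?_⟩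
  change lor (f x) (f y) = lor x y
  rw [hf, hf]
  simp only [lor_sub_left, lor_smul_left, lor_sub_right, lor_smul_right, he, lor_comm e y]
  field_simp
  ring

lemma fderiv_eq_zero_of_vd {F : ℂ → MinkC n} {z : ℂ} (h1 : vd I F z = 0) (h2 : vd (-I) F z = 0) :
    fderiv ℝ F z = 0 := by
  have hu : fderiv ℝ F z 1 = 0 := by
    have : fderiv ℝ F z 1 = vd I F z + vd (-I) F z := by simp only [vd, du, dv]; module
    rw [this, h1, h2, add_zero]
  have hv : fderiv ℝ F z I = 0 := by
    have : fderiv ℝ F z I = I • (vd I F z - vd (-I) F z) := by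
      simp only [vd, du, dv]
      match_scalars
      · linear_combination (1 : ℂ) * I_sq
      · ring
    rw [this, h1, h2, sub_zero, smul_zero]
  ext w
  have hw : w = w.re • (1 : ℂ) + w.im • I := by
    simp [Complex.re_add_im]
  rw [hw, map_add, map_smul, map_smul, hu, hv]
  simp

namespace NormalizedLifts

variable {U : Set ℂ} {Y Z : ℂ → MinkC n} {W : ℂ → Submodule ℝ (Mink n)}

/-- When `θ = 0` and `ρ` is real, the two surfaces are Moebius congruent. -/
lemma exists_congruence (h : NormalizedLifts U Y Z W) (ht : ∀ z ∈ U, thetaC Y Z z = 0)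
    (hr : ∀ z ∈ U, (starRingEnd ℂ) (rhoC Y Z z) = rhoC Y Z z) (hU : IsPreconnected U)
    {z₀ : ℂ} (hz₀ : z₀ ∈ U) :
    ∃ L : Mink n ≃ₗ[ℝ] Mink n, (∀ x y, lor (L x) (L y) = lor x y) ∧
      ∀ z ∈ U, ∃ c : ℝ, c ≠ 0 ∧ L (reV (Y z)) = c • reV (Z z) := by
  have hρ : ∀ z ∈ U, ((rhoC Y Z z).re : ℂ) = rhoC Y Z z := fun z hz =>
    Complex.conj_eq_iff_re.mp (hr z hz)
  have hρ0 : ∀ z ∈ U, (rhoC Y Z z).re ≠ 0 := by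
    intro z hz h0
    have := hρ z hz
    rw [h0] at this
    rcases h.rhoC_ne_zero_or hz with h1 | h1
    · exact h1 (by simpa using this.symm)
    · exact h1 (ht z hz)
  -- Here `⟨e, e⟩ = 2 ρ` and `⟨Y, e⟩ = -1`, so the reflection in `e^⊥` sends `Y` to `Y + ρ⁻¹ e = ρ⁻¹
  -- Z`.
  set e : ℂ → Mink n := fun z => reV (Z z) - (rhoC Y Z z).re • reV (Y z) with he
  have hE : ∀ z ∈ U, toC (e z) = Z z - rhoC Y Z z • Y z := by
    intro z hz
    rw [he, toC_sub, toC_smul, toC_reV (h.right.real z), toC_reV (h.left.real z), hρ z hz]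
  have hee : lor (e z₀) (e z₀) = 2 * (rhoC Y Z z₀).re := by
    have : ((lor (e z₀) (e z₀) : ℝ) : ℂ) = ((2 * (rhoC Y Z z₀).re : ℝ) : ℂ) := by
      obtain ⟨⟨a1, a2, a3, a4⟩, _⟩ := h.table hz₀
      rw [← lor_toC, hE z₀ hz₀]
      push_cast
      simp only [lor_sub_left, lor_sub_right, lor_smul_left, lor_smul_right, a1, a2, a3, a4,
        hρ z₀ hz₀]
      ring
    exact_mod_cast this
  obtain ⟨L, hL, hiso⟩ := exists_reflection hee (hρ0 z₀ hz₀)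
  refine ⟨L, hiso, fun z hz => ⟨(rhoC Y Z z).re⁻¹, inv_ne_zero (hρ0 z hz), ?_⟩⟩
  have hconst : ∀ x : Mink n,
      ((rhoC Y Z z₀).re⁻¹ * lor x (e z₀)) • e z₀ = ((rhoC Y Z z).re⁻¹ * lor x (e z)) • e z := by
    intro x
    apply toC_injective
    have key : ∀ w ∈ U, toC (((rhoC Y Z w).re⁻¹ * lor x (e w)) • e w) =
        ((rhoC Y Z w)⁻¹ * lor (toC x) (Z w - rhoC Y Z w • Y w)) • (Z w - rhoC Y Z w • Y w) := by
      intro w hw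
      rw [toC_smul, hE w hw, ← hE w hw, lor_toC]
      push_cast
      rw [hρ w hw]
    set G : ℂ → MinkC n := fun w => ((rhoC Y Z w)⁻¹ * lor (toC x) (Z w - rhoC Y Z w • Y w)) •
      (Z w - rhoC Y Z w • Y w) with hG
    have sG : ∀ w ∈ U, ContDiffAt ℝ ∞ G w := by
      intro w hw
      have h1 : ContDiffAt ℝ ∞ (fun w => Z w - rhoC Y Z w • Y w) w :=
        (h.right.smooth w hw).sub ((h.smooth_rhoC hw).smulC (h.left.smooth w hw))
      have h0 : rhoC Y Z w ≠ 0 := by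
        rw [← hρ w hw]; exact_mod_cast hρ0 w hw
      exact (((h.smooth_rhoC hw).inv h0).mul (contDiffAt_const.lorProd h1)).smulC h1
    have d1 : ∀ w ∈ U, vd I G w = 0 := fun w hw => h.vd_reflection ht hr (toC x) hw
    -- `G` takes real values on `U`, so its `z̄`-derivative is the conjugate of its `z`-derivative.
    have d2 : ∀ w ∈ U, vd (-I) G w = 0 := by
      intro w hw
      have c1 := vd_conjV (-I) (sG w hw).diffAt
      have c2 : vd (-I) (fun w => conjV (G w)) w = vd (-I) G w := by
        refine vd_eq_of_eqOn h.left.isOpen (-I) (fun v hv => ?_) hw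
        rw [hG]
        simp only
        rw [← key v hv, conjV_toC]
      rw [c2, map_neg, Complex.conj_I, neg_neg, d1 w hw] at c1
      rw [c1]; ext; simp [conjV]
    rw [key z₀ hz₀, key z hz]
    exact h.left.isOpen.is_const_of_fderiv_eq_zero hU
      (fun w hw => (sG w hw).diffAt.differentiableWithinAt)
      (fun w hw => fderiv_eq_zero_of_vd (d1 w hw) (d2 w hw)) hz₀ hz
  rw [hL, hconst]
  have hYe : lor (reV (Y z)) (e z) = -1 := by
    have : ((lor (reV (Y z)) (e z) : ℝ) : ℂ) = ((-1 : ℝ) : ℂ) := by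
      obtain ⟨⟨a1, a2, a3, a4⟩, _⟩ := h.table hz
      rw [← lor_toC, hE z hz, toC_reV (h.left.real z)]
      simp [a1, a3]
    exact_mod_cast this
  rw [hYe, he]
  have := hρ0 z hz
  match_scalars <;> field_simp
  ring

end NormalizedLifts

/-! ## The Hopf differential and the Willmore equation of a unit lift -/

/-- The null section `N` of a lift `Y`. -/
def nullSection (Y : ℂ → MinkC n) (z : ℂ) : MinkC n :=
  (2 : ℂ) • dzb (dz Y) z + (2 * lor (dzb (dz Y) z) (dzb (dz Y) z)) • Y z

/-- The Schwarzian of a lift. -/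
def schwarzianC (Y : ℂ → MinkC n) (z : ℂ) : ℂ := 2 * lor (dz (dz Y) z) (nullSection Y z)

/-- The Hopf differential of a lift. -/
def hopfC (Y : ℂ → MinkC n) (z : ℂ) : MinkC n := dz (dz Y) z + (schwarzianC Y z / 2) • Y z

/-- The projection to the normal bundle of a lift. -/
def normalProjC (Y : ℂ → MinkC n) (z : ℂ) (x : MinkC n) : MinkC n :=
  x + lor x (nullSection Y z) • Y z + lor x (Y z) • nullSection Y z
    - (2 * lor x (dzb Y z)) • dz Y z - (2 * lor x (dz Y z)) • dzb Y z

namespace UnitLift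

variable {U : Set ℂ} {Y : ℂ → MinkC n} {W : ℂ → Submodule ℝ (Mink n)}

/-- Since `⟨Y_zz̄, Y⟩ = -1/2`, the multiple of `Y` in `nullSection` is exactly the one that makes it
null. -/
lemma lor_nullSection (h : UnitLift U Y W) {z : ℂ} (hz : z ∈ U) :
    lor (Y z) (nullSection Y z) = -1 ∧ lor (dz Y z) (nullSection Y z) = 0 ∧
      lor (dzb Y z) (nullSection Y z) = 0 ∧ lor (nullSection Y z) (nullSection Y z) = 0 := by
  obtain ⟨_, _, t1, t2, t3⟩ := h.table hz
  have s1 := lor_comm (Y z) (dzb (dz Y) z)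
  have s2 := lor_comm (dz Y z) (dzb (dz Y) z)
  have s3 := lor_comm (dzb Y z) (dzb (dz Y) z)
  have s4 := lor_comm (dz Y z) (Y z)
  have s5 := lor_comm (dzb Y z) (Y z)
  rw [t1] at s1; rw [t2] at s2; rw [t3] at s3
  rw [h.lor_dz_self hz] at s4; rw [h.lor_dzb_self hz] at s5
  refine ⟨?_, ?_, ?_, ?_⟩ <;>
  · simp only [nullSection, lor_add_left, lor_add_right, lor_smul_left, lor_smul_right, s1, s2, s3,
      s4, s5, t1, h.null z]
    ring

lemma conjV_nullSection (h : UnitLift U Y W) {z : ℂ} (hz : z ∈ U) :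
    conjV (nullSection Y z) = nullSection Y z := by
  have e := h.conjV_dzb_dz hz
  have e2 := lor_conjV (dzb (dz Y) z) (dzb (dz Y) z)
  rw [e] at e2
  simp only [nullSection, conjV_add, conjV_smul, e, h.real, map_mul, map_ofNat, ← e2]

/-- The Hopf differential is real if `Y_zz` is real modulo `Y`. -/
lemma hopfC_real (h : UnitLift U Y W) {z : ℂ} (hz : z ∈ U) {c : ℂ}
    (hc : dzb (dzb Y) z = dz (dz Y) z + c • Y z) : conjV (hopfC Y z) = hopfC Y z := by
  have e1 := h.conjV_dz_dz hz
  have e2 := lor_conjV (dz (dz Y) z) (nullSection Y z)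
  rw [e1, h.conjV_nullSection hz] at e2
  -- Because `⟨Y, N⟩ = -1`, conjugation subtracts from `s / 2` the same `c` that it adds to `Y_zz`;
  -- the two changes cancel in `κ`.
  have e3 : (starRingEnd ℂ) (schwarzianC Y z / 2) = schwarzianC Y z / 2 - c := by
    have : schwarzianC Y z / 2 = lor (dz (dz Y) z) (nullSection Y z) := by
      rw [schwarzianC]; ring
    rw [this, ← e2, hc, lor_add_left, lor_smul_left, (h.lor_nullSection hz).1]
    ring
  rw [hopfC, conjV_add, conjV_smul, e1, e3, h.real, hc]
  module

lemma normalProjC_add (z : ℂ) (x y : MinkC n) :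
    normalProjC Y z (x + y) = normalProjC Y z x + normalProjC Y z y := by
  simp only [normalProjC, lor_add_left]; module

lemma normalProjC_smul (z : ℂ) (c : ℂ) (x : MinkC n) :
    normalProjC Y z (c • x) = c • normalProjC Y z x := by
  simp only [normalProjC, lor_smul_left]; module

/-- The projection kills all of `V`, including `Y_zz̄`, which is a combination of `N` and `Y`. -/
lemma normalProjC_frame (h : UnitLift U Y W) {z : ℂ} (hz : z ∈ U) :
    normalProjC Y z (Y z) = 0 ∧ normalProjC Y z (dz Y z) = 0 ∧ normalProjC Y z (dzb Y z) = 0 ∧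
      normalProjC Y z (nullSection Y z) = 0 ∧ normalProjC Y z (dzb (dz Y) z) = 0 := by
  obtain ⟨n1, n2, n3, n4⟩ := h.lor_nullSection hz
  have s1 := lor_comm (nullSection Y z) (Y z)
  have s2 := lor_comm (nullSection Y z) (dz Y z)
  have s3 := lor_comm (nullSection Y z) (dzb Y z)
  have s4 := lor_comm (dz Y z) (Y z)
  have s5 := lor_comm (dzb Y z) (Y z)
  have s6 := lor_comm (dzb Y z) (dz Y z)
  rw [n1] at s1; rw [n2] at s2; rw [n3] at s3
  rw [h.lor_dz_self hz] at s4; rw [h.lor_dzb_self hz] at s5; rw [h.metric z hz] at s6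
  have p1 : normalProjC Y z (Y z) = 0 := by
    simp only [normalProjC, n1, h.null z, h.lor_dz_self hz, h.lor_dzb_self hz]; module
  have p4 : normalProjC Y z (nullSection Y z) = 0 := by
    simp only [normalProjC, n4, s1, s2, s3]; module
  refine ⟨p1, ?_, ?_, p4, ?_⟩
  · simp only [normalProjC, n2, s4, h.conf z hz, h.metric z hz]; module
  · simp only [normalProjC, n3, s5, s6, h.conf' hz]; module
  · have : dzb (dz Y) z = (1 / 2 : ℂ) • nullSection Y z +
        (-lor (dzb (dz Y) z) (dzb (dz Y) z)) • Y z := by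
      rw [nullSection]; module
    rw [this, normalProjC_add, normalProjC_smul, normalProjC_smul, p1, p4]
    module

lemma normalProjC_hopfC (h : UnitLift U Y W) {z : ℂ} (hz : z ∈ U) :
    normalProjC Y z (hopfC Y z) = hopfC Y z := by
  obtain ⟨n1, n2, n3, n4⟩ := h.lor_nullSection hz
  obtain ⟨⟨t1, t2, t3⟩, _⟩ := h.table hz
  have e : lor (hopfC Y z) (nullSection Y z) = 0 := by
    simp only [hopfC, schwarzianC, lor_add_left, lor_smul_left, n1]; ring
  rw [normalProjC, e]
  simp only [hopfC, lor_add_left, lor_smul_left, t1, t2, t3, h.null z, h.lor_dz_self hz,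
    h.lor_dzb_self hz]
  module

/-- `κ` is normal and differs from `Y_zz` by a multiple of `Y`, which the projection kills. -/
lemma normalProjC_dz_dz (h : UnitLift U Y W) {z : ℂ} (hz : z ∈ U) :
    normalProjC Y z (dz (dz Y) z) = hopfC Y z := by
  have := h.normalProjC_hopfC hz
  rwa [hopfC, normalProjC_add, normalProjC_smul, (h.normalProjC_frame hz).1, smul_zero,
    add_zero] at this

lemma smooth_hopfC (h : UnitLift U Y W) {z : ℂ} (hz : z ∈ U) :
    ContDiffAt ℝ ∞ (schwarzianC Y) z ∧ ContDiffAt ℝ ∞ (hopfC Y) z := by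
  have h1 : ContDiffAt ℝ ∞ (dzb (dz Y)) z := by
    rw [dzb_eq']; exact (h.smooth_dz hz).vecDeriv _
  have h2 : ContDiffAt ℝ ∞ (dz (dz Y)) z := (h.smooth_dz hz).vecDeriv _
  have h3 : ContDiffAt ℝ ∞ (nullSection Y) z := (contDiffAt_const.smulC h1).add
    ((contDiffAt_const.mul (h1.lorProd h1)).smulC (h.smooth z hz))
  have h4 : ContDiffAt ℝ ∞ (schwarzianC Y) z := contDiffAt_const.mul (h2.lorProd h3)
  exact ⟨h4, h2.add ((h4.div_const 2).smulC (h.smooth z hz))⟩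

end UnitLift

/-! ### Mean curvature sphere congruences and the Willmore equation when `θ = 0`. -/

namespace NormalizedLifts

variable {U : Set ℂ} {Y Z : ℂ → MinkC n} {W : ℂ → Submodule ℝ (Mink n)}

/-- If `θ = 0` and `S` is the mean curvature sphere congruence of `Y`, it is that of `Z`. -/
lemma dzb_dz_partner_mem (h : NormalizedLifts U Y Z W) (ht : ∀ z ∈ U, thetaC Y Z z = 0)
    {z : ℂ} (hz : z ∈ U) (hm : dzb (dz Y) z ∈ WC (W z)) : dzb (dz Z) z ∈ WC (W z) := by
  -- Differentiating the structure equation, the only vector not automatically in the sphere is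
  -- `Y_zz̄`, where the hypothesis applies.
  rw [h.dzb_dz_partner_of_theta ht hz]
  have hs := fun (c : ℂ) {x : MinkC n} (hx : x ∈ WC (W z)) => (WC (W z)).smul_mem c hx
  exact add_mem (add_mem (add_mem (hs _ (h.right.mem z hz)) (hs _ (h.right.mem_dzb hz)))
    (hs _ (h.perp_mem hz))) (hs _ (add_mem (add_mem hm (hs _ (h.left.mem z hz)))
      (hs _ (h.left.mem_dzb hz))))

/-- This is `meanCurv = 0` solved for `Y_zz̄`, in the form that is differentiated to obtain `D_z̄
κ`. -/
lemma dzb_dz_of_mem (h : NormalizedLifts U Y Z W) {z : ℂ} (hz : z ∈ U)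
    (hm : dzb (dz Y) z ∈ WC (W z)) :
    dzb (dz Y) z = (1 / 2 : ℂ) • Z z + (-lamb Y Z z) • dz Y z + (-lam Y Z z) • dzb Y z +
      (-lor (dzb (dz Y) z) (Z z) - 2 * (lam Y Z z * lamb Y Z z)) • Y z := by
  have := (h.meanCurv_eq_zero_iff hz).mpr hm
  simp only [meanCurv, perp, perpb] at this
  linear_combination (norm := module) this

/-- If `θ = 0` and `S` is the mean curvature sphere congruence, then `s / 2 = λ_z - λ²`. -/
lemma schwarzianC_eq (h : NormalizedLifts U Y Z W) (ht : ∀ z ∈ U, thetaC Y Z z = 0)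
    {z : ℂ} (hz : z ∈ U) (hm : dzb (dz Y) z ∈ WC (W z)) :
    schwarzianC Y z / 2 = wd I (lam Y Z) z - lam Y Z z ^ 2 := by
  obtain ⟨⟨t1, t2, t3⟩, _⟩ := h.unitLift.table hz
  -- `Y_zz` is orthogonal to `Y`, `Y_z`, `Y_z̄`, and `N` equals `Z` modulo these three.
  have e1 : schwarzianC Y z / 2 = lor (dz (dz Y) z) (Z z) := by
    have e : nullSection Y z = (2 : ℂ) • dzb (dz Y) z +
      (2 * lor (dzb (dz Y) z) (dzb (dz Y) z)) • Y z := rfl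
    rw [schwarzianC, e, lor_add_right, lor_smul_right, lor_smul_right, t1,
      h.dzb_dz_of_mem hz hm]
    simp only [lor_add_right, lor_smul_right, t1, t2, t3]
    ring
  have e2 : wd I (lam Y Z) z = lor (dz (dz Y) z) (Z z) + lor (dz Y z) (dz Z z) :=
    wd_lor I (h.left.smooth_dz hz).diffAt (h.right.smooth z hz).diffAt
  have e3 : lor (dz Y z) (dz Z z) = lam Y Z z ^ 2 := by
    obtain ⟨⟨_, _, _, _, p5, _⟩, _⟩ := h.lor_perp_table hz
    rw [h.dz_partner_of_theta ht hz, lor_add_right, lor_smul_right, lor_smul_right, p5]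
    simp only [lam]
    ring
  rw [e1, e2, e3]
  ring

/-- If `θ = 0` and `S` is the mean curvature sphere congruence, then `D_z̄ κ = -λ̄ κ`. -/
lemma normal_dzb_hopfC (h : NormalizedLifts U Y Z W) (ht : ∀ z ∈ U, thetaC Y Z z = 0)
    (hm : ∀ z ∈ U, dzb (dz Y) z ∈ WC (W z)) {z : ℂ} (hz : z ∈ U) :
    normalProjC Y z (dzb (hopfC Y) z) = (-lamb Y Z z) • hopfC Y z := by
  have hu := h.unitLift
  obtain ⟨f1, f2, f3, f4, f5⟩ := hu.normalProjC_frame hz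
  have sY := h.left.smooth z hz
  have sA := h.left.smooth_dz hz
  have sB := h.left.smooth_dzb hz
  have sZ := h.right.smooth z hz
  have s1 : ContDiffAt ℝ ∞ (dz (dz Y)) z := sA.vecDeriv _
  have s2 : ContDiffAt ℝ ∞ (dzb (dz Y)) z := by rw [dzb_eq']; exact sA.vecDeriv _
  have s3 : ContDiffAt ℝ ∞ (fun w => schwarzianC Y w / 2) z := (hu.smooth_hopfC hz).1.div_const 2
  have sl : ContDiffAt ℝ ∞ (fun w => -lam Y Z w) z := (h.smooth_lam hz).neg
  have slb : ContDiffAt ℝ ∞ (fun w => -lamb Y Z w) z := (h.smooth_lamb hz).neg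
  have sr : ContDiffAt ℝ ∞
      (fun w => -lor (dzb (dz Y) w) (Z w) - 2 * (lam Y Z w * lamb Y Z w)) z :=
    (s2.lorProd sZ).neg.sub (contDiffAt_const.mul ((h.smooth_lam hz).mul (h.smooth_lamb hz)))
  have e1 : dzb (hopfC Y) z = dzb (dz (dz Y)) z + (wd (-I) (fun w => schwarzianC Y w / 2) z • Y z +
      (schwarzianC Y z / 2) • dzb Y z) := by
    rw [dzb_eq, dzb_eq, dzb_eq, ← vd_smul (-I) s3.diffAt sY.diffAt]
    exact vd_add (-I) s1.diffAt (s3.smulC sY).diffAt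
  -- After this exchange the formula for `Y_zz̄` can be differentiated in `z`. Its only term outside
  -- `V` is `-λ̄ Y_zz`: since `θ = 0`, `Z_z` is a combination of `Z`, `Y_z` and `Y`, all in `V`.
  have e2 : dzb (dz (dz Y)) z = dz (dzb (dz Y)) z := by
    rw [dzb_eq']; exact vd_comm (-I) I sA
  have pZ : normalProjC Y z (Z z) = 0 := by
    have : Z z = (2 : ℂ) • (dzb (dz Y) z + lamb Y Z z • dz Y z + lam Y Z z • dzb Y z +
        (lor (dzb (dz Y) z) (Z z) + 2 * (lam Y Z z * lamb Y Z z)) • Y z) := by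
      have := h.dzb_dz_of_mem hz (hm z hz)
      linear_combination (norm := module) (-2 : ℂ) • this
    rw [this]
    simp only [UnitLift.normalProjC_add, UnitLift.normalProjC_smul, f1, f2, f3, f5]
    module
  have e3 : dz (dzb (dz Y)) z = (1 / 2 : ℂ) • dz Z z +
      (wd I (fun w => -lamb Y Z w) z • dz Y z + (-lamb Y Z z) • dz (dz Y) z) +
      (wd I (fun w => -lam Y Z w) z • dzb Y z + (-lam Y Z z) • dz (dzb Y) z) +
      (wd I (fun w => -lor (dzb (dz Y) w) (Z w) - 2 * (lam Y Z w * lamb Y Z w)) z • Y z +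
        (-lor (dzb (dz Y) z) (Z z) - 2 * (lam Y Z z * lamb Y Z z)) • dz Y z) := by
    have c1 := vd_eq_of_eqOn h.left.isOpen I (fun w hw => h.dzb_dz_of_mem hw (hm w hw)) hz
    have sc : ContDiffAt ℝ ∞ (fun w => (1 / 2 : ℂ) • Z w) z := contDiffAt_const.smulC sZ
    rw [vd_add I ((sc.add (slb.smulC sA)).add (sl.smulC sB)).diffAt (sr.smulC sY).diffAt,
      vd_add I (sc.add (slb.smulC sA)).diffAt (sl.smulC sB).diffAt,
      vd_add I sc.diffAt (slb.smulC sA).diffAt,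
      vd_smul I (differentiableAt_const _) sZ.diffAt, vd_smul I slb.diffAt sA.diffAt,
      vd_smul I sl.diffAt sB.diffAt, vd_smul I sr.diffAt sY.diffAt, wd_const, zero_smul,
      zero_add] at c1
    exact c1
  rw [e1, e2, e3, h.left.dz_dzb hz, h.dz_partner_of_theta ht hz, perp]
  simp only [UnitLift.normalProjC_add, UnitLift.normalProjC_smul, f1, f2, f3, f5, pZ,
    hu.normalProjC_dz_dz hz]
  module

/-- If `θ = 0` and `S` is the mean curvature sphere congruence, then `Y` is Willmore. -/
lemma willmore (h : NormalizedLifts U Y Z W) (ht : ∀ z ∈ U, thetaC Y Z z = 0)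
    (hm : ∀ z ∈ U, dzb (dz Y) z ∈ WC (W z)) {z : ℂ} (hz : z ∈ U) :
    normalProjC Y z (dzb (fun w => normalProjC Y w (dzb (hopfC Y) w)) z) +
      ((starRingEnd ℂ) (schwarzianC Y z) / 2) • hopfC Y z = 0 := by
  have hu := h.unitLift
  have e1 := vd_eq_of_eqOn h.left.isOpen (-I) (fun w hw => h.normal_dzb_hopfC ht hm hw) hz
  have slb : ContDiffAt ℝ ∞ (fun w => -lamb Y Z w) z := (h.smooth_lamb hz).neg
  rw [vd_smul (-I) slb.diffAt (hu.smooth_hopfC hz).2.diffAt, ← dzb_eq, ← dzb_eq] at e1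
  have e2 : wd (-I) (fun w => -lamb Y Z w) z = -(starRingEnd ℂ) (wd I (lam Y Z) z) := by
    rw [wd_neg, wd_eq_of_eqOn h.left.isOpen (-I) (fun w hw => h.lamb_eq hw) hz,
      wd_conj (-I) (h.smooth_lam hz).diffAt]
    simp
  have e3 : (starRingEnd ℂ) (schwarzianC Y z) / 2 =
      (starRingEnd ℂ) (wd I (lam Y Z) z) - lamb Y Z z ^ 2 := by
    have := congrArg (starRingEnd ℂ) (h.schwarzianC_eq ht hz (hm z hz))
    rw [map_sub, map_pow, ← h.lamb_eq hz, map_div₀, map_ofNat] at this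
    exact this
  -- Using `D_z̄ κ = -λ̄ κ` twice, the second derivative is `(-λ̄_z̄ + λ̄²) κ`, which equals `-(s̄ /
  -- 2) κ`.
  rw [e1, UnitLift.normalProjC_add, UnitLift.normalProjC_smul, UnitLift.normalProjC_smul,
    hu.normalProjC_hopfC hz, h.normal_dzb_hopfC ht hm hz, e2, e3]
  module

end NormalizedLifts

/-! ## Independence of the lift -/

/-- The coefficient `θ` computed from arbitrary lifts. -/
def thetaB (Y Z : ℂ → MinkC n) (z : ℂ) : ℂ :=
  2 * (biv (dz Y z) (Y z) (dz Z z) (Z z) / biv (Y z) (Z z) (Y z) (Z z))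

/-- The coefficient `ρ` computed from arbitrary lifts. -/
def rhoB (Y Z : ℂ → MinkC n) (z : ℂ) : ℂ :=
  2 * (biv (dzb Y z) (Y z) (dz Z z) (Z z) / biv (Y z) (Z z) (Y z) (Z z))

lemma thetaB_swap (Y Z : ℂ → MinkC n) (z : ℂ) : thetaB Z Y z = thetaB Y Z z := by
  simp only [thetaB, biv, lor_comm (Z z), lor_comm (dz Z z)]
  congr 2 <;> ring

/-- The term `r_z Y` disappears in the wedge with `Y`, and numerator and denominator both acquire
the factor `r²`. -/
lemma thetaB_rescale_left {Y Z : ℂ → MinkC n} {r : ℂ → ℂ} {z : ℂ} (hr : DifferentiableAt ℝ r z)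
    (hY : DifferentiableAt ℝ Y z) (h0 : r z ≠ 0) :
    thetaB (fun w => r w • Y w) Z z = thetaB Y Z z := by
  have h1 : dz (fun w => r w • Y w) z = wd I r z • Y z + r z • dz Y z := vd_smul I hr hY
  rw [thetaB, thetaB, h1, ← mul_div_mul_left (biv (dz Y z) (Y z) (dz Z z) (Z z)) _
    (pow_ne_zero 2 h0)]
  simp only [biv, lor_add_left, lor_smul_left, lor_smul_right]
  congr 2 <;> ring

lemma rhoB_rescale_left {Y Z : ℂ → MinkC n} {r : ℂ → ℂ} {z : ℂ} (hr : DifferentiableAt ℝ r z)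
    (hY : DifferentiableAt ℝ Y z) (h0 : r z ≠ 0) :
    rhoB (fun w => r w • Y w) Z z = rhoB Y Z z := by
  have h1 : dzb (fun w => r w • Y w) z = wd (-I) r z • Y z + r z • dzb Y z := by
    rw [dzb_eq, dzb_eq]; exact vd_smul (-I) hr hY
  rw [rhoB, rhoB, h1, ← mul_div_mul_left (biv (dzb Y z) (Y z) (dz Z z) (Z z)) _
    (pow_ne_zero 2 h0)]
  simp only [biv, lor_add_left, lor_smul_left, lor_smul_right]
  congr 2 <;> ring

lemma rhoB_rescale_right {Y Z : ℂ → MinkC n} {r : ℂ → ℂ} {z : ℂ} (hr : DifferentiableAt ℝ r z)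
    (hZ : DifferentiableAt ℝ Z z) (h0 : r z ≠ 0) :
    rhoB Y (fun w => r w • Z w) z = rhoB Y Z z := by
  have h1 : dz (fun w => r w • Z w) z = wd I r z • Z z + r z • dz Z z := vd_smul I hr hZ
  rw [rhoB, rhoB, h1, ← mul_div_mul_left (biv (dzb Y z) (Y z) (dz Z z) (Z z)) _
    (pow_ne_zero 2 h0)]
  simp only [biv, lor_add_right, lor_smul_left, lor_smul_right]
  congr 2 <;> ring

lemma thetaB_rescale_right {Y Z : ℂ → MinkC n} {r : ℂ → ℂ} {z : ℂ} (hr : DifferentiableAt ℝ r z)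
    (hZ : DifferentiableAt ℝ Z z) (h0 : r z ≠ 0) :
    thetaB Y (fun w => r w • Z w) z = thetaB Y Z z := by
  rw [thetaB_swap, thetaB_rescale_left hr hZ h0, thetaB_swap]

namespace BlaschkeLifts

variable {U : Set ℂ} {Y Z : ℂ → MinkC n} {W : ℂ → Submodule ℝ (Mink n)}

/-- For real lifts, exchanging the surfaces exchanges the roles of `z` and `z̄` in the numerator,
which is conjugation. By contrast `θ` is symmetric. -/
lemma rhoB_swap (h : BlaschkeLifts U Y Z W) {z : ℂ} (hz : z ∈ U) :
    rhoB Z Y z = (starRingEnd ℂ) (rhoB Y Z z) := by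
  rw [rhoB, rhoB, map_mul, map_div₀, map_ofNat]
  simp only [biv, map_sub, map_mul, ← lor_conjV, h.left.real, h.right.real,
    ← h.left.dz_eq_conjV hz, ← h.right.dzb_eq_conjV hz, lor_comm (Z z), lor_comm (dzb Z z)]
  congr 2 <;> ring

end BlaschkeLifts

namespace NormalizedLifts

variable {U : Set ℂ} {Y Z : ℂ → MinkC n} {W : ℂ → Submodule ℝ (Mink n)}

/-- For normalized lifts the denominator is `-1` and the numerator is `-⟨Z_z, P⟩`, so the invariant
quotient is the coefficient in the structure equation. -/
lemma thetaB_eq (h : NormalizedLifts U Y Z W) {z : ℂ} (hz : z ∈ U) :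
    thetaB Y Z z = thetaC Y Z z := by
  obtain ⟨⟨a1, a2, a3, a4⟩, _, _, _, _, _, e3, _⟩ := h.table hz
  have e4 := lor_comm (Y z) (dz Z z)
  rw [e3] at e4
  simp only [thetaB, thetaC, perp, biv, lor_add_right, lor_smul_right, a1, a2, a3, a4, e3, e4,
    lor_comm (dz Z z) (dz Y z)]
  simp only [lam]
  ring

lemma rhoB_eq (h : NormalizedLifts U Y Z W) {z : ℂ} (hz : z ∈ U) :
    rhoB Y Z z = rhoC Y Z z := by
  obtain ⟨⟨a1, a2, a3, a4⟩, _, _, _, _, _, e3, _⟩ := h.table hz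
  have e4 := lor_comm (Y z) (dz Z z)
  rw [e3] at e4
  simp only [rhoB, rhoC, perpb, biv, lor_add_right, lor_smul_right, a1, a2, a3, a4, e3, e4,
    lor_comm (dz Z z) (dzb Y z)]
  simp only [lam, lamb]
  ring

end NormalizedLifts

/-! ## The canonical lift -/

lemma du_toC {F : ℂ → Mink n} {z : ℂ} (hF : DifferentiableAt ℝ F z) :
    du (fun w => toC (F w)) z = toC (du F z) ∧ dv (fun w => toC (F w)) z = toC (dv F z) := by
  have h1 : ∀ v, fderiv ℝ (fun w => toC (F w)) z v = toC (fderiv ℝ F z v) := by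
    intro v
    have : HasFDerivAt (fun w => toC (F w))
        (ContinuousLinearMap.pi fun i => Complex.ofRealCLM.comp
          ((ContinuousLinearMap.proj i).comp (fderiv ℝ F z))) z := by
      rw [hasFDerivAt_pi]
      intro i
      exact Complex.ofRealCLM.hasFDerivAt.comp z (hasFDerivAt_pi'.mp hF.hasFDerivAt i)
    rw [this.fderiv]
    ext i
    simp [toC]
  exact ⟨h1 1, h1 I⟩

lemma contDiffAt_of_toC {F : ℂ → Mink n} {z : ℂ} (hF : ContDiffAt ℝ ∞ (fun w => toC (F w)) z) :
    ContDiffAt ℝ ∞ F z := by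
  rw [contDiffAt_pi]
  intro i
  have h1 := contDiffAt_pi.mp hF i
  exact Complex.reCLM.contDiff.contDiffAt.comp z h1

lemma contDiffAt_toC {F : ℂ → Mink n} {z : ℂ} (hF : ContDiffAt ℝ ∞ F z) :
    ContDiffAt ℝ ∞ (fun w => toC (F w)) z :=
  contDiffAt_pi.mpr fun i => Complex.ofRealCLM.contDiff.contDiffAt.comp z
    (contDiffAt_pi.mp hF i)

lemma dz_toC {F : ℂ → Mink n} {z : ℂ} (hF : DifferentiableAt ℝ F z) :
    dz (fun w => toC (F w)) z = (1 / 2 : ℂ) • (toC (du F z) - I • toC (dv F z)) ∧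
    dzb (fun w => toC (F w)) z = (1 / 2 : ℂ) • (toC (du F z) + I • toC (dv F z)) := by
  rw [dz, dzb, (du_toC hF).1, (du_toC hF).2]
  exact ⟨rfl, rfl⟩

lemma du_zero_of_const {F : ℂ → Mink n} {z : ℂ} (hF : DifferentiableAt ℝ F z)
    (h0 : ∀ w, F w 0 = 1) : du F z 0 = 0 := by
  have h1 := (hasFDerivAt_pi'.mp hF.hasFDerivAt 0)
  have h2 : HasFDerivAt (fun w => F w 0) (0 : ℂ →L[ℝ] ℝ) z := by
    simp only [h0]
    exact hasFDerivAt_const 1 z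
  have h3 := h1.unique h2
  have := congrArg (fun L : ℂ →L[ℝ] ℝ => L 1) h3
  simpa [du] using this

lemma lor_nonneg_of_zero {x : Mink n} (h : x 0 = 0) : 0 ≤ lor x x := by
  rw [lor, h]
  have : 0 ≤ ∑ i : Fin (n + 1), x i.succ * x i.succ :=
    Finset.sum_nonneg fun i _ => mul_self_nonneg _
  linarith

namespace ConformalLift

variable {U : Set ℂ} {F : ℂ → Mink n} {W : ℂ → Submodule ℝ (Mink n)}

lemma real_relations (h : ConformalLift U (fun w => toC (F w)) W) {z : ℂ} (hz : z ∈ U) :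
    reV (dz (fun w => toC (F w)) z) = (1 / 2 : ℝ) • du F z ∧
      imV (dz (fun w => toC (F w)) z) = -((1 / 2 : ℝ) • dv F z) := by
  have hd := (dz_toC (contDiffAt_of_toC (h.smooth z hz)).diffAt).1
  rw [hd]
  constructor <;> ext i <;> simp [reV, imV, toC]

lemma lor_du_eq_dv (h : ConformalLift U (fun w => toC (F w)) W) {z : ℂ} (hz : z ∈ U) :
    lor (du F z) (du F z) = lor (dv F z) (dv F z) ∧ lor (du F z) (dv F z) = 0 ∧
      lor (du F z) (du F z) ≠ 0 ∧ lor (F z) (du F z) = 0 ∧ lor (F z) (dv F z) = 0 ∧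
      lor (dz (fun w => toC (F w)) z) (dzb (fun w => toC (F w)) z) =
        ((lor (du F z) (du F z) / 2 : ℝ) : ℂ) := by
  obtain ⟨h1, h2, h3, h4, h5⟩ := h.lor_real_parts hz
  obtain ⟨r1, r2⟩ := h.real_relations hz
  rw [r1] at h1 h2 h3 h4
  rw [r2] at h1 h2 h5
  simp only [lor_smul_left, lor_smul_right, lor_neg_left, lor_neg_right, reV_toC] at h1 h2 h3 h4 h5
  have e1 : lor (du F z) (du F z) = lor (dv F z) (dv F z) := by linarith
  have e2 : lor (du F z) (dv F z) = 0 := by linarith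
  refine ⟨e1, e2, fun h0 => h3 (by rw [h0]; ring), by linarith, by linarith, ?_⟩
  have hd := dz_toC (contDiffAt_of_toC (h.smooth z hz)).diffAt
  rw [hd.1, hd.2]
  simp only [lor_smul_left, lor_smul_right, lor_add_right, lor_sub_left, lor_toC,
    lor_comm (dv F z) (du F z), e2, ← e1]
  push_cast
  linear_combination (-((lor (du F z) (du F z) : ℝ) : ℂ) / 4) * I_sq

/-- The time coordinate of `F` is constant, so `F_u` is purely spatial and has nonnegative square;
the immersion condition excludes zero. -/
lemma du_pos (h : ConformalLift U (fun w => toC (F w)) W) (h0 : ∀ w, F w 0 = 1) {z : ℂ}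
    (hz : z ∈ U) : 0 < lor (du F z) (du F z) :=
  lt_of_le_of_ne (lor_nonneg_of_zero (du_zero_of_const
    (contDiffAt_of_toC (h.smooth z hz)).diffAt h0)) (h.lor_du_eq_dv hz).2.2.1.symm

/-- The factor of the canonical lift. -/
lemma smooth_factor (h : ConformalLift U (fun w => toC (F w)) W) (h0 : ∀ w, F w 0 = 1) {z : ℂ}
    (hz : z ∈ U) :
    ContDiffAt ℝ ∞ (fun w => (((Real.sqrt (lor (du F w) (du F w)))⁻¹ : ℝ) : ℂ)) z := by
  have h1 : ContDiffAt ℝ ∞ (fun w => 2 * (lor (dz (fun w => toC (F w)) w)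
      (dzb (fun w => toC (F w)) w)).re) z :=
    contDiffAt_const.mul (Complex.reCLM.contDiff.contDiffAt.comp z
      ((h.smooth_dz hz).lorProd (h.smooth_dzb hz)))
  have h2 : ContDiffAt ℝ ∞ (fun w => lor (du F w) (du F w)) z := by
    refine h1.congr_of_eventuallyEq ?_
    filter_upwards [h.isOpen.mem_nhds hz] with w hw
    rw [(h.lor_du_eq_dv hw).2.2.2.2.2, Complex.ofReal_re]
    ring
  have hp := h.du_pos h0 hz
  exact Complex.ofRealCLM.contDiff.contDiffAt.comp z
    ((h2.sqrt hp.ne').inv (Real.sqrt_pos.mpr hp).ne')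

lemma canonicalLift_eq (F : ℂ → Mink n) : canonicalLift F =
    fun z => (((Real.sqrt (lor (du F z) (du F z)))⁻¹ : ℝ) : ℂ) • toC (F z) := by
  ext1 z
  rw [canonicalLift, toC_smul]

lemma factor_ne_zero (h : ConformalLift U (fun w => toC (F w)) W) (h0 : ∀ w, F w 0 = 1) {z : ℂ}
    (hz : z ∈ U) : (((Real.sqrt (lor (du F z) (du F z)))⁻¹ : ℝ) : ℂ) ≠ 0 := by
  have := (Real.sqrt_pos.mpr (h.du_pos h0 hz)).ne'
  exact_mod_cast inv_ne_zero this

lemma unitLift_canonicalLift (h : ConformalLift U (fun w => toC (F w)) W)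
    (h0 : ∀ w, F w 0 = 1) : UnitLift U (canonicalLift F) W := by
  rw [canonicalLift_eq]
  refine ⟨h.rescale (fun z => Complex.conj_ofReal _) (fun z hz => h.smooth_factor h0 hz)
    (fun z hz => h.factor_ne_zero h0 hz), fun z hz => ?_⟩
  have hs := (h.smooth_factor h0 hz).diffAt
  have hF := (h.smooth z hz).diffAt
  have e1 := vd_smul I hs hF
  have e2 := vd_smul (-I) hs hF
  rw [← dzb_eq, ← dzb_eq] at e2
  rw [← dz_eq, ← dz_eq] at e1
  rw [e1, e2]
  have h1 := h.lor_dz_self hz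
  rw [lor_comm] at h1
  simp only [lor_add_left, lor_add_right, lor_smul_left, lor_smul_right, h.null z, h1,
    h.lor_dzb_self hz, (h.lor_du_eq_dv hz).2.2.2.2.2]
  have hp := h.du_pos h0 hz
  have hsq := Real.mul_self_sqrt hp.le
  have hsp := (Real.sqrt_pos.mpr hp).ne'
  set s := Real.sqrt (lor (du F z) (du F z))
  rw [← hsq]
  have hsp' : (s : ℂ) ≠ 0 := by exact_mod_cast hsp
  push_cast
  field_simp
  ring

end ConformalLift

namespace BlaschkeLifts

variable {U : Set ℂ} {F G : ℂ → Mink n} {W : ℂ → Submodule ℝ (Mink n)}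

/-- The canonical lift of the first surface and the normalized lift of the second one. -/
lemma normalized (h : BlaschkeLifts U (fun w => toC (F w)) (fun w => toC (G w)) W)
    (h0 : ∀ w, F w 0 = 1) :
    NormalizedLifts U (canonicalLift F) (normalizedPartner F G) W ∧
      (∀ z ∈ U, thetaC (canonicalLift F) (normalizedPartner F G) z = thetaCoord F G z) ∧
      (∀ z ∈ U, rhoC (canonicalLift F) (normalizedPartner F G) z = rhoCoord F G z) := by
  have hu := h.left.unitLift_canonicalLift h0
  have e := ConformalLift.canonicalLift_eq F
  have hb : BlaschkeLifts U (canonicalLift F) (fun w => toC (G w)) W := by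
    rw [e]
    exact h.rescale_left (fun z => Complex.conj_ofReal _)
      (fun z hz => h.left.smooth_factor h0 hz) (fun z hz => h.left.factor_ne_zero h0 hz)
  -- `ConformalLift` asks for reality at every `z`, also outside `U`.
  have hr : ∀ z, (starRingEnd ℂ) (-(lor (canonicalLift F z) (toC (G z)))⁻¹) =
      -(lor (canonicalLift F z) (toC (G z)))⁻¹ := by
    intro z
    rw [map_neg, map_inv₀, ← lor_conjV, hu.real, conjV_toC]
  have hs : ∀ z ∈ U, ContDiffAt ℝ ∞ (fun z => -(lor (canonicalLift F z) (toC (G z)))⁻¹) z :=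
    fun z hz => (((hb.left.smooth z hz).lorProd (hb.right.smooth z hz)).inv (hb.ne z hz)).neg
  have hn : ∀ z ∈ U, -(lor (canonicalLift F z) (toC (G z)))⁻¹ ≠ 0 := fun z hz =>
    neg_ne_zero.mpr (inv_ne_zero (hb.ne z hz))
  have hN : NormalizedLifts U (canonicalLift F) (normalizedPartner F G) W := by
    refine ⟨hb.rescale_right hr hs hn, hu.metric, fun z hz => ?_⟩
    rw [normalizedPartner, lor_smul_right]
    have := hb.ne z hz
    field_simp
  refine ⟨hN, fun z hz => ?_, fun z hz => ?_⟩
  · rw [← hN.thetaB_eq hz]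
    refine (thetaB_rescale_right (hs z hz).diffAt (hb.right.smooth z hz).diffAt
      (hn z hz)).trans ?_
    rw [e]
    exact thetaB_rescale_left (h.left.smooth_factor h0 hz).diffAt (h.left.smooth z hz).diffAt
      (h.left.factor_ne_zero h0 hz)
  · rw [← hN.rhoB_eq hz]
    refine (rhoB_rescale_right (hs z hz).diffAt (hb.right.smooth z hz).diffAt
      (hn z hz)).trans ?_
    rw [e]
    exact rhoB_rescale_left (h.left.smooth_factor h0 hz).diffAt (h.left.smooth z hz).diffAt
      (h.left.factor_ne_zero h0 hz)

end BlaschkeLifts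

/-! ## Change of coordinates -/

lemma fderiv_comp_holomorphic {E : Type*} [NormedAddCommGroup E] [NormedSpace ℝ E] {H : ℂ → E}
    {φ : ℂ → ℂ} {z : ℂ} (hH : DifferentiableAt ℝ H (φ z)) (hφ : DifferentiableAt ℂ φ z) (v : ℂ) :
    fderiv ℝ (fun w => H (φ w)) z v = (deriv φ z * v).re • fderiv ℝ H (φ z) 1 +
      (deriv φ z * v).im • fderiv ℝ H (φ z) I := by
  have h1 : HasFDerivAt φ (deriv φ z • (1 : ℂ →L[ℝ] ℂ)) z :=
    hφ.hasDerivAt.complexToReal_fderiv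
  have h2 : fderiv ℝ (fun w => H (φ w)) z = (fderiv ℝ H (φ z)).comp (deriv φ z • (1 : ℂ →L[ℝ] ℂ)) :=
    (hH.hasFDerivAt.comp z h1).fderiv
  have h3 : deriv φ z * v = (deriv φ z * v).re • (1 : ℂ) + (deriv φ z * v).im • I := by
    simp only [Complex.real_smul, mul_one]
    exact (Complex.re_add_im _).symm
  rw [h2, ← map_smul, ← map_smul, ← map_add, ← h3]
  simp

lemma dz_comp {H : ℂ → MinkC n} {φ : ℂ → ℂ} {z : ℂ} (hH : DifferentiableAt ℝ H (φ z))
    (hφ : DifferentiableAt ℂ φ z) :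
    dz (fun w => H (φ w)) z = deriv φ z • dz H (φ z) := by
  simp only [dz, du, dv, fderiv_comp_holomorphic hH hφ]
  generalize fderiv ℝ H (φ z) 1 = a
  generalize fderiv ℝ H (φ z) I = b
  generalize deriv φ z = c
  ext i
  apply Complex.ext <;> simp <;> ring

lemma dzb_comp {H : ℂ → MinkC n} {φ : ℂ → ℂ} {z : ℂ} (hH : DifferentiableAt ℝ H (φ z))
    (hφ : DifferentiableAt ℂ φ z) :
    dzb (fun w => H (φ w)) z = (starRingEnd ℂ) (deriv φ z) • dzb H (φ z) := by
  simp only [dzb, du, dv, fderiv_comp_holomorphic hH hφ]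
  generalize fderiv ℝ H (φ z) 1 = a
  generalize fderiv ℝ H (φ z) I = b
  generalize deriv φ z = c
  ext i
  apply Complex.ext <;> simp <;> ring

lemma wd_holomorphic {g : ℂ → ℂ} {z : ℂ} (hg : DifferentiableAt ℂ g z) : wd (-I) g z = 0 := by
  have h1 : fderiv ℝ g z = deriv g z • (1 : ℂ →L[ℝ] ℂ) :=
    hg.hasDerivAt.complexToReal_fderiv.fderiv
  rw [wd, h1]
  simp
  linear_combination (deriv g z) * I_sq

/-- `g_z̄ = 0` is the Cauchy–Riemann equation. -/
lemma differentiableAt_of_wd {g : ℂ → ℂ} {z : ℂ} (hg : DifferentiableAt ℝ g z)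
    (h : wd (-I) g z = 0) : DifferentiableAt ℂ g z := by
  rw [differentiableAt_complex_iff_differentiableAt_real]
  refine ⟨hg, ?_⟩
  rw [wd] at h
  rw [smul_eq_mul]
  linear_combination (-2 * I) * h + (fderiv ℝ g z I) * I_sq

/-- The map `F` is, near `z`, the composition of `H` with the holomorphic coordinate change `φ`. -/
structure CoordChange (V : Set ℂ) (φ : ℂ → ℂ) (z : ℂ) (F H : ℂ → MinkC n) : Prop where
  isOpen : IsOpen V
  mem : z ∈ V
  holo : DifferentiableOn ℂ φ V
  deriv_ne : deriv φ z ≠ 0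
  eq : ∀ w ∈ V, F w = H (φ w)
  smooth : ∀ w ∈ V, ContDiffAt ℝ ∞ H (φ w)

namespace CoordChange

variable {V : Set ℂ} {φ : ℂ → ℂ} {z : ℂ} {F H : ℂ → MinkC n}

lemma differentiableAt (h : CoordChange V φ z F H) {w : ℂ} (hw : w ∈ V) :
    DifferentiableAt ℂ φ w := h.holo.differentiableAt (h.isOpen.mem_nhds hw)

lemma dz_eq_of_mem (h : CoordChange V φ z F H) {w : ℂ} (hw : w ∈ V) :
    dz F w = deriv φ w • dz H (φ w) := by
  rw [← dz_comp (h.smooth w hw).diffAt (h.differentiableAt hw)]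
  exact vd_eq_of_eqOn h.isOpen I h.eq hw

lemma dz_eq (h : CoordChange V φ z F H) : dz F z = deriv φ z • dz H (φ z) :=
  h.dz_eq_of_mem h.mem

lemma dzb_eq (h : CoordChange V φ z F H) :
    dzb F z = (starRingEnd ℂ) (deriv φ z) • dzb H (φ z) := by
  rw [← dzb_comp (h.smooth z h.mem).diffAt (h.differentiableAt h.mem), MoebiusSurf.dzb_eq,
    MoebiusSurf.dzb_eq]
  exact vd_eq_of_eqOn h.isOpen (-I) h.eq h.mem

/-- `φ'` is holomorphic, so `∂/∂z̄` does not act on it and no first order term arises: `Y_zz̄` is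
only scaled by `|φ'|²`. -/
lemma dzb_dz_eq (h : CoordChange V φ z F H) :
    dzb (dz F) z = (starRingEnd ℂ (deriv φ z) * deriv φ z) • dzb (dz H) (φ z) := by
  have hφ := h.differentiableAt h.mem
  have s : DifferentiableAt ℝ (dz H) (φ z) := ((h.smooth z h.mem).vecDeriv I).diffAt
  have e1 := vd_eq_of_eqOn h.isOpen (-I) (fun w hw => h.dz_eq_of_mem hw) h.mem
  have hd : DifferentiableAt ℂ (deriv φ) z :=
    (h.holo.deriv h.isOpen).differentiableAt (h.isOpen.mem_nhds h.mem)
  have s2 : DifferentiableAt ℝ (fun w => dz H (φ w)) z := s.comp z (hφ.restrictScalars ℝ)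
  rw [vd_smul (-I) (hd.restrictScalars ℝ) s2, wd_holomorphic hd, zero_smul, zero_add,
    ← MoebiusSurf.dzb_eq, ← MoebiusSurf.dzb_eq, dzb_comp s hφ, smul_smul] at e1
  rw [mul_comm]
  exact e1

/-- `θ dz²` is a quadratic differential, whereas `ρ` transforms as the coefficient of `dz dz̄`. -/
lemma thetaB_eq (h : CoordChange V φ z F H) {F' H' : ℂ → MinkC n}
    (h' : CoordChange V φ z F' H') : thetaB F F' z = deriv φ z ^ 2 * thetaB H H' (φ z) := by
  rw [thetaB, thetaB, h.dz_eq, h'.dz_eq, h.eq z h.mem, h'.eq z h.mem]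
  simp only [biv, lor_smul_left, lor_smul_right]
  ring

lemma rhoB_eq (h : CoordChange V φ z F H) {F' H' : ℂ → MinkC n}
    (h' : CoordChange V φ z F' H') :
    rhoB F F' z = (starRingEnd ℂ (deriv φ z) * deriv φ z) * rhoB H H' (φ z) := by
  rw [rhoB, rhoB, h.dzb_eq, h'.dz_eq, h.eq z h.mem, h'.eq z h.mem]
  simp only [biv, lor_smul_left, lor_smul_right]
  ring

end CoordChange

/-! ## Surfaces on a Riemann surface -/

section Surfaces

variable {M : Type*} [TopologicalSpace M] [ChartedSpace ℂ M]

lemma lor_nullLift_self (x : Sph n) : lor (nullLift x) (nullLift x) = 0 := by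
  have h : ‖(x : EuclideanSpace ℝ (Fin (n + 1)))‖ = 1 := by simp
  have h2 := EuclideanSpace.norm_sq_eq (x : EuclideanSpace ℝ (Fin (n + 1)))
  rw [h] at h2
  simp only [lor, nullLift, Fin.cons_zero, Fin.cons_succ]
  simp only [Real.norm_eq_abs, sq_abs] at h2
  simp only [← sq]
  linarith

/-- Since `(1, x)` and `(1, y)` are null, their product is `-|x - y|² / 2`. -/
lemma lor_nullLift_neg {x y : Sph n} (hxy : x ≠ y) : lor (nullLift x) (nullLift y) < 0 := by
  have h1 := lor_nullLift_self x
  have h2 := lor_nullLift_self y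
  have e : lor (nullLift x - nullLift y) (nullLift x - nullLift y) =
      -2 * lor (nullLift x) (nullLift y) := by
    simp only [lor_sub_left, lor_sub_right, h1, h2, lor_comm (nullLift y) (nullLift x)]
    ring
  have e2 : lor (nullLift x - nullLift y) (nullLift x - nullLift y) =
      ∑ i : Fin (n + 1), ((x : EuclideanSpace ℝ (Fin (n + 1))) i -
        (y : EuclideanSpace ℝ (Fin (n + 1))) i) ^ 2 := by
    simp [lor, nullLift, ← sq]
  have hp : 0 < ∑ i : Fin (n + 1), ((x : EuclideanSpace ℝ (Fin (n + 1))) i -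
        (y : EuclideanSpace ℝ (Fin (n + 1))) i) ^ 2 := by
    have hne : ∃ i, (x : EuclideanSpace ℝ (Fin (n + 1))) i ≠
        (y : EuclideanSpace ℝ (Fin (n + 1))) i := by
      by_contra! hc
      exact hxy (Subtype.ext (PiLp.ext hc))
    obtain ⟨i, hi⟩ := hne
    exact Finset.sum_pos' (fun j _ => sq_nonneg _)
      ⟨i, Finset.mem_univ i, by have := sub_ne_zero.mpr hi; positivity⟩
  linarith

lemma nullLift_zero (x : Sph n) : nullLift x 0 = 1 := rfl

lemma IsConformalImmersion.smooth_at {f : M → Sph n} (hf : IsConformalImmersion f) (q : M) :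
    ContDiffAt ℝ ∞ (fun w => toC (liftAt f q w)) (pt q) := by
  have h := (contMDiffAt_iff.mp (hf.smooth q)).2
  have h1 : ContDiffAt ℝ ∞
      (fun w => ((f ((chartAt ℂ q).symm w) : Sph n) : EuclideanSpace ℝ (Fin (n + 1)))) (pt q) := by
    simpa [chartAt_self_eq, mfld_simps, Function.comp_def, contDiffWithinAt_univ, pt] using h
  apply contDiffAt_toC
  rw [contDiffAt_pi]
  intro i
  refine Fin.cases ?_ (fun j => ?_) i
  · exact contDiffAt_const
  · exact (contDiffAt_piLp 2).mp h1 j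

end Surfaces

lemma mem_contDiffGroupoid_iff (ψ : OpenPartialHomeomorph ℂ ℂ) :
    ψ ∈ contDiffGroupoid ω 𝓘(ℂ, ℂ) ↔
      ContDiffOn ℂ ω ψ ψ.source ∧ ContDiffOn ℂ ω ψ.symm ψ.target := by
  rw [contDiffGroupoid, mem_groupoid_of_pregroupoid]
  simp [contDiffPregroupoid]

/-- Direct expansion gives the Laplacian plus `I / 4` times the commutator of `∂/∂u` and `∂/∂v`. The
latter term is imaginary while `F_zz̄` is real, so it vanishes. -/
lemma ConformalLift.laplacian {U : Set ℂ} {F : ℂ → Mink n} {W : ℂ → Submodule ℝ (Mink n)}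
    (h : ConformalLift U (fun w => toC (F w)) W) {z : ℂ} (hz : z ∈ U) :
    dzb (dz (fun w => toC (F w))) z =
      (1 / 4 : ℂ) • toC (du (du F) z + dv (dv F) z) := by
  have hF : ∀ w ∈ U, ContDiffAt ℝ ∞ F w := fun w hw => contDiffAt_of_toC (h.smooth w hw)
  have hd : ContDiffAt ℝ ∞ (fderiv ℝ F) z := (hF z hz).fderiv_right (by simp)
  have su : ContDiffAt ℝ ∞ (du F) z := hd.clm_apply contDiffAt_const
  have sv : ContDiffAt ℝ ∞ (dv F) z := hd.clm_apply contDiffAt_const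
  have e1 := vd_eq_of_eqOn h.isOpen (-I) (fun w hw => (dz_toC (hF w hw).diffAt).1) hz
  have t2 : ContDiffAt ℝ ∞ (fun w => I • toC (dv F w)) z :=
    contDiffAt_const.smulC (contDiffAt_toC sv)
  rw [vd_smul (-I) (F := fun w => toC (du F w) - I • toC (dv F w)) (differentiableAt_const _)
      ((contDiffAt_toC su).sub t2).diffAt, vd_sub (-I) (contDiffAt_toC su).diffAt t2.diffAt,
    vd_smul (-I) (differentiableAt_const _) (contDiffAt_toC sv).diffAt, wd_const, wd_const,
    ← dzb_eq, ← dzb_eq, ← dzb_eq, (dz_toC su.diffAt).2, (dz_toC sv.diffAt).2] at e1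
  have e2 := h.conjV_dzb_dz hz
  have e3 : dzb (dz (fun w => toC (F w))) z = (1 / 4 : ℂ) • toC (du (du F) z + dv (dv F) z) +
      (I / 4) • (toC (dv (du F) z) - toC (du (dv F) z)) := by
    refine e1.trans ?_
    rw [toC_add]
    match_scalars <;> first | ring1 | linear_combination (-1 / 4 : ℂ) * I_sq
  rw [e3] at e2
  simp only [conjV_add, conjV_sub, conjV_smul, conjV_toC, map_div₀, Complex.conj_I, map_ofNat,
    map_one] at e2
  have e4 : (I / 4) • (toC (dv (du F) z) - toC (du (dv F) z)) = 0 := by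
    linear_combination (norm := module) (-1 / 2 : ℂ) • e2
  rw [e3, e4, add_zero]

/-! ### Lifts in arbitrary holomorphic coordinates and the transformation laws on `M`. -/

section Surfaces

variable {M : Type*} [TopologicalSpace M]

/-- The lift `(1, f)` in the coordinate `e`, as a complex vector. -/
def complexLift (f : M → Sph n) (e : OpenPartialHomeomorph M ℂ) (z : ℂ) : MinkC n :=
  toC (coordLift f e z)

lemma coordLift_transition (f : M → Sph n) {e e' : OpenPartialHomeomorph M ℂ} {w : ℂ}
    (hw : w ∈ (e.symm ≫ₕ e').source) :
    coordLift f e w = coordLift f e' ((e.symm ≫ₕ e') w) := by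
  have h2 : e.symm w ∈ e'.source := by
    have := hw
    rw [OpenPartialHomeomorph.trans_source] at this
    exact this.2
  simp only [coordLift, OpenPartialHomeomorph.coe_trans, Function.comp_apply, e'.left_inv h2]

lemma mem_transition_source {e e' : OpenPartialHomeomorph M ℂ} {z : ℂ} (hz : z ∈ e.target)
    (h : e.symm z ∈ e'.source) : z ∈ (e.symm ≫ₕ e').source := by
  rw [OpenPartialHomeomorph.trans_source]
  exact ⟨hz, h⟩

variable [ChartedSpace ℂ M]

lemma IsConformalImmersion.dz_liftAt {f : M → Sph n} (hf : IsConformalImmersion f) (q : M) :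
    dz (complexLift f (chartAt ℂ q)) (pt q) =
      (1 / 2 : ℂ) • (toC (du (liftAt f q) (pt q)) - I • toC (dv (liftAt f q) (pt q))) ∧
    dzb (complexLift f (chartAt ℂ q)) (pt q) =
      (1 / 2 : ℂ) • (toC (du (liftAt f q) (pt q)) + I • toC (dv (liftAt f q) (pt q))) :=
  dz_toC (contDiffAt_of_toC (hf.smooth_at q)).diffAt

lemma IsBlaschkeSolution.swap {f g : M → Sph n} {S : M → Submodule ℝ (Mink n)}
    (h : IsBlaschkeSolution f g S) : IsBlaschkeSolution g f S :=
  ⟨h.conformal_right, h.conformal_left, fun p => (h.distinct p).symm, h.envelops_right,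
    h.envelops_left⟩

lemma pt_mem (q : M) : pt q ∈ (chartAt ℂ q).target :=
  (chartAt ℂ q).map_source (mem_chart_source ℂ q)

lemma symm_pt (q : M) : (chartAt ℂ q).symm (pt q) = q :=
  (chartAt ℂ q).left_inv (mem_chart_source ℂ q)

/-- The inverse transition map is holomorphic too; the chain rule for the composition excludes a
zero of the derivative. -/
lemma transition_holomorphic {e e' : OpenPartialHomeomorph M ℂ}
    (he : e ∈ IsManifold.maximalAtlas 𝓘(ℂ, ℂ) ω M)
    (he' : e' ∈ IsManifold.maximalAtlas 𝓘(ℂ, ℂ) ω M) :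
    DifferentiableOn ℂ (e.symm ≫ₕ e') (e.symm ≫ₕ e').source ∧
      ∀ z ∈ (e.symm ≫ₕ e').source, deriv (e.symm ≫ₕ e') z ≠ 0 := by
  have h := (contDiffGroupoid ω 𝓘(ℂ, ℂ)).compatible_of_mem_maximalAtlas he he'
  set φ := e.symm ≫ₕ e'
  rw [mem_contDiffGroupoid_iff] at h
  have h1 := h.1.differentiableOn (by simp)
  have h2 := h.2.differentiableOn (by simp)
  refine ⟨h1, fun z hz h0 => ?_⟩
  have d1 := (h1.differentiableAt (φ.open_source.mem_nhds hz)).hasDerivAt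
  have d2 := (h2.differentiableAt (φ.open_target.mem_nhds (φ.map_source hz))).hasDerivAt
  have d3 := d2.comp z d1
  have d4 : HasDerivAt (φ.symm ∘ φ) 1 z := (hasDerivAt_id z).congr_of_eventuallyEq
    (Filter.eventuallyEq_of_mem (φ.open_source.mem_nhds hz) fun w hw => φ.left_inv hw)
  have := d3.unique d4
  rw [h0, mul_zero] at this
  exact zero_ne_one this

variable [IsManifold 𝓘(ℂ, ℂ) ω M]

lemma chartAt_mem (q : M) : chartAt ℂ q ∈ IsManifold.maximalAtlas 𝓘(ℂ, ℂ) ω M :=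
  IsManifold.chart_mem_maximalAtlas q

lemma IsConformalImmersion.smooth_complexLift {f : M → Sph n} (hf : IsConformalImmersion f)
    {e : OpenPartialHomeomorph M ℂ} (he : e ∈ IsManifold.maximalAtlas 𝓘(ℂ, ℂ) ω M) {z : ℂ}
    (hz : z ∈ e.target) : ContDiffAt ℝ ∞ (complexLift f e) z := by
  set q := e.symm z
  have hzs := mem_transition_source hz (mem_chart_source ℂ q)
  set φ := e.symm ≫ₕ chartAt ℂ q
  have hφ : ContDiffAt ℂ ∞ φ z := ((transition_holomorphic he (chartAt_mem q)).1.analyticAt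
    (φ.open_source.mem_nhds hzs)).contDiffAt
  have hpt : φ z = pt q := rfl
  have h1 := hf.smooth_at q
  rw [← hpt] at h1
  refine (h1.comp z (hφ.restrict_scalars ℝ)).congr_of_eventuallyEq ?_
  refine Filter.eventuallyEq_of_mem (φ.open_source.mem_nhds hzs) fun w hw => ?_
  rw [complexLift, coordLift_transition f hw]
  rfl

lemma IsConformalImmersion.coordChange {f : M → Sph n} (hf : IsConformalImmersion f)
    {e e' : OpenPartialHomeomorph M ℂ} (he : e ∈ IsManifold.maximalAtlas 𝓘(ℂ, ℂ) ω M)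
    (he' : e' ∈ IsManifold.maximalAtlas 𝓘(ℂ, ℂ) ω M) {z : ℂ}
    (hz : z ∈ (e.symm ≫ₕ e').source) :
    CoordChange (e.symm ≫ₕ e').source (e.symm ≫ₕ e') z (complexLift f e) (complexLift f e') := by
  obtain ⟨h1, h2⟩ := transition_holomorphic he he'
  refine ⟨(e.symm ≫ₕ e').open_source, hz, h1, h2 z hz, fun w hw => ?_, fun w hw => ?_⟩
  · rw [complexLift, coordLift_transition f hw]; rfl
  · refine hf.smooth_complexLift he' ?_
    have := (e.symm ≫ₕ e').map_source hw
    rw [OpenPartialHomeomorph.trans_target] at this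
    exact this.1

/-- The conditions on `f` are stated at each point in its own preferred chart; this coordinate
change, which depends on the point, carries them to a fixed coordinate `e`. -/
lemma IsConformalImmersion.coordChange_chartAt {f : M → Sph n} (hf : IsConformalImmersion f)
    {e : OpenPartialHomeomorph M ℂ} (he : e ∈ IsManifold.maximalAtlas 𝓘(ℂ, ℂ) ω M) {z : ℂ}
    (hz : z ∈ e.target) :
    CoordChange (e.symm ≫ₕ chartAt ℂ (e.symm z)).source (e.symm ≫ₕ chartAt ℂ (e.symm z)) z
      (complexLift f e) (complexLift f (chartAt ℂ (e.symm z))) :=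
  hf.coordChange he (chartAt_mem _) (mem_transition_source hz (mem_chart_source ℂ _))

/-- The lift of a conformal immersion that envelops `S`, in any holomorphic coordinate. -/
lemma IsConformalImmersion.conformalLift {f : M → Sph n} (hf : IsConformalImmersion f)
    {S : M → Submodule ℝ (Mink n)} (hS : Envelops f S)
    {e : OpenPartialHomeomorph M ℂ} (he : e ∈ IsManifold.maximalAtlas 𝓘(ℂ, ℂ) ω M) :
    ConformalLift e.target (complexLift f e) (fun z => S (e.symm z)) := by
  refine ⟨e.open_target, fun z => conjV_toC _, fun z => ?_, fun z hz => hf.smooth_complexLift he hz,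
    fun z hz => ?_, fun z hz => ?_, fun z _ => ?_, fun z hz => ?_, fun z _ => (hS _).1⟩
  · rw [complexLift, lor_toC, coordLift, lor_nullLift_self, Complex.ofReal_zero]
  · rw [(hf.coordChange_chartAt he hz).dz_eq]
    have e1 := (hf.dz_liftAt (e.symm z)).1
    have e2 := hf.isometric_axes (e.symm z)
    have e3 := hf.orthogonal_axes (e.symm z)
    have hpt : (e.symm ≫ₕ chartAt ℂ (e.symm z)) z = pt (e.symm z) := rfl
    rw [hpt, e1]
    simp only [lor_smul_left, lor_smul_right, lor_sub_left, lor_sub_right, lor_toC,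
      lor_comm (dv (liftAt f (e.symm z)) (pt (e.symm z))) (du (liftAt f (e.symm z)) (pt (e.symm z))),
      e2, e3]
    push_cast
    linear_combination (deriv (e.symm ≫ₕ chartAt ℂ (e.symm z)) z ^ 2 / 4 *
      ((lor (dv (liftAt f (e.symm z)) (pt (e.symm z)))
        (dv (liftAt f (e.symm z)) (pt (e.symm z))) : ℝ) : ℂ)) * I_sq
  · have hc := hf.coordChange_chartAt he hz
    rw [hc.dz_eq, hc.dzb_eq]
    obtain ⟨e0, e1⟩ := hf.dz_liftAt (e.symm z)
    have e2 := hf.isometric_axes (e.symm z)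
    have e3 := hf.orthogonal_axes (e.symm z)
    have hpt : (e.symm ≫ₕ chartAt ℂ (e.symm z)) z = pt (e.symm z) := rfl
    rw [hpt, e0, e1]
    have hd := (contDiffAt_of_toC (hf.smooth_at (e.symm z))).diffAt
    have hpos : lor (du (liftAt f (e.symm z)) (pt (e.symm z)))
        (du (liftAt f (e.symm z)) (pt (e.symm z))) ≠ 0 := by
      intro h0
      have hz0 : du (liftAt f (e.symm z)) (pt (e.symm z)) 0 = 0 :=
        du_zero_of_const hd (fun w => rfl)
      have hne := (hf.immersion (e.symm z)).ne_zero 0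
      apply hne
      simp only [Matrix.cons_val_zero]
      rw [lor, hz0, mul_zero, neg_zero, zero_add,
        Finset.sum_eq_zero_iff_of_nonneg (fun i _ => mul_self_nonneg _)] at h0
      ext i
      refine Fin.cases hz0 (fun j => ?_) i
      simpa using h0 j (Finset.mem_univ j)
    have hval : lor ((1 / 2 : ℂ) • (toC (du (liftAt f (e.symm z)) (pt (e.symm z))) -
          I • toC (dv (liftAt f (e.symm z)) (pt (e.symm z)))))
        ((1 / 2 : ℂ) • (toC (du (liftAt f (e.symm z)) (pt (e.symm z))) +
          I • toC (dv (liftAt f (e.symm z)) (pt (e.symm z))))) =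
        ((lor (du (liftAt f (e.symm z)) (pt (e.symm z)))
          (du (liftAt f (e.symm z)) (pt (e.symm z))) : ℝ) : ℂ) / 2 := by
      simp only [lor_smul_left, lor_smul_right, lor_sub_left, lor_add_right, lor_toC,
        lor_comm (dv (liftAt f (e.symm z)) (pt (e.symm z)))
          (du (liftAt f (e.symm z)) (pt (e.symm z))), ← e2, e3]
      push_cast
      linear_combination (-((lor (du (liftAt f (e.symm z)) (pt (e.symm z)))
        (du (liftAt f (e.symm z)) (pt (e.symm z))) : ℝ) : ℂ) / 4) * I_sq
    rw [lor_smul_left, lor_smul_right, hval]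
    have h1 := hc.deriv_ne
    have h2 : (starRingEnd ℂ) (deriv (e.symm ≫ₕ chartAt ℂ (e.symm z)) z) ≠ 0 := by simpa using h1
    have h3 : ((lor (du (liftAt f (e.symm z)) (pt (e.symm z)))
          (du (liftAt f (e.symm z)) (pt (e.symm z))) : ℝ) : ℂ) ≠ 0 := by exact_mod_cast hpos
    exact mul_ne_zero h1 (mul_ne_zero h2 (div_ne_zero h3 two_ne_zero))
  · exact toC_mem_WC.mpr (hS _).2.1
  · have hpt : (e.symm ≫ₕ chartAt ℂ (e.symm z)) z = pt (e.symm z) := rfl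
    rw [(hf.coordChange_chartAt he hz).dz_eq, hpt, (hf.dz_liftAt (e.symm z)).1]
    exact (WC _).smul_mem _ ((WC _).smul_mem _ (sub_mem (toC_mem_WC.mpr (hS _).2.2.1)
      ((WC _).smul_mem _ (toC_mem_WC.mpr (hS _).2.2.2))))

/-- The lifts of a solution of the Blaschke problem, in any holomorphic coordinate. -/
lemma IsBlaschkeSolution.lifts {f g : M → Sph n} {S : M → Submodule ℝ (Mink n)}
    (h : IsBlaschkeSolution f g S) {e : OpenPartialHomeomorph M ℂ}
    (he : e ∈ IsManifold.maximalAtlas 𝓘(ℂ, ℂ) ω M) :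
    BlaschkeLifts e.target (complexLift f e) (complexLift g e) (fun z => S (e.symm z)) := by
  refine ⟨h.conformal_left.conformalLift h.envelops_left he,
    h.conformal_right.conformalLift h.envelops_right he, fun z _ => ?_⟩
  rw [complexLift, complexLift, lor_toC]
  exact_mod_cast (lor_nullLift_neg (h.distinct (e.symm z))).ne

lemma IsBlaschkeSolution.theta_eq_zero_iff {f g : M → Sph n} {S : M → Submodule ℝ (Mink n)}
    (h : IsBlaschkeSolution f g S) {e : OpenPartialHomeomorph M ℂ}
    (he : e ∈ IsManifold.maximalAtlas 𝓘(ℂ, ℂ) ω M) {z : ℂ} (hz : z ∈ e.target) :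
    theta f g (e.symm z) = 0 ↔ thetaCoord (coordLift f e) (coordLift g e) z = 0 := by
  have hc := h.conformal_left.coordChange_chartAt he hz
  have e1 := hc.thetaB_eq (h.conformal_right.coordChange_chartAt he hz)
  have e2 : thetaCoord (coordLift f e) (coordLift g e) z =
    deriv (e.symm ≫ₕ chartAt ℂ (e.symm z)) z ^ 2 * theta f g (e.symm z) := e1
  rw [e2, mul_eq_zero_iff_left]
  exact pow_ne_zero 2 hc.deriv_ne

lemma IsBlaschkeSolution.rho_eq_zero_iff {f g : M → Sph n} {S : M → Submodule ℝ (Mink n)}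
    (h : IsBlaschkeSolution f g S) {e : OpenPartialHomeomorph M ℂ}
    (he : e ∈ IsManifold.maximalAtlas 𝓘(ℂ, ℂ) ω M) {z : ℂ} (hz : z ∈ e.target) :
    rho f g (e.symm z) = 0 ↔ rhoCoord (coordLift f e) (coordLift g e) z = 0 := by
  have hc := h.conformal_left.coordChange_chartAt he hz
  have e1 := hc.rhoB_eq (h.conformal_right.coordChange_chartAt he hz)
  have e2 : rhoCoord (coordLift f e) (coordLift g e) z =
    ((starRingEnd ℂ) (deriv (e.symm ≫ₕ chartAt ℂ (e.symm z)) z) *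
      deriv (e.symm ≫ₕ chartAt ℂ (e.symm z)) z) * rho f g (e.symm z) := e1
  rw [e2, mul_eq_zero_iff_left]
  exact mul_ne_zero ((map_ne_zero _).mpr hc.deriv_ne) hc.deriv_ne

/-- `S p` is the mean curvature sphere of `f` at `p` if and only if `S p` contains the mixed second
derivative of the lift. -/
lemma eq_meanCurvatureSphere_iff {f : M → Sph n} (hf : IsConformalImmersion f)
    {S : M → Submodule ℝ (Mink n)} (hS : Envelops f S)
    {e : OpenPartialHomeomorph M ℂ} (he : e ∈ IsManifold.maximalAtlas 𝓘(ℂ, ℂ) ω M) {z : ℂ}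
    (hz : z ∈ e.target) :
    S (e.symm z) = meanCurvatureSphere f (e.symm z) ↔
      dzb (dz (complexLift f e)) z ∈ WC (S (e.symm z)) := by
  have hc := hf.coordChange_chartAt he hz
  set q := e.symm z
  have hpt : (e.symm ≫ₕ chartAt ℂ q) z = pt q := rfl
  have hq := hf.conformalLift hS (chartAt_mem q)
  have hl := hq.laplacian (pt_mem q)
  have hd : dzb (dz (complexLift f (chartAt ℂ q))) (pt q) =
    (1 / 4 : ℂ) • toC (du (du (liftAt f q)) (pt q) + dv (dv (liftAt f q)) (pt q)) := hl
  have key : dzb (dz (complexLift f e)) z ∈ WC (S q) ↔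
      du (du (liftAt f q)) (pt q) + dv (dv (liftAt f q)) (pt q) ∈ S q := by
    rw [hc.dzb_dz_eq, hpt, hd, smul_smul, Submodule.smul_mem_iff _ ?_, toC_mem_WC]
    have h1 := hc.deriv_ne
    have h2 : (starRingEnd ℂ) (deriv (e.symm ≫ₕ chartAt ℂ q) z) ≠ 0 := by simpa using h1
    exact mul_ne_zero (mul_ne_zero h2 h1) (by norm_num)
  rw [key]
  constructor
  · intro h
    rw [h]
    exact Submodule.subset_span (by simp)
  · intro h
    obtain ⟨r1, r2, r3, r4, r5, r6⟩ := hq.lor_du_eq_dv (pt_mem q)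
    -- `⟨F_zz̄, F⟩ = -⟨F_z, F_z̄⟩ ≠ 0`, so the Laplacian completes `F, F_u, F_v` to a basis of the
    -- 4-space.
    have h0 : lor (liftAt f q (pt q)) (du (du (liftAt f q)) (pt q) + dv (dv (liftAt f q)) (pt q))
        ≠ 0 := by
      intro h0
      have i1 := hq.imm _ (pt_mem q)
      apply i1
      have i2 := lor_vd_add_eq_zero hq.isOpen (-I) 0 (fun w hw => hq.smooth_dz hw) hq.smooth
        (fun w hw => by rw [lor_comm]; exact hq.lor_dz_self hw) (pt_mem q)
      rw [← dzb_eq, ← dzb_eq, hd] at i2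
      have i3 : complexLift f (chartAt ℂ q) (pt q) = toC (liftAt f q (pt q)) := rfl
      rw [i3, lor_smul_left, lor_toC, lor_comm, h0] at i2
      simpa using i2
    refine (span_eq_of_linearIndependent (hS q).1.1 ?_ (hS q).2.2.1 (hS q).2.2.2 h
      (linearIndependent_of_lor (lor_nullLift_self _) r4 r5 r2 r3 (r1 ▸ r3) h0)).symm
    have h2 := (hS q).2.1
    rw [symm_pt]; exact h2

end Surfaces

/-! ## Holomorphic square roots as coordinate changes -/

/-- A quadratic differential that does not vanish at a point is `dw²` in a suitable coordinate. -/
lemma exists_coordinate {U : Set ℂ} (hU : IsOpen U) {z₀ : ℂ} (hz₀ : z₀ ∈ U) {q : ℂ → ℂ}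
    (hq : DifferentiableOn ℂ q U) (h0 : q z₀ ≠ 0) :
    ∃ ψ : OpenPartialHomeomorph ℂ ℂ, ψ ∈ contDiffGroupoid ω 𝓘(ℂ, ℂ) ∧ z₀ ∈ ψ.source ∧
      ψ.source ⊆ U ∧ ∀ z ∈ ψ.source, deriv ψ z ≠ 0 ∧ deriv ψ z ^ 2 = q z := by
  have hc : ContinuousAt (fun z => q z / q z₀) z₀ :=
    (hq.continuousOn.continuousAt (hU.mem_nhds hz₀)).div_const _
  have hs : ∀ᶠ z in 𝓝 z₀, q z / q z₀ ∈ slitPlane :=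
    hc.eventually_mem (isOpen_slitPlane.mem_nhds (by simp [div_self h0]))
  obtain ⟨r, hr, hball⟩ := Metric.eventually_nhds_iff_ball.mp (hs.and (hU.mem_nhds hz₀))
  set B := Metric.ball z₀ r
  -- A holomorphic square root of `q`: division by `q z₀` keeps the argument of the logarithm off
  -- the branch cut. A primitive of `s` on the ball is the coordinate.
  set s : ℂ → ℂ := fun z => exp (log (q z₀) / 2) * exp (log (q z / q z₀) / 2) with hsdef
  have hs2 : ∀ z ∈ B, s z ^ 2 = q z := by
    intro z hz
    have h1 := slitPlane_ne_zero (hball z hz).1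
    rw [hsdef, mul_pow, ← Complex.exp_nat_mul, ← Complex.exp_nat_mul]
    push_cast
    rw [mul_div_cancel₀ _ two_ne_zero, mul_div_cancel₀ _ two_ne_zero, exp_log h0, exp_log h1,
      mul_div_cancel₀ _ h0]
  have hs0 : ∀ z, s z ≠ 0 := fun z => mul_ne_zero (exp_ne_zero _) (exp_ne_zero _)
  have hsd : DifferentiableOn ℂ s B := by
    intro z hz
    have h1 : DifferentiableAt ℂ q z := hq.differentiableAt (hU.mem_nhds (hball z hz).2)
    exact ((((h1.div_const _).clog (hball z hz).1).div_const 2).cexp.const_mul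
      _).differentiableWithinAt
  obtain ⟨g, hg⟩ := hsd.isExactOn_ball
  have hgd : DifferentiableOn ℂ g B := fun z hz => (hg z hz).differentiableAt.differentiableWithinAt
  have hga : ∀ z ∈ B, ContDiffAt ℂ ω g z := fun z hz =>
    (hgd.analyticAt (Metric.isOpen_ball.mem_nhds hz)).contDiffAt
  have hz₀B : z₀ ∈ B := Metric.mem_ball_self hr
  set ψ₀ := (hga z₀ hz₀B).toOpenPartialHomeomorph g
    ((hg z₀ hz₀B).hasFDerivAt_equiv (hs0 z₀)) (by simp)
  set ψ := ψ₀.restrOpen B Metric.isOpen_ball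
  have hcoe : ⇑ψ = g := rfl
  have hsrc : ψ.source = ψ₀.source ∩ B := rfl
  have hB : ψ.source ⊆ B := fun z hz => hz.2
  refine ⟨ψ, ?_, ⟨?_, hz₀B⟩, fun z hz => (hball z (hB hz)).2, fun z hz => ?_⟩
  · rw [mem_contDiffGroupoid_iff]
    refine ⟨fun z hz => (hga z (hB hz)).contDiffWithinAt, fun z hz => ?_⟩
    have h1 := hB (ψ.map_target hz)
    exact (ψ.contDiffAt_symm_deriv (hs0 _) hz (hg _ h1) (hga _ h1)).contDiffWithinAt
  · exact (hga z₀ hz₀B).mem_toOpenPartialHomeomorph_source _ _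
  · rw [hcoe, (hg z (hB hz)).deriv]
    exact ⟨hs0 z, hs2 z (hB hz)⟩

/-! ## Orientations -/

/-- Comparison of the orientations of a 4-space defined by two null vectors and oriented planes. -/
lemma exists_bases {W : Submodule ℝ (Mink n)} (hW : Module.finrank ℝ W = 4)
    {a b c d b' c' : Mink n} (ha : a ∈ W) (hb : b ∈ W) (hc : c ∈ W) (hd : d ∈ W)
    (hb' : b' ∈ W) (hc' : c' ∈ W)
    (hli : LinearIndependent ℝ ![a, b, c, a + d]) {α₁ β₁ α₂ β₂ m₁₁ m₁₂ m₂₁ m₂₂ : ℝ}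
    (e1 : b' = α₁ • d + β₁ • a + m₁₁ • b + m₁₂ • c)
    (e2 : c' = α₂ • d + β₂ • a + m₂₁ • b + m₂₂ • c) (hdet : m₁₁ * m₂₂ - m₁₂ * m₂₁ ≠ 0) :
    ∃ B B' : Module.Basis (Fin 4) ℝ W, (∀ i, (B i : Mink n) = ![a, a + d, b, c] i) ∧
      (∀ i, (B' i : Mink n) = ![d, a + d, b', c'] i) ∧
      B.det B' = -(m₁₁ * m₂₂ - m₁₂ * m₂₁) := by
  have hli2 : LinearIndependent ℝ ![a, a + d, b, c] := by
    have hinj : Function.Injective (![0, 3, 1, 2] : Fin 4 → Fin 4) := by decide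
    have h1 := hli.comp _ hinj
    have h2 : ![a, b, c, a + d] ∘ (![0, 3, 1, 2] : Fin 4 → Fin 4) = ![a, a + d, b, c] := by
      ext i; fin_cases i <;> rfl
    rwa [h2] at h1
  set v : Fin 4 → W := ![⟨a, ha⟩, ⟨a + d, W.add_mem ha hd⟩, ⟨b, hb⟩, ⟨c, hc⟩] with hv
  have hvc : ∀ i, (v i : Mink n) = ![a, a + d, b, c] i := by
    intro i; fin_cases i <;> rfl
  have hvli : LinearIndependent ℝ v := by
    apply LinearIndependent.of_comp W.subtype
    have : W.subtype ∘ v = ![a, a + d, b, c] := funext hvc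
    rwa [this]
  set B := basisOfLinearIndependentOfCardEqFinrank hvli (by simp [hW])
  have hB : ∀ i, B i = v i := fun i => by
    simp [B]
  set w : Fin 4 → W := ![⟨d, hd⟩, ⟨a + d, W.add_mem ha hd⟩, ⟨b', hb'⟩, ⟨c', hc'⟩] with hw
  have hwc : ∀ i, (w i : Mink n) = ![d, a + d, b', c'] i := by
    intro i; fin_cases i <;> rfl
  -- The rows express `d, a + d, b', c'` in the basis `a, a + d, b, c`, using `d = (a + d) - a`. The
  -- upper left block has determinant `-1`: exchanging the null vectors reverses the orientation.
  set A : Matrix (Fin 4) (Fin 4) ℝ := !![-1, 1, 0, 0; 0, 1, 0, 0; β₁ - α₁, α₁, m₁₁, m₁₂;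
    β₂ - α₂, α₂, m₂₁, m₂₂] with hA
  have hwA : ∀ j, w j = ∑ i, A j i • B i := by
    intro j
    apply Subtype.ext
    rw [hwc]
    simp only [Fin.sum_univ_four, hB, Submodule.coe_add, Submodule.coe_smul, hvc]
    fin_cases j
    · simp [hA]
    · simp [hA]
    · simp [hA, e1]; module
    · simp [hA, e2]; module
  have hmat : B.toMatrix w = A.transpose := by
    ext i j
    rw [Module.Basis.toMatrix_apply, hwA, Module.Basis.repr_sum_self, Matrix.transpose_apply]
  have hdetw : B.det w = -(m₁₁ * m₂₂ - m₁₂ * m₂₁) := by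
    rw [Module.Basis.det_apply, hmat, Matrix.det_transpose, hA]
    simp [Matrix.det_succ_row_zero, Fin.sum_univ_succ, Fin.succAbove]
    ring
  have hunit : IsUnit (B.det w) := by
    rw [hdetw]; exact (neg_ne_zero.mpr hdet).isUnit
  obtain ⟨l1, l2⟩ := (B.is_basis_iff_det).mpr hunit
  refine ⟨B, Module.Basis.mk l1 l2.ge, fun i => by rw [hB, hvc],
    fun i => by rw [Module.Basis.mk_apply, hwc], ?_⟩
  rw [Module.Basis.coe_mk, hdetw]

/-- The structure equations of `BlaschkeLifts` in real form. -/
lemma real_of_complex_relation {a b b' c c' d : Mink n} {α β γ : ℂ}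
    (h : (1 / 2 : ℂ) • (toC b' - I • toC c') = α • toC d + β • toC a +
      γ • ((1 / 2 : ℂ) • (toC b + I • toC c))) :
    b' = (2 * α.re) • d + (2 * β.re) • a + γ.re • b + (-γ.im) • c ∧
    c' = (-(2 * α.im)) • d + (-(2 * β.im)) • a + (-γ.im) • b + (-γ.re) • c := by
  constructor
  · ext i
    have := congrArg Complex.re (congrFun h i)
    simp [toC] at this
    simp
    linarith
  · ext i
    have := congrArg Complex.im (congrFun h i)
    simp [toC] at this
    simp
    linarith

namespace BlaschkeLifts

variable {U : Set ℂ} {F G : ℂ → Mink n} {W : ℂ → Submodule ℝ (Mink n)}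

/-- The scalar of the normalized partner. -/
lemma exists_rescaling (h : BlaschkeLifts U (fun w => toC (F w)) (fun w => toC (G w)) W)
    (h0 : ∀ w, F w 0 = 1) :
    ∃ r s : ℂ → ℝ, (∀ z ∈ U, r z ≠ 0 ∧ s z ≠ 0) ∧
      (∀ z ∈ U, ContDiffAt ℝ ∞ (fun w => (r w : ℂ)) z ∧ ContDiffAt ℝ ∞ (fun w => (s w : ℂ)) z) ∧
      canonicalLift F = (fun z => (r z : ℂ) • toC (F z)) ∧
      normalizedPartner F G = (fun z => (s z : ℂ) • toC (G z)) := by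
  set r : ℂ → ℝ := fun z => (Real.sqrt (lor (du F z) (du F z)))⁻¹ with hr
  set s : ℂ → ℝ := fun z => -(r z * lor (F z) (G z))⁻¹ with hs
  have e1 := ConformalLift.canonicalLift_eq F
  have hcs : ∀ z, (s z : ℂ) = -(lor (canonicalLift F z) (toC (G z)))⁻¹ := by
    intro z
    rw [hs, hr, e1, lor_smul_left, lor_toC]
    push_cast
    rfl
  have hr0 : ∀ z ∈ U, r z ≠ 0 := fun z hz => by
    have := h.left.factor_ne_zero h0 hz
    exact_mod_cast this
  have hl0 : ∀ z ∈ U, lor (F z) (G z) ≠ 0 := fun z hz => by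
    have := h.ne z hz
    rw [lor_toC] at this
    exact_mod_cast this
  have hsm := fun z hz => h.left.smooth_factor h0 (z := z) hz
  refine ⟨r, s, fun z hz => ⟨hr0 z hz, neg_ne_zero.mpr (inv_ne_zero (mul_ne_zero (hr0 z hz)
    (hl0 z hz)))⟩, fun z hz => ⟨hsm z hz, ?_⟩, e1, ?_⟩
  · have h1 := ((hsm z hz).smulC (h.left.smooth z hz)).lorProd (h.right.smooth z hz)
    have h2 : ContDiffAt ℝ ∞ (fun w => -(lor (canonicalLift F w) (toC (G w)))⁻¹) z := by
      rw [e1]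
      refine (h1.inv ?_).neg
      rw [lor_smul_left]
      exact mul_ne_zero (h.left.factor_ne_zero h0 hz) (h.ne z hz)
    exact h2.congr_of_eventuallyEq (Filter.Eventually.of_forall hcs)
  · ext1 z
    rw [hcs]
    rfl

/-- The structure equation for unnormalized lifts: rescaling changes the derivatives by multiples of
the lifts and `γ` by a nonzero factor. `dz_right_of_theta` is the analogue in the other case. -/
lemma dz_right_of_rho (h : BlaschkeLifts U (fun w => toC (F w)) (fun w => toC (G w)) W)
    (h0 : ∀ w, F w 0 = 1) {z : ℂ} (hz : z ∈ U) (hρ : rhoCoord F G z = 0) :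
    ∃ α β γ : ℂ, γ ≠ 0 ∧ dz (fun w => toC (G w)) z =
      α • toC (G z) + β • toC (F z) + γ • dzb (fun w => toC (F w)) z := by
  obtain ⟨hN, _, h2⟩ := h.normalized h0
  obtain ⟨r, s, hrs, hsm, e1, e2⟩ := h.exists_rescaling h0
  rw [← h2 z hz] at hρ
  have hθ : thetaC (canonicalLift F) (normalizedPartner F G) z ≠ 0 :=
    (hN.rhoC_ne_zero_or hz).resolve_left (fun hc => hc hρ)
  have h3 := hN.dz_partner hz
  rw [hρ, zero_smul, add_zero, perpb] at h3
  have d1 : dz (normalizedPartner F G) z = wd I (fun w => (s w : ℂ)) z • toC (G z) +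
      (s z : ℂ) • dz (fun w => toC (G w)) z := by
    rw [e2]; exact vd_smul I (hsm z hz).2.diffAt (h.right.smooth z hz).diffAt
  have d2 : dzb (canonicalLift F) z = wd (-I) (fun w => (r w : ℂ)) z • toC (F z) +
      (r z : ℂ) • dzb (fun w => toC (F w)) z := by
    rw [e1, dzb_eq, dzb_eq]
    exact vd_smul (-I) (hsm z hz).1.diffAt (h.left.smooth z hz).diffAt
  have v1 : normalizedPartner F G z = (s z : ℂ) • toC (G z) := congrFun e2 z
  have v2 : canonicalLift F z = (r z : ℂ) • toC (F z) := congrFun e1 z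
  rw [d1, d2, v1, v2] at h3
  generalize thetaC (canonicalLift F) (normalizedPartner F G) z = θ at h3 hθ
  generalize lam (canonicalLift F) (normalizedPartner F G) z = l at h3
  generalize lamb (canonicalLift F) (normalizedPartner F G) z = lb at h3
  generalize wd I (fun w => (s w : ℂ)) z = ds at h3
  generalize wd (-I) (fun w => (r w : ℂ)) z = dr at h3
  have hs0 : (s z : ℂ) ≠ 0 := by exact_mod_cast (hrs z hz).2
  have hr0 : (r z : ℂ) ≠ 0 := by exact_mod_cast (hrs z hz).1
  refine ⟨(s z : ℂ)⁻¹ * (l * s z - ds), (s z : ℂ)⁻¹ * (θ * (dr + lb * r z)),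
    (s z : ℂ)⁻¹ * (θ * r z), mul_ne_zero (inv_ne_zero hs0) (mul_ne_zero hθ hr0), ?_⟩
  apply smul_right_injective _ hs0
  simp only [smul_add, smul_smul, mul_inv_cancel_left₀ hs0]
  linear_combination (norm := module) h3

lemma dz_right_of_theta (h : BlaschkeLifts U (fun w => toC (F w)) (fun w => toC (G w)) W)
    (h0 : ∀ w, F w 0 = 1) {z : ℂ} (hz : z ∈ U) (hθ : thetaCoord F G z = 0) :
    ∃ α β γ : ℂ, γ ≠ 0 ∧ dz (fun w => toC (G w)) z =
      α • toC (G z) + β • toC (F z) + γ • dz (fun w => toC (F w)) z := by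
  obtain ⟨hN, h2, _⟩ := h.normalized h0
  obtain ⟨r, s, hrs, hsm, e1, e2⟩ := h.exists_rescaling h0
  rw [← h2 z hz] at hθ
  have hρ : rhoC (canonicalLift F) (normalizedPartner F G) z ≠ 0 :=
    (hN.rhoC_ne_zero_or hz).resolve_right (fun hc => hc hθ)
  have h3 := hN.dz_partner hz
  rw [hθ, zero_smul, add_zero, perp] at h3
  have d1 : dz (normalizedPartner F G) z = wd I (fun w => (s w : ℂ)) z • toC (G z) +
      (s z : ℂ) • dz (fun w => toC (G w)) z := by
    rw [e2]; exact vd_smul I (hsm z hz).2.diffAt (h.right.smooth z hz).diffAt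
  have d2 : dz (canonicalLift F) z = wd I (fun w => (r w : ℂ)) z • toC (F z) +
      (r z : ℂ) • dz (fun w => toC (F w)) z := by
    rw [e1]; exact vd_smul I (hsm z hz).1.diffAt (h.left.smooth z hz).diffAt
  have v1 : normalizedPartner F G z = (s z : ℂ) • toC (G z) := congrFun e2 z
  have v2 : canonicalLift F z = (r z : ℂ) • toC (F z) := congrFun e1 z
  rw [d1, d2, v1, v2] at h3
  generalize rhoC (canonicalLift F) (normalizedPartner F G) z = θ at h3 hρ
  generalize lam (canonicalLift F) (normalizedPartner F G) z = l at h3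
  generalize wd I (fun w => (s w : ℂ)) z = ds at h3
  generalize wd I (fun w => (r w : ℂ)) z = dr at h3
  have hs0 : (s z : ℂ) ≠ 0 := by exact_mod_cast (hrs z hz).2
  have hr0 : (r z : ℂ) ≠ 0 := by exact_mod_cast (hrs z hz).1
  refine ⟨(s z : ℂ)⁻¹ * (l * s z - ds), (s z : ℂ)⁻¹ * (θ * (dr + l * r z)),
    (s z : ℂ)⁻¹ * (θ * r z), mul_ne_zero (inv_ne_zero hs0) (mul_ne_zero hρ hr0), ?_⟩
  apply smul_right_injective _ hs0
  simp only [smul_add, smul_smul, mul_inv_cancel_left₀ hs0]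
  linear_combination (norm := module) h3

end BlaschkeLifts

/-- The mixed second derivative of a lift lies in the sphere if that of a multiple does. -/
lemma ConformalLift.dzb_dz_rescale_mem_iff {U : Set ℂ} {Y : ℂ → MinkC n}
    {W : ℂ → Submodule ℝ (Mink n)} (h : ConformalLift U Y W) {r : ℂ → ℂ}
    (hs : ∀ z ∈ U, ContDiffAt ℝ ∞ r z) {z : ℂ} (hz : z ∈ U) (h0 : r z ≠ 0) :
    dzb (dz (fun z => r z • Y z)) z ∈ WC (W z) ↔ dzb (dz Y) z ∈ WC (W z) := by
  have e1 := vd_eq_of_eqOn h.isOpen (-I) (f := dz (fun z => r z • Y z))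
    (g := fun w => wd I r w • Y w + r w • dz Y w)
    (fun w hw => vd_smul I (hs w hw).diffAt (h.smooth w hw).diffAt) hz
  have s1 := (hs z hz).scalDeriv I
  have sY := h.smooth z hz
  have sA := h.smooth_dz hz
  rw [vd_add (-I) (s1.smulC sY).diffAt ((hs z hz).smulC sA).diffAt, vd_smul (-I) s1.diffAt sY.diffAt,
    vd_smul (-I) (hs z hz).diffAt sA.diffAt, ← dzb_eq, ← dzb_eq, ← dzb_eq, ← add_assoc] at e1
  rw [e1, Submodule.add_mem_iff_right, Submodule.smul_mem_iff _ h0]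
  have hm := fun (c : ℂ) {x : MinkC n} (hx : x ∈ WC (W z)) => (WC (W z)).smul_mem c hx
  exact add_mem (add_mem (hm _ (h.mem z hz)) (hm _ (h.mem_dzb hz))) (hm _ (h.mem_dz z hz))

lemma NormalizedLifts.mono {U V : Set ℂ} {Y Z : ℂ → MinkC n} {W : ℂ → Submodule ℝ (Mink n)}
    (h : NormalizedLifts U Y Z W) (hV : IsOpen V) (hVU : V ⊆ U) : NormalizedLifts V Y Z W :=
  ⟨h.toBlaschkeLifts.mono hV hVU, fun z hz => h.metric z (hVU hz),
    fun z hz => h.pairing z (hVU hz)⟩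

/-! ### The alternative, the orientations and the two cases on `M`. -/

section Surfaces

variable {M : Type*} [TopologicalSpace M]

lemma MoebiusCongruentNear.symm {f g : M → Sph n} {p : M} (h : MoebiusCongruentNear f g p) :
    MoebiusCongruentNear g f p := by
  obtain ⟨L, hL, U, hU, hp, hc⟩ := h
  refine ⟨L.symm, fun x y => ?_, U, hU, hp, fun q hq => ?_⟩
  · have := hL (L.symm x) (L.symm y)
    rw [L.apply_symm_apply, L.apply_symm_apply] at this
    exact this.symm
  · obtain ⟨c, h0, h1⟩ := hc q hq
    refine ⟨c⁻¹, inv_ne_zero h0, ?_⟩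
    rw [LinearEquiv.symm_apply_eq, map_smul, h1, smul_smul, inv_mul_cancel₀ h0, one_smul]

variable [ChartedSpace ℂ M]

lemma theta_swap (f g : M → Sph n) (p : M) : theta g f p = theta f g p := thetaB_swap _ _ _

variable [IsManifold 𝓘(ℂ, ℂ) ω M] {f g : M → Sph n} {S : M → Submodule ℝ (Mink n)}

namespace IsBlaschkeSolution

lemma normalized (h : IsBlaschkeSolution f g S) {e : OpenPartialHomeomorph M ℂ}
    (he : e ∈ IsManifold.maximalAtlas 𝓘(ℂ, ℂ) ω M) :
    NormalizedLifts e.target (canonicalLift (coordLift f e))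
      (normalizedPartner (coordLift f e) (coordLift g e)) (fun z => S (e.symm z)) ∧
    (∀ z ∈ e.target, thetaC (canonicalLift (coordLift f e))
      (normalizedPartner (coordLift f e) (coordLift g e)) z =
        thetaCoord (coordLift f e) (coordLift g e) z) ∧
    (∀ z ∈ e.target, rhoC (canonicalLift (coordLift f e))
      (normalizedPartner (coordLift f e) (coordLift g e)) z =
        rhoCoord (coordLift f e) (coordLift g e) z) :=
  BlaschkeLifts.normalized (h.lifts he) (fun _ => rfl)

lemma xor_rho_theta (h : IsBlaschkeSolution f g S) (p : M) :
    Xor (rho f g p = 0) (theta f g p = 0) := by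
  obtain ⟨hN, h1, h2⟩ := h.normalized (chartAt_mem p)
  have e1 := h1 _ (pt_mem p)
  have e2 := h2 _ (pt_mem p)
  have k1 := hN.rhoC_mul_thetaC (pt_mem p)
  have k2 := hN.rhoC_ne_zero_or (pt_mem p)
  rw [e1, e2] at k1 k2
  change rho f g p * theta f g p = 0 at k1
  change rho f g p ≠ 0 ∨ theta f g p ≠ 0 at k2
  rcases mul_eq_zero.mp k1 with h3 | h3
  · exact Or.inl ⟨h3, fun h4 => k2.elim (fun hc => hc h3) (fun hc => hc h4)⟩
  · exact Or.inr ⟨h3, fun h4 => k2.elim (fun hc => hc h4) (fun hc => hc h3)⟩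

/-- The frames of the two surfaces, and the determinant of the change of frame. -/
lemma exists_frames (h : IsBlaschkeSolution f g S) (p : M) {α₁ β₁ α₂ β₂ m₁₁ m₁₂ m₂₁ m₂₂ : ℝ}
    (e1 : du (liftAt g p) (pt p) = α₁ • liftAt g p (pt p) + β₁ • liftAt f p (pt p) +
      m₁₁ • du (liftAt f p) (pt p) + m₁₂ • dv (liftAt f p) (pt p))
    (e2 : dv (liftAt g p) (pt p) = α₂ • liftAt g p (pt p) + β₂ • liftAt f p (pt p) +
      m₂₁ • du (liftAt f p) (pt p) + m₂₂ • dv (liftAt f p) (pt p))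
    (hdet : m₁₁ * m₂₂ - m₁₂ * m₂₁ ≠ 0) :
    ∃ B B' : Module.Basis (Fin 4) ℝ (S p), SurfaceInduces f p (S p) B.orientation ∧
      SurfaceInduces g p (S p) B'.orientation ∧ B.det B' = -(m₁₁ * m₂₂ - m₁₂ * m₂₁) := by
  have hl := h.conformal_left.conformalLift h.envelops_left (chartAt_mem p)
  obtain ⟨r1, r2, r3, r4, r5, r6⟩ := hl.lor_du_eq_dv (pt_mem p)
  have vf : liftAt f p (pt p) = nullLift (f p) := congrArg (fun q => nullLift (f q)) (symm_pt p)
  have vg : liftAt g p (pt p) = nullLift (g p) := congrArg (fun q => nullLift (g q)) (symm_pt p)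
  rw [vf, vg] at e1 e2
  change lor (liftAt f p (pt p)) _ = 0 at r4 r5
  rw [vf] at r4 r5
  obtain ⟨s1, s2, s3, s4⟩ := h.envelops_left p
  obtain ⟨_, t2, t3, t4⟩ := h.envelops_right p
  have hneg := lor_nullLift_neg (h.distinct p)
  have hF := lor_nullLift_self (f p)
  have hG := lor_nullLift_self (g p)
  -- The sum of two distinct forward null vectors is forward time-like and can serve in both frames.
  have hT : IsFutureTimelike (nullLift (f p) + nullLift (g p)) := by
    refine ⟨?_, ?_⟩
    · simp only [lor_add_left, lor_add_right, hF, hG, lor_comm (nullLift (g p)) (nullLift (f p))]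
      linarith
    · simp [nullLift_zero]
  have hli := linearIndependent_of_lor (d := nullLift (f p) + nullLift (g p)) hF r4 r5 r2 r3
    (r1 ▸ r3) (by rw [lor_add_right, hF, zero_add]; exact hneg.ne)
  obtain ⟨B, B', hB, hB', hd⟩ := exists_bases s1.1 s2 s3 s4 t2 t3 t4 hli e1 e2 hdet
  exact ⟨B, B', ⟨_, B, hT, hB, rfl⟩, ⟨_, B', hT, hB', rfl⟩, hd⟩

/-- Through `γ F_z̄` the tangent frames are related by a matrix of determinant `-|γ|²`; the exchange
of the null vectors brings a second sign. -/
lemma compatible_of_rho (h : IsBlaschkeSolution f g S) (p : M) (hρ : rho f g p = 0) :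
    CompatibleOrientations f g p (S p) := by
  obtain ⟨α, β, γ, hγ, e⟩ := BlaschkeLifts.dz_right_of_rho (h.lifts (chartAt_mem p))
    (fun _ => rfl) (pt_mem p) hρ
  have e1 := (h.conformal_left.dz_liftAt p).2
  have e2 := (h.conformal_right.dz_liftAt p).1
  obtain ⟨k1, k2⟩ := real_of_complex_relation ((e2.symm.trans e).trans
    (congrArg (fun x => α • toC (liftAt g p (pt p)) + β • toC (liftAt f p (pt p)) + γ • x) e1))
  have hpos : 0 < γ.re ^ 2 + γ.im ^ 2 := by
    have := Complex.normSq_pos.mpr hγ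
    rw [Complex.normSq_apply] at this
    nlinarith
  obtain ⟨B, B', hB, hB', hd⟩ := h.exists_frames p k1 k2 (by nlinarith)
  refine ⟨B.orientation, hB, ?_⟩
  have : B.orientation = B'.orientation := by
    rw [Module.Basis.orientation_eq_iff_det_pos, hd]
    nlinarith
  rw [this]
  exact hB'

lemma opposite_of_theta (h : IsBlaschkeSolution f g S) (p : M) (hθ : theta f g p = 0) :
    OppositeOrientations f g p (S p) := by
  obtain ⟨α, β, γ, hγ, e⟩ := BlaschkeLifts.dz_right_of_theta (h.lifts (chartAt_mem p))
    (fun _ => rfl) (pt_mem p) hθ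
  -- `F_z` is written as a `z̄`-derivative with `-F_v` in place of `F_v`, to fit
  -- `real_of_complex_relation`. The determinant is now `|γ|²`, so only the sign from the null
  -- vectors remains.
  have e1 : dz (complexLift f (chartAt ℂ p)) (pt p) = (1 / 2 : ℂ) •
      (toC (du (liftAt f p) (pt p)) + I • toC (-dv (liftAt f p) (pt p))) := by
    rw [(h.conformal_left.dz_liftAt p).1]
    ext i
    simp [toC]
    ring
  have e2 := (h.conformal_right.dz_liftAt p).1
  obtain ⟨k1, k2⟩ := real_of_complex_relation ((e2.symm.trans e).trans
    (congrArg (fun x => α • toC (liftAt g p (pt p)) + β • toC (liftAt f p (pt p)) + γ • x) e1))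
  rw [smul_neg, ← neg_smul] at k1 k2
  have hpos : 0 < γ.re ^ 2 + γ.im ^ 2 := by
    have := Complex.normSq_pos.mpr hγ
    rw [Complex.normSq_apply] at this
    nlinarith
  obtain ⟨B, B', hB, hB', hd⟩ := h.exists_frames p k1 k2 (by nlinarith)
  refine ⟨B.orientation, hB, ?_⟩
  have : B'.orientation = -B.orientation := by
    rw [← Module.Basis.orientation_ne_iff_eq_neg]
    intro hc
    have := (Module.Basis.orientation_eq_iff_det_pos B B').mp hc.symm
    rw [hd] at this
    nlinarith
  rw [← this]
  exact hB'

/-- Around each point there is a coordinate with `θ = 1`, if `ρ = 0`. -/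
lemma exists_chart_theta_one (h : IsBlaschkeSolution f g S) (hρ : ∀ p, rho f g p = 0) (p : M) :
    ∃ e ∈ IsManifold.maximalAtlas 𝓘(ℂ, ℂ) ω M, p ∈ e.source ∧
      ∀ z ∈ e.target, thetaCoord (coordLift f e) (coordLift g e) z = 1 := by
  set e₀ := chartAt ℂ p
  have he₀ : e₀ ∈ IsManifold.maximalAtlas 𝓘(ℂ, ℂ) ω M := chartAt_mem p
  obtain ⟨hN, h1, h2⟩ := h.normalized he₀
  have hr : ∀ z ∈ e₀.target, rhoC (canonicalLift (coordLift f e₀))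
      (normalizedPartner (coordLift f e₀) (coordLift g e₀)) z = 0 := fun z hz => by
    rw [h2 z hz]; exact (h.rho_eq_zero_iff he₀ hz).mp (hρ _)
  have hq : DifferentiableOn ℂ (thetaCoord (coordLift f e₀) (coordLift g e₀)) e₀.target := by
    refine DifferentiableOn.congr (fun z hz => ?_) (fun z hz => (h1 z hz).symm)
    exact (differentiableAt_of_wd (hN.smooth_thetaC hz).diffAt
      (hN.dzb_theta_of_rho hr hz)).differentiableWithinAt
  have hq0 : thetaCoord (coordLift f e₀) (coordLift g e₀) (pt p) ≠ 0 := by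
    rw [← h1 _ (pt_mem p)]
    exact (hN.rhoC_ne_zero_or (pt_mem p)).resolve_left fun hc => hc (hr _ (pt_mem p))
  obtain ⟨ψ, hψ, hsrc, hsub, hψd⟩ := exists_coordinate e₀.open_target (pt_mem p) hq hq0
  set e := e₀ ≫ₕ ψ with he_def
  have he : e ∈ IsManifold.maximalAtlas 𝓘(ℂ, ℂ) ω M := by
    intro e' he'
    obtain ⟨c1, c2⟩ := he₀ e' he'
    refine ⟨?_, ?_⟩
    · rw [he_def, OpenPartialHomeomorph.trans_symm_eq_symm_trans_symm,
        OpenPartialHomeomorph.trans_assoc]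
      exact StructureGroupoid.trans _ (StructureGroupoid.symm _ hψ) c1
    · rw [he_def, ← OpenPartialHomeomorph.trans_assoc]
      exact StructureGroupoid.trans _ c2 hψ
  refine ⟨e, he, ?_, fun z hz => ?_⟩
  · rw [he_def, OpenPartialHomeomorph.trans_source]
    exact ⟨mem_chart_source ℂ p, hsrc⟩
  · have hz' : z ∈ ψ.target := by
      rw [he_def, OpenPartialHomeomorph.trans_target] at hz
      exact hz.1
    set w := ψ.symm z
    have hw : w ∈ ψ.source := ψ.map_target hz'
    have hwt : w ∈ e₀.target := hsub hw
    have hsource : ∀ v ∈ ψ.source, v ∈ (e₀.symm ≫ₕ e).source := by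
      intro v hv
      refine mem_transition_source (hsub hv) ?_
      rw [he_def, OpenPartialHomeomorph.trans_source]
      refine ⟨e₀.map_target (hsub hv), ?_⟩
      change e₀ (e₀.symm v) ∈ ψ.source
      rwa [e₀.right_inv (hsub hv)]
    have hval : ∀ v ∈ ψ.source, (e₀.symm ≫ₕ e) v = ψ v := by
      intro v hv
      change ψ (e₀ (e₀.symm v)) = ψ v
      rw [e₀.right_inv (hsub hv)]
    have hder : deriv (e₀.symm ≫ₕ e) w = deriv ψ w :=
      (Filter.eventuallyEq_of_mem (ψ.open_source.mem_nhds hw) hval).deriv_eq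
    have k1 := (h.conformal_left.coordChange he₀ he (hsource w hw)).thetaB_eq
      (h.conformal_right.coordChange he₀ he (hsource w hw))
    rw [hval w hw, hder, (hψd w hw).2, ψ.right_inv hz'] at k1
    have hne : thetaCoord (coordLift f e₀) (coordLift g e₀) w ≠ 0 := by
      rw [← (hψd w hw).2]
      exact pow_ne_zero 2 (hψd w hw).1
    change thetaCoord (coordLift f e₀) (coordLift g e₀) w = _ * _ at k1
    -- With `θ₀` the coefficient in the old chart, `θ₀ = ψ'² θ` and `ψ'² = θ₀ ≠ 0`, so `θ = 1`.
    exact (mul_eq_left₀ hne).mp k1.symm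

/-- The isothermic case of the generalized Blaschke problem. -/
lemma isDarbouxPair (h : IsBlaschkeSolution f g S) (hρ : ∀ p, rho f g p = 0) :
    IsDarbouxPair f g S := by
  refine ⟨h, fun p => h.compatible_of_rho p (hρ p), fun p => ?_⟩
  obtain ⟨e, he, hp, hθ⟩ := h.exists_chart_theta_one hρ p
  -- The pair is arbitrary so that this also applies to `(g, f)`: an exchange conjugates `ρ` and
  -- preserves `θ`, hence keeps both conditions.
  have key : ∀ {f g : M → Sph n}, IsBlaschkeSolution f g S →
      (∀ z ∈ e.target, rhoCoord (coordLift f e) (coordLift g e) z = 0) →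
      (∀ z ∈ e.target, thetaCoord (coordLift f e) (coordLift g e) z = 1) → ∀ z ∈ e.target,
      IsRealV (hopf (coordLift f e) z) := by
    intro f g h hr ht z hz
    obtain ⟨hN, h1, h2⟩ := h.normalized he
    obtain ⟨c, hc⟩ := hN.dz_dz_of_const_theta (fun w hw => (h2 w hw).trans (hr w hw))
      one_ne_zero (fun w hw => by rw [h1 w hw, ht w hw, Complex.ofReal_one]) hz
    exact isRealV_of_conjV_eq (hN.unitLift.hopfC_real hz hc)
  have hr : ∀ z ∈ e.target, rhoCoord (coordLift f e) (coordLift g e) z = 0 := fun z hz =>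
    (h.rho_eq_zero_iff he hz).mp (hρ _)
  have hr' : ∀ z ∈ e.target, rhoCoord (coordLift g e) (coordLift f e) z = 0 := by
    intro z hz
    have h1 : rhoCoord (coordLift g e) (coordLift f e) z =
      (starRingEnd ℂ) (rhoCoord (coordLift f e) (coordLift g e) z) := (h.lifts he).rhoB_swap hz
    rw [h1, hr z hz, map_zero]
  have hθ' : ∀ z ∈ e.target, thetaCoord (coordLift g e) (coordLift f e) z = 1 := by
    intro z hz
    rw [← hθ z hz]
    exact thetaB_swap _ _ _
  refine ⟨e, he, hp, 1, one_ne_zero, fun z hz => ⟨key h hr hθ z hz, key h.swap hr' hθ' z hz, ?_⟩⟩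
  obtain ⟨hN, h1, h2⟩ := h.normalized he
  have := hN.dz_partner_of_rho (fun w hw => (h2 w hw).trans (hr w hw)) hz
  rw [h1 z hz, hθ z hz] at this
  refine ⟨lam (canonicalLift (coordLift f e))
    (normalizedPartner (coordLift f e) (coordLift g e)) z, ?_⟩
  rw [Complex.ofReal_one]
  exact this

/-- In terms of normalized lifts: `S` is the mean curvature sphere of `f`. -/
lemma eq_meanCurvatureSphere_left_iff (h : IsBlaschkeSolution f g S)
    {e : OpenPartialHomeomorph M ℂ} (he : e ∈ IsManifold.maximalAtlas 𝓘(ℂ, ℂ) ω M) {z : ℂ}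
    (hz : z ∈ e.target) :
    S (e.symm z) = meanCurvatureSphere f (e.symm z) ↔
      dzb (dz (canonicalLift (coordLift f e))) z ∈ WC (S (e.symm z)) := by
  rw [eq_meanCurvatureSphere_iff h.conformal_left h.envelops_left he hz]
  obtain ⟨r, s, hrs, hsm, e1, e2⟩ := BlaschkeLifts.exists_rescaling (h.lifts he) (fun _ => rfl)
  rw [e1]
  exact ((h.lifts he).left.dzb_dz_rescale_mem_iff (fun w hw => (hsm w hw).1) hz
    (by exact_mod_cast (hrs z hz).1)).symm

lemma eq_meanCurvatureSphere_right_iff (h : IsBlaschkeSolution f g S)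
    {e : OpenPartialHomeomorph M ℂ} (he : e ∈ IsManifold.maximalAtlas 𝓘(ℂ, ℂ) ω M) {z : ℂ}
    (hz : z ∈ e.target) :
    S (e.symm z) = meanCurvatureSphere g (e.symm z) ↔
      dzb (dz (normalizedPartner (coordLift f e) (coordLift g e))) z ∈ WC (S (e.symm z)) := by
  rw [eq_meanCurvatureSphere_iff h.conformal_right h.envelops_right he hz]
  obtain ⟨r, s, hrs, hsm, e1, e2⟩ := BlaschkeLifts.exists_rescaling (h.lifts he) (fun _ => rfl)
  rw [e2]
  exact ((h.lifts he).right.dzb_dz_rescale_mem_iff (fun w hw => (hsm w hw).2) hz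
    (by exact_mod_cast (hrs z hz).2)).symm

lemma thetaC_eq_zero (h : IsBlaschkeSolution f g S) (hθ : ∀ p, theta f g p = 0)
    {e : OpenPartialHomeomorph M ℂ} (he : e ∈ IsManifold.maximalAtlas 𝓘(ℂ, ℂ) ω M) :
    ∀ z ∈ e.target, thetaC (canonicalLift (coordLift f e))
      (normalizedPartner (coordLift f e) (coordLift g e)) z = 0 := fun z hz => by
  rw [(h.normalized he).2.1 z hz]
  exact (h.theta_eq_zero_iff he hz).mp (hθ _)

/-- If `θ = 0` and the surfaces are not congruent, `S` is the mean curvature sphere of `f`. -/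
lemma eq_meanCurvatureSphere_of_not_congruent (h : IsBlaschkeSolution f g S)
    (hθ : ∀ p, theta f g p = 0) {p : M} (hc : ¬ MoebiusCongruentNear f g p) :
    S p = meanCurvatureSphere f p := by
  by_contra hS
  apply hc
  set e := chartAt ℂ p
  have he : e ∈ IsManifold.maximalAtlas 𝓘(ℂ, ℂ) ω M := chartAt_mem p
  obtain ⟨hN, -, -⟩ := h.normalized he
  have ht := h.thetaC_eq_zero hθ he
  have hsp : e.symm (pt p) = p := symm_pt p
  have hiff := h.eq_meanCurvatureSphere_left_iff he (pt_mem p)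
  rw [hsp] at hiff
  have hm : meanCurv (canonicalLift (coordLift f e))
      (normalizedPartner (coordLift f e) (coordLift g e)) (pt p) ≠ 0 := by
    rw [Ne, hN.meanCurv_eq_zero_iff (pt_mem p), hsp, ← hiff]
    exact hS
  -- The normal component of `Y_zz̄` stays nonzero on a ball, where `ρ` is therefore real;
  -- connectedness of the ball makes the reflection constant.
  have hev := ((hN.smooth_meanCurv (pt_mem p)).continuousAt.eventually_ne hm).and
    (e.open_target.mem_nhds (pt_mem p))
  obtain ⟨r, hr, hball⟩ := Metric.eventually_nhds_iff_ball.mp hev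
  set V := Metric.ball (pt p) r
  have hVU : V ⊆ e.target := fun z hz => (hball z hz).2
  have hpV : pt p ∈ V := Metric.mem_ball_self hr
  obtain ⟨L, hL, hLc⟩ := (hN.mono Metric.isOpen_ball hVU).exists_congruence
    (fun z hz => ht z (hVU hz)) (fun z hz => hN.rho_real_or ht (hVU hz) (hball z hz).1)
    (convex_ball _ _).isPreconnected hpV
  refine ⟨L, hL, e.source ∩ e ⁻¹' V, e.isOpen_inter_preimage Metric.isOpen_ball,
    ⟨mem_chart_source ℂ p, hpV⟩, fun q hq => ?_⟩
  obtain ⟨r', s, hrs, _, e1, e2⟩ := BlaschkeLifts.exists_rescaling (h.lifts he) (fun _ => rfl)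
  obtain ⟨c, hc0, hceq⟩ := hLc (e q) hq.2
  obtain ⟨hr0, hs0⟩ := hrs (e q) (e.map_source hq.1)
  rw [congrFun e1 (e q), congrFun e2 (e q), ← toC_smul, ← toC_smul, reV_toC, reV_toC, map_smul]
    at hceq
  have vf : coordLift f e (e q) = nullLift (f q) := by rw [coordLift, e.left_inv hq.1]
  have vg : coordLift g e (e q) = nullLift (g q) := by rw [coordLift, e.left_inv hq.1]
  rw [vf, vg] at hceq
  refine ⟨(r' (e q))⁻¹ * (c * s (e q)), mul_ne_zero (inv_ne_zero hr0) (mul_ne_zero hc0 hs0), ?_⟩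
  rw [mul_smul, mul_smul, ← hceq, smul_smul, inv_mul_cancel₀ hr0, one_smul]

lemma dzb_dz_mem_of_eq (h : IsBlaschkeSolution f g S) {U : Set M}
    (hSU : ∀ p ∈ U, S p = meanCurvatureSphere f p) {e : OpenPartialHomeomorph M ℂ}
    (he : e ∈ IsManifold.maximalAtlas 𝓘(ℂ, ℂ) ω M) :
    ∀ z ∈ e.target ∩ e.symm ⁻¹' U,
      dzb (dz (canonicalLift (coordLift f e))) z ∈ WC (S (e.symm z)) := fun _ hz =>
  (h.eq_meanCurvatureSphere_left_iff he hz.1).mp (hSU _ hz.2)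

lemma eq_meanCurvatureSphere_right (h : IsBlaschkeSolution f g S) (hθ : ∀ p, theta f g p = 0)
    {U : Set M} (hSU : ∀ p ∈ U, S p = meanCurvatureSphere f p) {p : M} (hp : p ∈ U) :
    S p = meanCurvatureSphere g p := by
  have he := chartAt_mem p
  have hsp := symm_pt p
  have hz : pt p ∈ (chartAt ℂ p).target ∩ (chartAt ℂ p).symm ⁻¹' U :=
    ⟨pt_mem p, by rw [Set.mem_preimage, hsp]; exact hp⟩
  have hiff := h.eq_meanCurvatureSphere_right_iff he (pt_mem p)
  rw [hsp] at hiff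
  rw [hiff]
  have h1 := (h.normalized he).1.dzb_dz_partner_mem (h.thetaC_eq_zero hθ he) (pt_mem p)
    (h.dzb_dz_mem_of_eq hSU he _ hz)
  rwa [hsp] at h1

lemma isSWillmoreAt (h : IsBlaschkeSolution f g S) (hθ : ∀ p, theta f g p = 0)
    {U : Set M} (hU : IsOpen U) (hSU : ∀ p ∈ U, S p = meanCurvatureSphere f p) {p : M}
    (hp : p ∈ U) : IsSWillmoreAt f p := by
  have he := chartAt_mem p
  have hsp := symm_pt p
  set V := (chartAt ℂ p).target ∩ (chartAt ℂ p).symm ⁻¹' U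
  have hz : pt p ∈ V := ⟨pt_mem p, by rw [Set.mem_preimage, hsp]; exact hp⟩
  have hN := (h.normalized he).1.mono ((chartAt ℂ p).isOpen_inter_preimage_symm hU)
    Set.inter_subset_left
  have ht : ∀ z ∈ V, _ := fun z hz => h.thetaC_eq_zero hθ he z hz.1
  have hm := h.dzb_dz_mem_of_eq hSU he
  refine ⟨hN.willmore ht hm hz, fun hli => ?_⟩
  have h1 := hN.normal_dzb_hopfC ht hm hz
  -- `λ̄ κ + D_z̄ κ = 0` is a linear relation with a coefficient `1`, nontrivial even where `κ`
  -- vanishes.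
  have h2 := LinearIndependent.pair_iff.mp hli
    (lamb (canonicalLift (coordLift f (chartAt ℂ p)))
      (normalizedPartner (coordLift f (chartAt ℂ p)) (coordLift g (chartAt ℂ p))) (pt p)) 1 (by
    rw [one_smul]
    change _ • hopfC (canonicalLift (coordLift f (chartAt ℂ p))) (pt p) +
      normalProjC (canonicalLift (coordLift f (chartAt ℂ p))) (pt p)
        (dzb (hopfC (canonicalLift (coordLift f (chartAt ℂ p)))) (pt p)) = 0
    rw [h1]
    module)
  exact one_ne_zero h2.2

end IsBlaschkeSolution

end Surfaces

end MoebiusSurf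

end

theorem mainTheorem4 {M : Type*} [TopologicalSpace M] [ChartedSpace ℂ M]
    [IsManifold 𝓘(ℂ, ℂ) ω M] {n : ℕ}
    (f g : M → MoebiusSurf.Sph n) (S : M → Submodule ℝ (MoebiusSurf.Mink n))
    (hsol : MoebiusSurf.IsBlaschkeSolution f g S) :
    -- at every point exactly one of the two cases occurs
    (∀ p, Xor (MoebiusSurf.rho f g p = 0) (MoebiusSurf.theta f g p = 0)) ∧
    -- the isothermic case
    (∀ p, MoebiusSurf.rho f g p = 0 → MoebiusSurf.CompatibleOrientations f g p (S p)) ∧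
    ((∀ p, MoebiusSurf.rho f g p = 0) → MoebiusSurf.IsDarbouxPair f g S) ∧
    -- the S-Willmore case
    (∀ p, MoebiusSurf.theta f g p = 0 → MoebiusSurf.OppositeOrientations f g p (S p)) ∧
    ((∀ p, MoebiusSurf.theta f g p = 0) →
      (∀ p, ¬ MoebiusSurf.MoebiusCongruentNear f g p →
        S p = MoebiusSurf.meanCurvatureSphere f p ∧
        S p = MoebiusSurf.meanCurvatureSphere g p) ∧
      (∀ U : Set M, IsOpen U →
        (∀ p ∈ U, S p = MoebiusSurf.meanCurvatureSphere f p) →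
        ∀ p ∈ U, S p = MoebiusSurf.meanCurvatureSphere g p ∧
          MoebiusSurf.IsSWillmoreAt f p ∧ MoebiusSurf.IsSWillmoreAt g p)) := by
  refine ⟨hsol.xor_rho_theta, hsol.compatible_of_rho, hsol.isDarbouxPair, hsol.opposite_of_theta,
    fun hθ => ⟨fun p hp => ?_, fun U hU hSU p hp => ?_⟩⟩
  -- `θ = 0` and local congruence are symmetric in the two surfaces, so the statement for the second
  -- one follows by exchanging them.
  · have hθ' : ∀ p, MoebiusSurf.theta g f p = 0 := fun p => by
      rw [MoebiusSurf.theta_swap, hθ]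
    exact ⟨hsol.eq_meanCurvatureSphere_of_not_congruent hθ hp,
      hsol.swap.eq_meanCurvatureSphere_of_not_congruent hθ' fun hc => hp hc.symm⟩
  · have hθ' : ∀ p, MoebiusSurf.theta g f p = 0 := fun p => by
      rw [MoebiusSurf.theta_swap, hθ]
    -- The exchange for the S-Willmore property needs this on all of the open set, since the
    -- Willmore equation involves derivatives.
    have hSg : ∀ q ∈ U, S q = MoebiusSurf.meanCurvatureSphere g q := fun q hq =>
      hsol.eq_meanCurvatureSphere_right hθ hSU hq
    exact ⟨hSg p hp, hsol.isSWillmoreAt hθ hU hSU hp, hsol.swap.isSWillmoreAt hθ' hU hSg hp⟩
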